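/- **Setting.** In a finite undirected (multi)graph $G=(\mathcal V,\mathcal E)$ a *finite path* $\sigma$ is a finite walk, from its entrance $\mathrm{ent}(\sigma)$ to its exit $\mathrm{exi}(\sigma)$ (trivial paths of length $0$ are allowed); $n(\sigma,e)$ is the number of times $\sigma$ traverses the edge $e$, in either direction. A *path-flow* is a finite nonnegative measure $\mu$ on the set of finite paths. Its *transportation measure* $\mathrm{tra}(\mu)$ is the push-forward of $\mu$ under $\sigma\mapsto(\mathrm{ent}(\sigma),\mathrm{exi}(\sigma))$, and its *flow-volume* is $\mathrm{flo}(\mu)=\big(\int n(\sigma,e)\,\mu(d\sigma)\big)_{e\in\mathcal E}$. An *environment* is a family $\mathbf c=(c(e))_{e\in\mathcal E}$ of nonnegative reals, and $\mathrm{cost}(\mathbf f,\mathbf c)=\sum_{e}c(e)f(e)^2$. Let $\kappa$ be a probability distribution with $\kappa[0,c^*]=1$ for some $0<c^*<\infty$, and let $B>\frac14$. **Torus.** The $N\times N$ torus has vertex set $[0,N-1]^2$ and $2N^2$ edges, one from each $(i,j)$ to $(i+1,j)$ and one from each $(i,j)$ to $(i,j+1)$, modulo $N$. A *standardized global flow*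 is the flow-volume of a path-flow $\mu$ on it with $\mathrm{tra}(\mu)(v,w)=N^{-3}$ for all vertices $v,w$. On the torus $\mathbb E$ is the expectation when the $c(e)$ are i.i.d. with law $\kappa$. **Square.** For $M\ge1$ the *extended $M\times M$ square* consists of the lattice square $[0,M-1]^2$ with its nearest-neighbour edges, and of $4M$ boundary points $(-\frac12,j)$, $(M-\frac12,j)$, $(i,-\frac12)$, $(i,M-\frac12)$ with $0\le i,j\le M-1$ (left, right, bottom, top), each joined by a half-edge to the nearest vertex of the square. Let $\mathrm{Bou}_M$ be the set of boundary points and $b\mapsto b^{\mathrm{reflect}}$ the reflection of $\mathrm{Bou}_M$ exchanging left with right and bottom with top. Let $\mathcal Q_M$ be the set of finite measures $Q$ on $\mathrm{Bou}_M\times\mathrm{Bou}_M$ such that the push-forward of the second (exit) marginal under $b\mapsto b^{\mathrm{reflect}}$ equals the first (entrance) marginal, and put $$\mathrm{drift}(Q)=\frac1{M^2}\sum_{b_1,b_2}(b_2-b_1)\,Q(b_1,b_2)\in\mathbb R^2 .$$ Let $\mathcal Q_M^{\mathrm{iso}}$ be the set of finite measures $Q_0=\int Q\,\psi(dQ)$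 where $\psi$ is a probability distribution on $\mathcal Q_M$ under which $\mathrm{drift}(Q)$ modulo $(1,1)$ is uniformly distributed on $[0,1]^2$. For a finite measure $Q$ on $\mathrm{Bou}_M\times\mathrm{Bou}_M$ let $$\mathrm{cost}_{M,B}(Q,\mathbf c)=\inf\{\mathrm{cost}(\mathrm{flo}(\mu),\mathbf c):\ \mathrm{tra}(\mu)=Q,\ \max_e\mathrm{flo}(\mu)(e)\le B\}$$ over path-flows $\mu$ on the extended square ($\inf\emptyset=\infty$), and $$c_{M,B}=\inf\{\mathbb E\,\mathrm{cost}_{M,B}(Q,\mathbf c):\ Q\in\mathcal Q_M^{\mathrm{iso}}\},$$ where here the $c(e)$ are i.i.d. with law $\kappa$ over the internal edges and the half-edges on the left and bottom sides, and $c(e)=0$ on the half-edges on the right and top sides. **Proposition 17.** There exist, for all $N$ and all environments $\mathbf c$ on the $N\times N$ torus, standardized global flows $\mathbf f(\cdot\mid\mathbf c)$ on the $N\times N$ torus, depending measurably on $\mathbf c$, such that $\max_e f(e\mid\mathbf c)\le B$ and such that, for each fixed $M\ge1$, $$\limsup_{N\to\infty}N^{-2}\,\mathbb E\,\mathrm{cost}(\mathbf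 f(\cdot\mid\mathbf c),\mathbf c)\le M^{-2}c_{M,B}.$$ -/

import Mathlib

open MeasureTheory Filter
open scoped NNReal ENNReal

namespace RoutingFlow

noncomputable section

/-! ### Paths, path-flows, flow-volumes and costs on a finite multigraph -/

section General

variable {V E : Type}

/-- The multigraph on all of `V` whose edge `e` joins the two components of `ends e`.
Edges are undirected: the order of the two ends plays no role. -/
def graphOfEnds (ends : E → V × V) : Graph V E where
  vertexSet := Set.univ
  IsLink e x y := ends e = (x, y) ∨ ends e = (y, x)
  isLink_symm := fun _ _ => ⟨fun _ _ h => h.symm⟩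
  eq_or_eq_of_isLink_of_isLink := by
    rintro e x y v w (h | h) (h' | h') <;> rw [h] at h' <;> simp only [Prod.mk.injEq] at h' <;> tauto
  left_mem_of_isLink := fun _ _ _ _ => trivial

/-- Finite paths `u = v₀, e₁, v₁, …, e_k, v_k = w` in `G` from `u` to `w`. -/
inductive PathFromTo (G : Graph V E) : V → V → Type
  | nil (v : V) (hv : v ∈ G.vertexSet) : PathFromTo G v v
  | cons {u v w : V} (e : E) (h : G.IsLink e u v) (p : PathFromTo G v w) : PathFromTo G u w

/-- The list of edges of a path, in order of traversal. -/
def PathFromTo.edges {G : Graph V E} : {u w : V} → PathFromTo G u w → List E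
  | _, _, .nil _ _ => []
  | _, _, .cons e _ p => e :: p.edges

/-- The set `Σ` of all finite paths of `G`. -/
structure FinPath (G : Graph V E) where
  /-- the entrance (source) -/
  ent : V
  /-- the exit (destination) -/
  exi : V
  /-- the path itself -/
  path : PathFromTo G ent exi

/-- The path space is discrete (it is countable whenever the graph is finite). -/
instance (G : Graph V E) : MeasurableSpace (FinPath G) := ⊤

open Classical in
/-- `n(σ, e)`: the number of times that `e` occurs, in either direction, in `σ`. -/
def FinPath.n {G : Graph V E} (σ : FinPath G) (e : E) : ℕ := σ.path.edges.count e

/-- The transportation measure `tra(μ)`, given by its point masses: the mass at `(v, w)` of the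
push-forward of `μ` under `σ ↦ (ent σ, exi σ)`. -/
def tra {G : Graph V E} (μ : Measure (FinPath G)) (v w : V) : ℝ≥0∞ :=
  μ {σ | σ.ent = v ∧ σ.exi = w}

/-- The flow-volume `flo(μ)`. -/
def flo {G : Graph V E} (μ : Measure (FinPath G)) (e : E) : ℝ≥0∞ :=
  ∫⁻ σ, (σ.n e : ℝ≥0∞) ∂μ

/-- The cost `∑ₑ c(e) f(e)²` of the flow-volume `f` in the environment `c`. -/
def cost [Fintype E] (f : E → ℝ≥0∞) (c : E → ℝ≥0) : ℝ≥0∞ :=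
  ∑ e, (c e : ℝ≥0∞) * f e ^ 2

end General

/-! ### The `N × N` torus -/

/-- Vertices `[0, N-1]²` of the torus. -/
abbrev TorusVertex (N : ℕ) : Type := Fin N × Fin N

/-- The `2N²` edges of the torus: `inl (i, j)` is the edge from `(i, j)` to `(i+1, j)` and
`inr (i, j)` the edge from `(i, j)` to `(i, j+1)`, modulo `N`. -/
abbrev TorusEdge (N : ℕ) : Type := (Fin N × Fin N) ⊕ (Fin N × Fin N)

/-- `i + 1` modulo `N`. -/
def cyclicSucc {N : ℕ} (i : Fin N) : Fin N := ⟨(i.val + 1) % N, Nat.mod_lt _ i.pos⟩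

/-- The two ends of an edge of the torus. -/
def torusEnds (N : ℕ) : TorusEdge N → TorusVertex N × TorusVertex N
  | .inl (i, j) => ((i, j), (cyclicSucc i, j))
  | .inr (i, j) => ((i, j), (i, cyclicSucc j))

/-- The discrete torus. For `N ≥ 3` it is a simple graph; for `N = 2` it has double edges and for
`N = 1` loops, so that it always has `2N²` edges. -/
def torus (N : ℕ) : Graph (TorusVertex N) (TorusEdge N) := graphOfEnds (torusEnds N)

/-- `f` is the flow-volume of a path-flow (a finite measure on paths) which carries volume `N⁻³`
between every source-destination pair. -/
def IsStandardizedGlobalFlow (N : ℕ) (f : TorusEdge N → ℝ≥0∞) : Prop :=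
  ∃ μ : Measure (FinPath (torus N)), IsFiniteMeasure μ ∧
    (∀ v w : TorusVertex N, tra μ v w = ((N : ℝ≥0∞) ^ 3)⁻¹) ∧ f = flo μ

/-- The law of the i.i.d. (`κ`) environment on the torus. -/
def torusEnvLaw (κ : Measure ℝ≥0) (N : ℕ) : Measure (TorusEdge N → ℝ≥0) :=
  Measure.pi fun _ => κ

/-! ### The extended `M × M` square -/

/-- The four sides of the square. -/
inductive Side
  | left | right | bottom | top
  deriving DecidableEq

instance : Fintype Side := ⟨{.left, .right, .bottom, .top}, by rintro (_ | _ | _ | _) <;> decide⟩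

/-- The opposite side. -/
def Side.opposite : Side → Side
  | .left => .right
  | .right => .left
  | .bottom => .top
  | .top => .bottom

/-- The `4M` boundary points: a side, and a position along that side. -/
abbrev Bou (M : ℕ) : Type := Side × Fin M

/-- The coordinates of a boundary point: `(-1/2, j)`, `(M - 1/2, j)`, `(i, -1/2)` or
`(i, M - 1/2)`. -/
def Bou.pos {M : ℕ} : Bou M → ℝ × ℝ
  | (.left, j) => (-1 / 2, (j : ℕ))
  | (.right, j) => ((M : ℝ) - 1 / 2, (j : ℕ))
  | (.bottom, i) => ((i : ℕ), -1 / 2)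
  | (.top, i) => ((i : ℕ), (M : ℝ) - 1 / 2)

/-- Reflection of a boundary point left-to-right or top-to-bottom. -/
def Bou.reflect {M : ℕ} (b : Bou M) : Bou M := (b.1.opposite, b.2)

/-- The vertex of the `M × M` square to which a boundary point is attached. -/
def Bou.inner {M : ℕ} : Bou M → Fin M × Fin M
  | (.left, j) => (⟨0, j.pos⟩, j)
  | (.right, j) => (⟨M - 1, Nat.sub_lt j.pos Nat.one_pos⟩, j)
  | (.bottom, i) => (i, ⟨0, i.pos⟩)
  | (.top, i) => (i, ⟨M - 1, Nat.sub_lt i.pos Nat.one_pos⟩)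

/-- Vertices of the extended square: internal vertices (`inl`) and boundary points (`inr`). -/
abbrev SquareVertex (M : ℕ) : Type := (Fin M × Fin M) ⊕ Bou M

/-- Edges of the extended square: `inl (inl (i, j))` joins `(i, j)` and `(i+1, j)`,
`inl (inr (i, j))` joins `(i, j)` and `(i, j+1)`, and `inr b` is the half-edge ending at the
boundary point `b`. -/
abbrev SquareEdge (M : ℕ) : Type :=
  ((Fin (M - 1) × Fin M) ⊕ (Fin M × Fin (M - 1))) ⊕ Bou M

/-- The two ends of an edge of the extended square. -/
def squareEnds (M : ℕ) : SquareEdge M → SquareVertex M × SquareVertex M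
  | .inl (.inl (i, j)) =>
      (.inl (⟨i.val, by have := i.isLt; omega⟩, j), .inl (⟨i.val + 1, by have := i.isLt; omega⟩, j))
  | .inl (.inr (i, j)) =>
      (.inl (i, ⟨j.val, by have := j.isLt; omega⟩), .inl (i, ⟨j.val + 1, by have := j.isLt; omega⟩))
  | .inr b => (.inr b, .inl b.inner)

/-- The extended `M × M` square. -/
def square (M : ℕ) : Graph (SquareVertex M) (SquareEdge M) := graphOfEnds (squareEnds M)

/-- A (finite) transportation measure on `Bou_M × Bou_M`, given by its point masses. -/
abbrev Transport (M : ℕ) : Type := Bou M → Bou M → ℝ≥0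

/-- The entrance marginal. -/
def Transport.entMarginal {M : ℕ} (Q : Transport M) (b : Bou M) : ℝ≥0 := ∑ b', Q b b'

/-- The exit marginal. -/
def Transport.exiMarginal {M : ℕ} (Q : Transport M) (b : Bou M) : ℝ≥0 := ∑ b', Q b' b

/-- `𝒬_M`: the push-forward of the exit marginal under `b ↦ b.reflect` is the entrance marginal. -/
def balanced (M : ℕ) : Set (Transport M) :=
  {Q | ∀ b : Bou M, ∑ b' with b'.reflect = b, Q.exiMarginal b' = Q.entMarginal b}

/-- `drift(Q) = M⁻² ∑ (b₂ - b₁) Q(b₁, b₂)`. -/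
def drift {M : ℕ} (Q : Transport M) : ℝ × ℝ :=
  ((M : ℝ) ^ 2)⁻¹ • ∑ b₁ : Bou M, ∑ b₂ : Bou M, (Q b₁ b₂ : ℝ) • (b₂.pos - b₁.pos)

/-- `drift(Q)` modulo `(1, 1)`, as a point of `[0, 1)²`. -/
def driftMod {M : ℕ} (Q : Transport M) : ℝ × ℝ := (Int.fract (drift Q).1, Int.fract (drift Q).2)

/-- The isotropic transportation measures: mixtures `Q₀ = ∫ Q ψ(dQ)` for a probability law `ψ` on
`𝒬_M` under which `drift(Q)` modulo `(1, 1)` is uniform on the unit square. -/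
def isotropic (M : ℕ) : Set (Transport M) :=
  {Q₀ | ∃ ψ : Measure (Transport M), IsProbabilityMeasure ψ ∧
    (∀ᵐ Q ∂ψ, Q ∈ balanced M) ∧
    (∀ b₁ b₂ : Bou M, (Q₀ b₁ b₂ : ℝ≥0∞) = ∫⁻ Q, (Q b₁ b₂ : ℝ≥0∞) ∂ψ) ∧
    ψ.map driftMod = volume.restrict (Set.Icc (0 : ℝ) 1 ×ˢ Set.Icc (0 : ℝ) 1)}

/-- A transportation measure on `Bou_M × Bou_M`, regarded as a measure (by its point masses) on
pairs of vertices of the extended square. -/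
def Transport.extend {M : ℕ} (Q : Transport M) : SquareVertex M → SquareVertex M → ℝ≥0∞
  | .inr b₁, .inr b₂ => Q b₁ b₂
  | _, _ => 0

/-- `cost_{M,B}(Q, c)`: the infimum of the cost over all path-flows across the extended square with
transportation measure `Q` and all edge-flows at most `B`; it is `∞` if there are none. -/
def squareCost (M : ℕ) (B : ℝ≥0) (Q : Transport M) (c : SquareEdge M → ℝ≥0) : ℝ≥0∞ :=
  ⨅ μ ∈ {μ : Measure (FinPath (square M)) |
      IsFiniteMeasure μ ∧ (∀ v w, tra μ v w = Q.extend v w) ∧ ∀ e, flo μ e ≤ B},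
    cost (flo μ) c

/-- The law of the random environment on the extended square: independent cost-factors with law `κ`
on internal edges and on the half-edges on the left and bottom sides, and cost-factor `0` on the
half-edges on the right and top sides. -/
def squareEnvLaw (κ : Measure ℝ≥0) (M : ℕ) : Measure (SquareEdge M → ℝ≥0) :=
  Measure.pi fun e => match e with
    | .inl _ => κ
    | .inr (.left, _) => κ
    | .inr (.bottom, _) => κ
    | .inr (.right, _) => Measure.dirac 0
    | .inr (.top, _) => Measure.dirac 0

/-- The constant `c_{M,B}`: the infimum of `𝔼 cost_{M,B}(Q, c)` over isotropic `Q`. -/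
def localCost (κ : Measure ℝ≥0) (B : ℝ≥0) (M : ℕ) : ℝ≥0∞ :=
  ⨅ Q ∈ isotropic M, ∫⁻ c, squareCost M B Q c ∂(squareEnvLaw κ M)

end

end RoutingFlow

/-! Cut the torus into `K × K` blocks of side `M`, with `K = N / M`, leaving a strip of width less
than `M`. An isotropic `Q₀` is a mixture of balanced measures whose drifts are uniform modulo 1. A
balanced `Q`, scaled by `N / M²`, unrolls into one long itinerary: apart from boundedly many
mismatches, each exit from a block is the entrance of the next one, and `M` times the displacement
in blocks is `N * drift Q` up to a bounded error. Started anywhere, it ends near the starting point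
shifted by `N * drift Q`. As the drifts equidistribute, the demand with displacement `w - v` can be
given to the components whose drift matches it.

Summed over all sources and destinations, every block then has to carry at most the transport `Q₀`,
so each block may use a near-optimal path-flow for the environment it sees. All the rest (getting to
the first gate and from the last one, repairing mismatches, crossing the strip, demand left over)
has volume `o(N²)`. Averaging the construction over all translations of the torus brings the rest
down to `o(1)` per edge, and by convexity of the cost the main part costs at most the average over
translates, whose expectation is at most `(N / M)²` local costs. Mixing in a little shortest-path
flow, which loads no edge by more than `1/4 < B`, restores the capacity constraint.

The feasible flows on the torus do not involve `M`. Hence one measurable choice within 1 of the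
optimum (`exists_measurable_selection`) serves all `M`.

The weight rests on `exists_itinerary` (Birkhoff's theorem on doubly stochastic matrices),
`exists_discretization`, `displacement_near_drift` with `cdist_endpoint_le`, `mainPart_le`,
`vol_restPart_le`, and `map_blockEnv`; `exists_global_flow` and `exists_feasible_cost_le` put them
together. -/

namespace RoutingFlow
noncomputable section

/-! ### Calculus of unit flows: concatenation, mixture, image, superposition, conditioning. -/

section UnitFlows

variable {V E V' E' : Type} {G : Graph V E} {G' : Graph V' E'}

open Classical in
/-- The number of traversals of `e` by a path. -/
def PathFromTo.num {u w : V} (p : PathFromTo G u w) (e : E) : ℕ := p.edges.count e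

lemma PathFromTo.num_nil (v : V) (hv : v ∈ G.vertexSet) (e : E) :
    (PathFromTo.nil (G := G) v hv).num e = 0 := rfl

open Classical in
lemma PathFromTo.num_cons {u v w : V} (a : E) (h : G.IsLink a u v) (p : PathFromTo G v w) (e : E) :
    (PathFromTo.cons a h p).num e = p.num e + if a = e then 1 else 0 := by
  unfold PathFromTo.num
  rw [PathFromTo.edges, List.count_cons]
  simp

/-- Concatenation of paths. -/
def PathFromTo.append {u v w : V} : PathFromTo G u v → PathFromTo G v w → PathFromTo G u w
  | .nil _ _, q => q
  | .cons e h p, q => .cons e h (p.append q)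

lemma PathFromTo.num_append {u v w : V} (p : PathFromTo G u v) (q : PathFromTo G v w) (e : E) :
    (p.append q).num e = p.num e + q.num e := by
  induction p with
  | nil => simp [PathFromTo.append, PathFromTo.num_nil]
  | cons a h p ih => simp only [PathFromTo.append, PathFromTo.num_cons, ih]; ring

/-- `f` is the flow-volume of a probability distribution on paths from `v` to `w`. -/
def UnitFlow (G : Graph V E) (v w : V) (f : E → ℝ≥0∞) : Prop :=
  ∃ (ι : Type) (p : ι → ℝ≥0∞) (γ : ι → PathFromTo G v w),
    ∑' i, p i = 1 ∧ ∀ e, ∑' i, p i * ((γ i).num e : ℝ≥0∞) = f e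

lemma UnitFlow.of_path {v w : V} (p : PathFromTo G v w) :
    UnitFlow G v w fun e => (p.num e : ℝ≥0∞) :=
  ⟨Unit, fun _ => 1, fun _ => p, by simp, by simp⟩

lemma UnitFlow.refl {v : V} (hv : v ∈ G.vertexSet) : UnitFlow G v v 0 := by
  convert UnitFlow.of_path (PathFromTo.nil (G := G) v hv) using 1
  ext e
  simp [PathFromTo.num_nil]

lemma UnitFlow.trans {u v w : V} {f g : E → ℝ≥0∞} (hf : UnitFlow G u v f)
    (hg : UnitFlow G v w g) : UnitFlow G u w (f + g) := by
  obtain ⟨ι, p, γ, hp, hf⟩ := hf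
  obtain ⟨κ, q, δ, hq, hg⟩ := hg
  refine ⟨ι × κ, fun x => p x.1 * q x.2, fun x => (γ x.1).append (δ x.2), ?_, fun e => ?_⟩
  · rw [ENNReal.tsum_prod (f := fun i j => p i * q j)]
    simp [ENNReal.tsum_mul_left, hp, hq]
  · have h1 : ∑' x : ι × κ, (p x.1 * (γ x.1).num e) * q x.2 = f e := by
      rw [ENNReal.tsum_prod (f := fun i j => (p i * (γ i).num e) * q j)]
      simp [ENNReal.tsum_mul_left, hq, hf]
    have h2 : ∑' x : ι × κ, p x.1 * (q x.2 * (δ x.2).num e) = g e := by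
      rw [ENNReal.tsum_prod (f := fun i j => p i * (q j * (δ j).num e))]
      simp [ENNReal.tsum_mul_left, ENNReal.tsum_mul_right, hp, hg]
    rw [Pi.add_apply, ← h1, ← h2, ← ENNReal.tsum_add]
    refine tsum_congr fun x => ?_
    rw [PathFromTo.num_append]
    push_cast
    ring

lemma UnitFlow.sum {J : Type} [Fintype J] {v w : V} {m : J → ℝ≥0∞} {f : J → E → ℝ≥0∞}
    (hm : ∑ j, m j = 1) (hf : ∀ j, UnitFlow G v w (f j)) :
    UnitFlow G v w fun e => ∑ j, m j * f j e := by
  choose ι p γ hp hf using hf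
  refine ⟨Σ j, ι j, fun x => m x.1 * p x.1 x.2, fun x => γ x.1 x.2, ?_, fun e => ?_⟩
  · rw [ENNReal.tsum_sigma (f := fun j i => m j * p j i)]
    simp [ENNReal.tsum_mul_left, hp, hm]
  · beta_reduce
    rw [← tsum_fintype (L := SummationFilter.unconditional _)]
    rw [ENNReal.tsum_sigma (f := fun j i => m j * p j i * (γ j i).num e)]
    refine tsum_congr fun j => ?_
    rw [← hf, ← ENNReal.tsum_mul_left]
    exact tsum_congr fun i => by ring

open Classical in
/-- The image of a flow under a map of edges; the edges in `S` are contracted. -/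
def pushFlow [Fintype E] (S : Set E) (ε : E → E') (f : E → ℝ≥0∞) (e' : E') : ℝ≥0∞ :=
  ∑ e with e ∉ S ∧ ε e = e', f e

-- Edges of `S` vanish from the image path because `φ` identifies their two ends.
open Classical in
lemma PathFromTo.exists_map [Fintype E] {φ : V → V'} {S : Set E} {ε : E → E'}
    (hV : ∀ v, φ v ∈ G'.vertexSet)
    (hS : ∀ e ∈ S, ∀ x y, G.IsLink e x y → φ x = φ y)
    (hε : ∀ e ∉ S, ∀ x y, G.IsLink e x y → G'.IsLink (ε e) (φ x) (φ y))
    {u w : V} (p : PathFromTo G u w) :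
    ∃ p' : PathFromTo G' (φ u) (φ w), ∀ e', p'.num e' = ∑ e with e ∉ S ∧ ε e = e', p.num e := by
  induction p with
  | nil v hv => exact ⟨.nil _ (hV v), fun e' => by simp [PathFromTo.num_nil]⟩
  | @cons u v w a h p ih =>
    obtain ⟨p', hp'⟩ := ih
    by_cases ha : a ∈ S
    · have := hS a ha _ _ h
      refine ⟨this ▸ p', fun e' => ?_⟩
      have h1 : (this ▸ p' : PathFromTo G' (φ u) (φ w)).num e' = p'.num e' := by
        generalize φ u = x at this
        subst this
        rfl
      rw [h1, hp']
      refine Finset.sum_congr rfl fun e he => ?_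
      rw [PathFromTo.num_cons, if_neg, add_zero]
      rintro rfl
      simp [ha] at he
    · refine ⟨.cons (ε a) (hε a ha _ _ h) p', fun e' => ?_⟩
      rw [PathFromTo.num_cons, hp']
      simp only [PathFromTo.num_cons, Finset.sum_add_distrib, Finset.sum_ite_eq]
      simp [ha]

lemma UnitFlow.map [Fintype E] {φ : V → V'} {S : Set E} {ε : E → E'}
    (hV : ∀ v, φ v ∈ G'.vertexSet)
    (hS : ∀ e ∈ S, ∀ x y, G.IsLink e x y → φ x = φ y)
    (hε : ∀ e ∉ S, ∀ x y, G.IsLink e x y → G'.IsLink (ε e) (φ x) (φ y))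
    {v w : V} {f : E → ℝ≥0∞} (hf : UnitFlow G v w f) :
    UnitFlow G' (φ v) (φ w) (pushFlow S ε f) := by
  classical
  obtain ⟨ι, p, γ, hp, hf⟩ := hf
  choose δ hδ using fun i => (γ i).exists_map hV hS hε
  refine ⟨ι, p, δ, hp, fun e' => ?_⟩
  unfold pushFlow
  simp_rw [← hf, hδ, Nat.cast_sum, Finset.mul_sum]
  exact Summable.tsum_finsetSum fun _ _ => ENNReal.summable

/-- Superposition of unit flows as a path-flow. -/
lemma exists_measure_of_unitFlow [Fintype V] {T : V → V → ℝ≥0∞} {F : V → V → E → ℝ≥0∞}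
    (hT : ∀ v w, T v w ≠ ∞) (hF : ∀ v w, UnitFlow G v w (F v w)) :
    ∃ μ : Measure (FinPath G), IsFiniteMeasure μ ∧ (∀ v w, tra μ v w = T v w) ∧
      flo μ = fun e => ∑ v, ∑ w, T v w * F v w e := by
  classical
  choose ι p γ hp hF using hF
  let μ : V → V → Measure (FinPath G) := fun v w =>
    T v w • Measure.sum fun i => p v w i • Measure.dirac ⟨v, w, γ v w i⟩
  have hμ : ∀ v w (s : Set (FinPath G)), μ v w s =
      T v w * ∑' i, p v w i * s.indicator 1 (⟨v, w, γ v w i⟩ : FinPath G) := by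
    intro v w s
    have hs : MeasurableSet s := trivial
    simp [μ, Measure.sum_apply _ hs, Measure.dirac_apply' _ hs]
  refine ⟨∑ v, ∑ w, μ v w, ⟨?_⟩, fun v w => ?_, ?_⟩
  · simp only [Measure.finsetSum_apply, hμ]
    simp only [Set.indicator_univ, Pi.one_apply, mul_one, hp]
    exact ENNReal.sum_lt_top.2 fun v _ => ENNReal.sum_lt_top.2 fun w _ => (hT v w).lt_top
  · unfold tra
    simp only [Measure.finsetSum_apply, hμ]
    rw [Finset.sum_eq_single v, Finset.sum_eq_single w]
    · simp [hp]
    · intro b _ hb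
      simp [hb]
    · simp
    · intro b _ hb
      simp [hb]
    · simp
  · ext e
    have : ∀ v w, flo (μ v w) e = T v w * F v w e := by
      intro v w
      rw [← hF]
      simp only [flo, μ, lintegral_smul_measure, lintegral_sum_measure, smul_eq_mul]
      congr 1
      refine tsum_congr fun i => ?_
      rw [lintegral_dirac' _ measurable_from_top]
      rfl
    simp_rw [← this]
    simp [flo]

/-- The edges and the vertices that follow them, in order along a path. -/
def PathFromTo.code : {u w : V} → PathFromTo G u w → List (E × V)
  | _, _, .nil _ _ => []
  | _, _, .cons (v := v) e _ p => (e, v) :: p.code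

/-- Makes the path space countable, so that integrals over it become sums. -/
lemma PathFromTo.code_inj {u w w' : V} (p : PathFromTo G u w) (q : PathFromTo G u w')
    (h : p.code = q.code) : (⟨u, w, p⟩ : FinPath G) = ⟨u, w', q⟩ := by
  induction p with
  | nil => cases q with
    | nil => rfl
    | cons => simp [PathFromTo.code] at h
  | cons e hl p ih => cases q with
    | nil => simp [PathFromTo.code] at h
    | cons e' hl' q =>
      simp only [PathFromTo.code, List.cons.injEq, Prod.mk.injEq] at h
      obtain ⟨⟨rfl, rfl⟩, h⟩ := h
      have := ih q h
      simp only [FinPath.mk.injEq, true_and] at this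
      obtain ⟨rfl, h2⟩ := this
      cases h2
      rfl

instance [Countable V] [Countable E] : Countable (FinPath G) := by
  refine Function.Injective.countable (f := fun σ : FinPath G => (σ.ent, σ.path.code)) ?_
  rintro ⟨u, w, p⟩ ⟨u', w', q⟩ h
  simp only [Prod.mk.injEq] at h
  obtain ⟨rfl, h⟩ := h
  exact p.code_inj q h

/-- Conditioning a path-flow on the end points. -/
lemma exists_unitFlow_of_measure [Countable V] [Countable E] {β : Type} [Fintype β] {ι : β → V}
    (hι : ι.Injective) (μ : Measure (FinPath G)) (hμ : IsFiniteMeasure μ) :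
    ∃ g : β → β → E → ℝ≥0∞,
      (∀ a b, tra μ (ι a) (ι b) ≠ 0 → UnitFlow G (ι a) (ι b) (g a b)) ∧
      ∀ e, ∑ a, ∑ b, tra μ (ι a) (ι b) * g a b e ≤ flo μ e := by
  classical
  let S : β → β → Set (FinPath G) := fun a b => {σ | σ.ent = ι a ∧ σ.exi = ι b}
  have hT : ∀ a b, tra μ (ι a) (ι b) ≠ ∞ := fun a b => measure_ne_top μ _
  have hflo : ∀ s : Set (FinPath G), ∀ h : FinPath G → ℝ≥0∞,
      ∫⁻ σ in s, h σ ∂μ = ∑' x : s, μ {(x : FinPath G)} * h x := by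
    intro s h
    rw [← lintegral_indicator (by trivial), lintegral_countable',
      tsum_subtype s (fun x => μ {x} * h x)]
    refine tsum_congr fun x => ?_
    by_cases hx : x ∈ s <;> simp [hx, mul_comm]
  refine ⟨fun a b e => (tra μ (ι a) (ι b))⁻¹ * ∫⁻ σ in S a b, (σ.n e : ℝ≥0∞) ∂μ, ?_, fun e => ?_⟩
  · intro a b h0
    have hγ : ∀ x : S a b, ∃ γ : PathFromTo G (ι a) (ι b), ∀ e, γ.num e = x.1.n e := by
      rintro ⟨⟨u, w, p⟩, hu, hw⟩
      simp only at hu hw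
      subst hu hw
      exact ⟨p, fun e => rfl⟩
    choose γ hγ using hγ
    refine ⟨S a b, fun x => (tra μ (ι a) (ι b))⁻¹ * μ {x.1}, γ, ?_, fun e => ?_⟩
    · have h1 := hflo (S a b) 1
      simp only [Pi.one_apply, lintegral_const, one_mul, mul_one, Measure.restrict_apply_univ] at h1
      rw [ENNReal.tsum_mul_left, ← h1]
      exact ENNReal.inv_mul_cancel h0 (hT a b)
    · beta_reduce
      rw [hflo, ← ENNReal.tsum_mul_left]
      exact tsum_congr fun x => by rw [hγ, mul_assoc]
  · calc ∑ a, ∑ b, tra μ (ι a) (ι b) * ((tra μ (ι a) (ι b))⁻¹ * ∫⁻ σ in S a b, (σ.n e : ℝ≥0∞) ∂μ)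
        ≤ ∑ a, ∑ b, ∫⁻ σ in S a b, (σ.n e : ℝ≥0∞) ∂μ := by
          gcongr with a _ b _
          -- `T⁻¹ * T ≤ 1` holds also for the pairs with `T = 0`.
          rw [← mul_assoc]
          exact mul_le_of_le_one_left' (ENNReal.mul_inv_le_one _)
      _ = ∑ x : β × β, ∫⁻ σ in S x.1 x.2, (σ.n e : ℝ≥0∞) ∂μ := by
          rw [Fintype.sum_prod_type]
      _ = ∫⁻ σ in ⋃ x ∈ (Finset.univ : Finset (β × β)), S x.1 x.2, (σ.n e : ℝ≥0∞) ∂μ := by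
          rw [lintegral_biUnion_finset]
          · rintro ⟨a, b⟩ _ ⟨a', b'⟩ _ hne
            refine Set.disjoint_left.2 ?_
            rintro σ ⟨h1, h2⟩ ⟨h3, h4⟩
            exact hne (Prod.ext (hι (h1.symm.trans h3)) (hι (h2.symm.trans h4)))
          · intro _ _; trivial
      -- Paths with an end outside the range of `ι` are dropped.
      _ ≤ flo μ e := setLIntegral_le_lintegral _ _

end UnitFlows

end
end RoutingFlow

namespace RoutingFlow
noncomputable section

/-! ### Standardized flows on the torus as superpositions of unit flows. -/

section TorusFlows

variable {N : ℕ}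

/-- Total volume of a flow. -/
def vol (f : TorusEdge N → ℝ≥0∞) : ℝ≥0∞ := ∑ e, f e

/-- There is a unit flow from `v` to `w` with horizontal and vertical volumes at most `a`, `b`. -/
def HasRoute (v w : TorusVertex N) (a b : ℕ) : Prop :=
  ∃ f, UnitFlow (torus N) v w f ∧ ∑ x, f (.inl x) ≤ a ∧ ∑ x, f (.inr x) ≤ b

lemma HasRoute.refl (v : TorusVertex N) : HasRoute v v 0 0 :=
  ⟨0, UnitFlow.refl trivial, by simp, by simp⟩

lemma HasRoute.trans {u v w : TorusVertex N} {a b a' b' : ℕ} (h : HasRoute u v a b)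
    (h' : HasRoute v w a' b') : HasRoute u w (a + a') (b + b') := by
  obtain ⟨f, hf, h1, h2⟩ := h
  obtain ⟨g, hg, h3, h4⟩ := h'
  refine ⟨f + g, hf.trans hg, ?_, ?_⟩
  · simp only [Pi.add_apply, Finset.sum_add_distrib]; push_cast; gcongr
  · simp only [Pi.add_apply, Finset.sum_add_distrib]; push_cast; gcongr

/-! ### Standardized flows as superpositions of unit flows -/

/-- `f` is a superposition of unit flows with volume `N⁻³` between any two vertices. -/
def StdFlow (N : ℕ) (f : TorusEdge N → ℝ≥0∞) : Prop :=
  ∃ F : TorusVertex N → TorusVertex N → TorusEdge N → ℝ≥0∞,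
    (∀ v w, UnitFlow (torus N) v w (F v w)) ∧
    f = fun e => ∑ v, ∑ w, ((N : ℝ≥0∞) ^ 3)⁻¹ * F v w e

lemma StdFlow.isStandardizedGlobalFlow {f : TorusEdge N → ℝ≥0∞} (hf : StdFlow N f) :
    IsStandardizedGlobalFlow N f := by
  obtain ⟨F, hF, rfl⟩ := hf
  -- For `N = 0` the weight `N⁻³` is `∞`, but there are no vertices.
  rcases Nat.eq_zero_or_pos N with rfl | hN
  · exact ⟨0, inferInstance, fun v => v.1.elim0, by ext e; rcases e with e | e <;> exact e.1.elim0⟩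
  obtain ⟨μ, h1, h2, h3⟩ := exists_measure_of_unitFlow (T := fun _ _ => ((N : ℝ≥0∞) ^ 3)⁻¹)
    (fun v w => by simp [hN.ne']) hF
  exact ⟨μ, h1, h2, h3.symm⟩

lemma StdFlow.sum {J : Type} [Fintype J] {m : J → ℝ≥0∞} {f : J → TorusEdge N → ℝ≥0∞}
    (hm : ∑ j, m j = 1) (hf : ∀ j, StdFlow N (f j)) :
    StdFlow N fun e => ∑ j, m j * f j e := by
  choose F hF h using hf
  refine ⟨fun v w e => ∑ j, m j * F j v w e, fun v w => UnitFlow.sum hm fun j => hF j v w, ?_⟩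
  ext e
  simp_rw [h, Finset.mul_sum]
  rw [Finset.sum_comm]
  refine Finset.sum_congr rfl fun v _ => ?_
  rw [Finset.sum_comm]
  refine Finset.sum_congr rfl fun w _ => Finset.sum_congr rfl fun j _ => by ring

lemma card_torusVertex : ((Fintype.card (TorusVertex N) : ℕ) : ℝ≥0∞) = (N : ℝ≥0∞) ^ 2 := by
  simp [Fintype.card_prod, sq]

end TorusFlows

lemma emod_le_self_of_nonneg {a b : ℤ} (ha : 0 ≤ a) (hb : 0 < b) : a % b ≤ a := by
  have h1 := Int.emod_add_mul_ediv a b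
  have h2 := Int.ediv_nonneg ha hb.le
  nlinarith

/-! ### Torus geometry, shortest routes, averaging over translations. -/

section Torus

variable {N : ℕ} [NeZero N]

/-- Reduction of an integer modulo `N`. -/
def red (N : ℕ) [NeZero N] (i : ℤ) : Fin N :=
  ⟨(i % N).toNat, by
    have h1 : (0 : ℤ) < N := by exact_mod_cast Nat.pos_of_ne_zero (NeZero.ne N)
    have h2 := Int.emod_lt_of_pos i h1
    have h3 := Int.emod_nonneg i h1.ne'
    omega⟩

lemma red_val (i : ℤ) : ((red N i : ℕ) : ℤ) = i % N := by
  have h1 : (0 : ℤ) < N := by exact_mod_cast Nat.pos_of_ne_zero (NeZero.ne N)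
  simp [red, Int.emod_nonneg i h1.ne']

lemma red_eq_iff {i j : ℤ} : red N i = red N j ↔ i % N = j % N := by
  rw [← red_val, ← red_val, Fin.ext_iff]
  norm_cast

lemma red_coe (a : Fin N) : red N (a : ℕ) = a := by
  have h : ((red N (a : ℕ) : ℕ) : ℤ) = (a : ℕ) := by
    rw [red_val]; exact Int.emod_eq_of_lt (by positivity) (by exact_mod_cast a.isLt)
  exact Fin.ext (by exact_mod_cast h)

lemma red_add (i j : ℤ) : red N (i + j) = red N i + red N j := by
  apply Fin.ext
  have : ((red N (i + j) : ℕ) : ℤ) = ((red N i + red N j : Fin N) : ℕ) := by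
    rw [Fin.val_add]
    push_cast
    rw [red_val, red_val, red_val, ← Int.add_emod]
  exact_mod_cast this

lemma red_zero : red N 0 = 0 := by
  have := red_coe (0 : Fin N)
  simpa using this

lemma red_sub (i j : ℤ) : red N (i - j) = red N i - red N j := by
  rw [eq_sub_iff_add_eq, ← red_add, sub_add_cancel]

lemma red_neg (i : ℤ) : red N (-i) = -red N i := by
  rw [← zero_sub, red_sub, red_zero, zero_sub]

lemma cyclicSucc_eq (i : Fin N) : cyclicSucc i = i + red N 1 := by
  apply Fin.ext
  rw [Fin.val_add, cyclicSucc]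
  have : ((red N 1 : ℕ) : ℤ) = ((1 % N : ℕ) : ℤ) := by rw [red_val]; push_cast; rfl
  have : (red N 1 : ℕ) = 1 % N := by exact_mod_cast this
  simp [this]

lemma cyclicSucc_red (i : ℤ) : cyclicSucc (red N i) = red N (i + 1) := by
  rw [cyclicSucc_eq, red_add]

/-- Distance on the cycle of length `N`. -/
def cdist (i j : Fin N) : ℕ := min (j - i : Fin N).val (i - j : Fin N).val

/-- Allows every position estimate to be made on conveniently chosen integer lifts. -/
lemma cdist_red_le (x y : ℤ) : (cdist (red N x) (red N y) : ℤ) ≤ |x - y| := by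
  have h1 : (0 : ℤ) < N := by exact_mod_cast Nat.pos_of_ne_zero (NeZero.ne N)
  unfold cdist
  rw [← red_sub, ← red_sub, Nat.cast_min, red_val, red_val]
  rcases le_total y x with h | h
  · refine (min_le_right _ _).trans ?_
    rw [abs_of_nonneg (by omega)]
    exact emod_le_self_of_nonneg (by omega) h1
  · refine (min_le_left _ _).trans ?_
    rw [abs_sub_comm, abs_of_nonneg (by omega)]
    exact emod_le_self_of_nonneg (by omega) h1

lemma cdist_self (i : Fin N) : cdist i i = 0 := by simp [cdist]

lemma cdist_le (i j : Fin N) : 2 * cdist i j ≤ N := by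
  unfold cdist
  by_cases h : j = i
  · simp [h]
  have : ((i - j : Fin N) : ℕ) = N - (j - i : Fin N) := by
    rw [← neg_sub j i, Fin.val_neg', Nat.mod_eq_of_lt]
    have : (j - i : Fin N).val ≠ 0 := by
      rw [Fin.val_ne_zero_iff]; exact sub_ne_zero.2 h
    have := (j - i : Fin N).isLt
    omega
  omega

/-- From `n` to `n + 2` the sum grows by `n + 1`, and `4 (n + 1) = (n + 2)² - n²`. -/
lemma four_mul_sum_min_le (n : ℕ) : 4 * ∑ d ∈ Finset.range n, min d (n - d) ≤ n ^ 2 := by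
  induction n using Nat.twoStepInduction with
  | zero => simp
  | one => simp
  | more n ih _ =>
    have : ∑ d ∈ Finset.range (n + 2), min d (n + 2 - d)
        = ∑ d ∈ Finset.range n, min d (n - d) + (n + 1) := by
      rw [Finset.sum_range_succ']
      have h : ∀ d ∈ Finset.range (n + 1), min (d + 1) (n + 2 - (d + 1)) = min d (n - d) + 1 := by
        intro d hd
        have := Finset.mem_range.1 hd
        omega
      rw [Finset.sum_congr rfl h, Finset.sum_add_distrib, Finset.sum_range_succ]
      simp
    rw [this]
    nlinarith

lemma four_mul_sum_cdist_le (i : Fin N) : 4 * ∑ j, cdist i j ≤ N ^ 2 := by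
  refine le_trans ?_ (four_mul_sum_min_le N)
  rw [← Fin.sum_univ_eq_sum_range (fun d => min d (N - d)),
    ← Equiv.sum_comp (Equiv.subRight i) fun d : Fin N => min (d : ℕ) (N - d)]
  gcongr with j
  simp only [Equiv.subRight_apply, cdist]
  gcongr
  rw [← neg_sub j i, Fin.val_neg']
  exact Nat.mod_le _ _

lemma exists_step (v : TorusVertex N) :
    (∃ f, UnitFlow (torus N) v (v.1 + red N 1, v.2) f ∧ ∑ x, f (.inl x) ≤ 1 ∧ ∑ x, f (.inr x) ≤ 0) ∧
    (∃ f, UnitFlow (torus N) (v.1 + red N 1, v.2) v f ∧ ∑ x, f (.inl x) ≤ 1 ∧ ∑ x, f (.inr x) ≤ 0) ∧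
    (∃ f, UnitFlow (torus N) v (v.1, v.2 + red N 1) f ∧ ∑ x, f (.inl x) ≤ 0 ∧ ∑ x, f (.inr x) ≤ 1) ∧
    (∃ f, UnitFlow (torus N) (v.1, v.2 + red N 1) v f ∧ ∑ x, f (.inl x) ≤ 0 ∧ ∑ x, f (.inr x) ≤ 1) := by
  classical
  have key : ∀ (e : TorusEdge N) (x y : TorusVertex N), (torus N).IsLink e x y →
      UnitFlow (torus N) x y fun e' => ((if e = e' then 1 else 0 : ℕ) : ℝ≥0∞) := by
    intro e x y h
    have hy : y ∈ (torus N).vertexSet := trivial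
    convert UnitFlow.of_path (PathFromTo.cons e h (.nil y hy)) using 3
    rw [PathFromTo.num_cons, PathFromTo.num_nil]
    split_ifs <;> rfl
  have h1 : torusEnds N (.inl v) = (v, (v.1 + red N 1, v.2)) := by
    simp [torusEnds, cyclicSucc_eq]
  have h2 : torusEnds N (.inr v) = (v, (v.1, v.2 + red N 1)) := by
    simp [torusEnds, cyclicSucc_eq]
  exact ⟨⟨_, key (.inl v) _ _ (Or.inl h1), by simp, by simp⟩,
    ⟨_, key (.inl v) _ _ (Or.inr h1), by simp, by simp⟩,
    ⟨_, key (.inr v) _ _ (Or.inl h2), by simp, by simp⟩,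
    ⟨_, key (.inr v) _ _ (Or.inr h2), by simp, by simp⟩⟩

lemma HasRoute.horizontal (v : TorusVertex N) (n : ℕ) :
    HasRoute v (v.1 + red N n, v.2) n 0 ∧ HasRoute (v.1 + red N n, v.2) v n 0 := by
  induction n with
  | zero => simpa [red_zero] using HasRoute.refl v
  | succ n ih =>
    obtain ⟨⟨f, hf⟩, ⟨g, hg⟩, -, -⟩ := exists_step (v.1 + red N n, v.2)
    have : v.1 + red N ((n + 1 : ℕ) : ℤ) = v.1 + red N n + red N 1 := by
      push_cast; rw [red_add, add_assoc]
    rw [this]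
    refine ⟨?_, ?_⟩
    · exact ih.1.trans (a' := 1) (b' := 0) ⟨f, by simpa using hf⟩
    · rw [add_comm n 1]
      exact HasRoute.trans (b := 0) ⟨g, by simpa using hg⟩ ih.2

lemma HasRoute.vertical (v : TorusVertex N) (n : ℕ) :
    HasRoute v (v.1, v.2 + red N n) 0 n ∧ HasRoute (v.1, v.2 + red N n) v 0 n := by
  induction n with
  | zero => simpa [red_zero] using HasRoute.refl v
  | succ n ih =>
    obtain ⟨-, -, ⟨f, hf⟩, ⟨g, hg⟩⟩ := exists_step (v.1, v.2 + red N n)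
    have : v.2 + red N ((n + 1 : ℕ) : ℤ) = v.2 + red N n + red N 1 := by
      push_cast; rw [red_add, add_assoc]
    rw [this]
    refine ⟨?_, ?_⟩
    · exact ih.1.trans (a' := 0) (b' := 1) ⟨f, by simpa using hf⟩
    · rw [add_comm n 1]
      exact HasRoute.trans (a := 0) ⟨g, by simpa using hg⟩ ih.2

lemma hasRoute_cdist (v w : TorusVertex N) : HasRoute v w (cdist v.1 w.1) (cdist v.2 w.2) := by
  have h1 : HasRoute v (w.1, v.2) (cdist v.1 w.1) 0 := by
    unfold cdist
    rcases min_choice (w.1 - v.1 : Fin N).val (v.1 - w.1 : Fin N).val with h | h <;> rw [h]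
    · simpa [red_coe] using (HasRoute.horizontal v (w.1 - v.1 : Fin N).val).1
    · simpa [red_coe] using (HasRoute.horizontal (w.1, v.2) (v.1 - w.1 : Fin N).val).2
  have h2 : HasRoute (w.1, v.2) w 0 (cdist v.2 w.2) := by
    unfold cdist
    rcases min_choice (w.2 - v.2 : Fin N).val (v.2 - w.2 : Fin N).val with h | h <;> rw [h]
    · simpa [red_coe] using (HasRoute.vertical (w.1, v.2) (w.2 - v.2 : Fin N).val).1
    · simpa [red_coe] using (HasRoute.vertical w (v.2 - w.2 : Fin N).val).2
  simpa using h1.trans h2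

/-- A unit flow along a shortest route. -/
def shortest (v w : TorusVertex N) : TorusEdge N → ℝ≥0∞ := (hasRoute_cdist v w).choose

/-- The `ℓ¹` distance on the torus. -/
def tdist (v w : TorusVertex N) : ℕ := cdist v.1 w.1 + cdist v.2 w.2

lemma unitFlow_shortest (v w : TorusVertex N) : UnitFlow (torus N) v w (shortest v w) :=
  (hasRoute_cdist v w).choose_spec.1

lemma sum_shortest_inl_le (v w : TorusVertex N) :
    ∑ x, shortest v w (.inl x) ≤ cdist v.1 w.1 := (hasRoute_cdist v w).choose_spec.2.1

lemma sum_shortest_inr_le (v w : TorusVertex N) :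
    ∑ x, shortest v w (.inr x) ≤ cdist v.2 w.2 := (hasRoute_cdist v w).choose_spec.2.2

lemma vol_shortest_le (v w : TorusVertex N) : vol (shortest v w) ≤ tdist v w := by
  unfold vol tdist
  rw [Fintype.sum_sum_type]
  push_cast
  exact add_le_add (sum_shortest_inl_le v w) (sum_shortest_inr_le v w)

lemma tdist_le (v w : TorusVertex N) : tdist v w ≤ N := by
  have h1 := cdist_le v.1 w.1
  have h2 := cdist_le v.2 w.2
  unfold tdist
  omega

lemma tdist_self (v : TorusVertex N) : tdist v v = 0 := by simp [tdist, cdist_self]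

/-- The point of the torus with given integer coordinates. -/
def pt (N : ℕ) [NeZero N] (x : ℤ × ℤ) : TorusVertex N := (red N x.1, red N x.2)

lemma tdist_pt_le (x y : ℤ × ℤ) :
    (tdist (pt N x) (pt N y) : ℤ) ≤ |x.1 - y.1| + |x.2 - y.2| := by
  unfold tdist pt
  push_cast
  exact add_le_add (cdist_red_le _ _) (cdist_red_le _ _)

/-- Translation of edges. -/
def edgeShift (τ : TorusVertex N) : TorusEdge N ≃ TorusEdge N :=
  Equiv.sumCongr (Equiv.addRight τ) (Equiv.addRight τ)

lemma torusEnds_edgeShift (τ : TorusVertex N) (e : TorusEdge N) :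
    torusEnds N (edgeShift τ e) = ((torusEnds N e).1 + τ, (torusEnds N e).2 + τ) := by
  rcases e with ⟨i, j⟩ | ⟨i, j⟩ <;>
  simp [edgeShift, torusEnds, cyclicSucc_eq, Prod.ext_iff, add_right_comm]

lemma UnitFlow.translate {v w : TorusVertex N} {f : TorusEdge N → ℝ≥0∞} (τ : TorusVertex N)
    (hf : UnitFlow (torus N) v w f) :
    UnitFlow (torus N) (v + τ) (w + τ) fun e => f ((edgeShift τ).symm e) := by
  classical
  have := hf.map (G' := torus N) (φ := fun v => v + τ) (S := ∅) (ε := edgeShift τ)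
    (fun v => trivial) (fun e he => he.elim) ?_
  · convert this using 1
    ext e
    unfold pushFlow
    rw [Finset.sum_eq_single ((edgeShift τ).symm e)]
    · intro b hb hne
      simp only [Set.mem_empty_iff_false, not_false_eq_true, true_and, Finset.mem_filter,
        Finset.mem_univ] at hb
      exact absurd (by simp [← hb]) hne
    · simp
  · intro e _ x y h
    change torusEnds N _ = _ ∨ torusEnds N _ = _
    rw [torusEnds_edgeShift]
    rcases h with h | h
    · left; rw [h]
    · right; rw [h]

lemma StdFlow.translate {f : TorusEdge N → ℝ≥0∞} (τ : TorusVertex N) (hf : StdFlow N f) :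
    StdFlow N fun e => f ((edgeShift τ).symm e) := by
  obtain ⟨F, hF, rfl⟩ := hf
  refine ⟨fun v w e => F (v - τ) (w - τ) ((edgeShift τ).symm e), fun v w => ?_, ?_⟩
  · simpa using (hF (v - τ) (w - τ)).translate τ
  · ext e
    refine (Equiv.sum_comp (Equiv.subRight τ) _).symm.trans ?_
    refine Finset.sum_congr rfl fun v _ => ?_
    exact (Equiv.sum_comp (Equiv.subRight τ) _).symm

/-- The flow `f τ` may vary with `τ`: later it is adapted to the environment seen from `τ`. -/
lemma StdFlow.average {f : TorusVertex N → TorusEdge N → ℝ≥0∞} (hf : ∀ τ, StdFlow N (f τ)) :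
    StdFlow N fun e => ∑ τ, ((N : ℝ≥0∞) ^ 2)⁻¹ * f τ ((edgeShift τ).symm e) := by
  refine StdFlow.sum ?_ fun τ => (hf τ).translate τ
  rw [Finset.sum_const, nsmul_eq_mul, Finset.card_univ, card_torusVertex]
  exact ENNReal.mul_inv_cancel (by simp [NeZero.ne N]) (by finiteness)

lemma sum_edgeShift_inl (f : TorusEdge N → ℝ≥0∞) (x : TorusVertex N) :
    ∑ τ, f ((edgeShift τ).symm (.inl x)) = ∑ y, f (.inl y) := by
  rw [← Equiv.sum_comp (Equiv.subLeft x) fun y => f (.inl y)]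
  refine Finset.sum_congr rfl fun τ _ => ?_
  simp [edgeShift, sub_eq_add_neg]

lemma sum_edgeShift_inr (f : TorusEdge N → ℝ≥0∞) (x : TorusVertex N) :
    ∑ τ, f ((edgeShift τ).symm (.inr x)) = ∑ y, f (.inr y) := by
  rw [← Equiv.sum_comp (Equiv.subLeft x) fun y => f (.inr y)]
  refine Finset.sum_congr rfl fun τ _ => ?_
  simp [edgeShift, sub_eq_add_neg]

/-- Translations act simply transitively on the edges of each orientation. Averaging thus turns a
bound on the volume into a bound on every edge. -/
lemma sum_edgeShift_le_vol (f : TorusEdge N → ℝ≥0∞) (e : TorusEdge N) :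
    ∑ τ, f ((edgeShift τ).symm e) ≤ vol f := by
  unfold vol
  rw [Fintype.sum_sum_type]
  rcases e with x | x
  · rw [sum_edgeShift_inl]; exact le_self_add
  · rw [sum_edgeShift_inr]; exact le_add_self

/-- The load of an edge after averaging: `N⁴` demands of size `N⁻³`, each using on average at most
`N / 4` edges of the given orientation, spread over `N²` such edges. -/
lemma inv_mul_sum_cdist_le :
    ((N : ℝ≥0∞) ^ 2)⁻¹ * (((N : ℝ≥0∞) ^ 3)⁻¹ *
      ((N : ℝ≥0∞) ^ 2 * ∑ i : Fin N, ∑ j : Fin N, (cdist i j : ℝ≥0∞))) ≤ 1 / 4 := by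
  have hN : (N : ℝ≥0∞) ≠ 0 := by simp [NeZero.ne N]
  have h1 : 4 * ∑ i : Fin N, ∑ j : Fin N, (cdist i j : ℝ≥0∞) ≤ (N : ℝ≥0∞) ^ 3 := by
    have : 4 * ∑ i : Fin N, ∑ j : Fin N, cdist i j ≤ N ^ 3 := by
      rw [Finset.mul_sum]
      calc ∑ i : Fin N, 4 * ∑ j, cdist i j ≤ ∑ i : Fin N, N ^ 2 :=
            Finset.sum_le_sum fun i _ => four_mul_sum_cdist_le i
        _ = N ^ 3 := by simp; ring
    exact_mod_cast this
  rw [mul_left_comm, ← mul_assoc ((N : ℝ≥0∞) ^ 2)⁻¹, ENNReal.inv_mul_cancel (by simp [hN])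
    (by finiteness), one_mul, ENNReal.le_div_iff_mul_le (by simp) (by simp), mul_assoc, mul_comm _ 4]
  exact (mul_le_mul_right h1 _).trans (ENNReal.inv_mul_le_one _)

/-- Shortest-path routing, averaged over translations, loads every edge by at most `1/4`. -/
lemma exists_stdFlow_le_quarter (N : ℕ) : ∃ u, StdFlow N u ∧ ∀ e, u e ≤ 1 / 4 := by
  rcases Nat.eq_zero_or_pos N with rfl | hN
  · refine ⟨0, ⟨fun v => v.1.elim0, fun v => v.1.elim0, ?_⟩, by simp⟩
    ext e; rcases e with e | e <;> exact e.1.elim0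
  have : NeZero N := ⟨hN.ne'⟩
  refine ⟨_, StdFlow.average (N := N) (f := fun _ e => ∑ v, ∑ w, ((N : ℝ≥0∞) ^ 3)⁻¹ * shortest v w e)
    fun _ => ⟨shortest, unitFlow_shortest, rfl⟩, fun e => ?_⟩
  rw [← Finset.mul_sum]
  refine le_trans ?_ (inv_mul_sum_cdist_le (N := N))
  gcongr
  have hswap : ∀ ι : TorusVertex N → TorusEdge N,
      ∑ y, ∑ v, ∑ w, ((N : ℝ≥0∞) ^ 3)⁻¹ * shortest v w (ι y)
        = ((N : ℝ≥0∞) ^ 3)⁻¹ * ∑ v, ∑ w, ∑ y, shortest v w (ι y) := by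
    intro ι
    simp_rw [Finset.mul_sum]
    rw [Finset.sum_comm]
    exact Finset.sum_congr rfl fun v _ => Finset.sum_comm
  rcases e with x | x
  · rw [sum_edgeShift_inl fun e => ∑ v, ∑ w, ((N : ℝ≥0∞) ^ 3)⁻¹ * shortest v w e, hswap]
    gcongr
    calc _ ≤ ∑ v : TorusVertex N, ∑ w : TorusVertex N, (cdist v.1 w.1 : ℝ≥0∞) := by
          gcongr; exact sum_shortest_inl_le _ _
      _ = _ := by
          simp only [Fintype.sum_prod_type, Finset.sum_const, Finset.card_univ, Fintype.card_fin,
            ← Finset.smul_sum, smul_smul]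
          rw [nsmul_eq_mul]; push_cast; ring
  · rw [sum_edgeShift_inr fun e => ∑ v, ∑ w, ((N : ℝ≥0∞) ^ 3)⁻¹ * shortest v w e, hswap]
    gcongr
    calc _ ≤ ∑ v : TorusVertex N, ∑ w : TorusVertex N, (cdist v.2 w.2 : ℝ≥0∞) := by
          gcongr; exact sum_shortest_inr_le _ _
      _ = _ := by
          simp only [Fintype.sum_prod_type, Finset.sum_const, Finset.card_univ, Fintype.card_fin,
            ← Finset.smul_sum, smul_smul]
          rw [nsmul_eq_mul]; push_cast; ring

end Torus

end
end RoutingFlow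

namespace RoutingFlow
noncomputable section

/-! ### Measurability, and near-optimal selection of a flow. -/

section Selection

variable {E : Type} [Fintype E]

lemma continuous_cost_flow (c : E → ℝ≥0) : Continuous fun f : E → ℝ≥0∞ => cost f c := by
  unfold cost
  refine continuous_finsetSum _ fun e _ => ?_
  exact (ENNReal.continuous_const_mul ENNReal.coe_ne_top).comp
    ((ENNReal.continuous_pow 2).comp (continuous_apply e))

lemma continuous_cost_env {f : E → ℝ≥0∞} (hf : ∀ e, f e ≠ ∞) :
    Continuous fun c : E → ℝ≥0 => cost f c := by
  unfold cost
  refine continuous_finsetSum _ fun e _ => ?_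
  exact (ENNReal.continuous_mul_const (ENNReal.pow_ne_top (hf e))).comp
    (ENNReal.continuous_coe.comp (continuous_apply e))

lemma cost_lt_top {f : E → ℝ≥0∞} (hf : ∀ e, f e ≠ ∞) (c : E → ℝ≥0) : cost f c < ∞ :=
  ENNReal.sum_lt_top.2 fun e _ =>
    ENNReal.mul_lt_top ENNReal.coe_lt_top (ENNReal.pow_lt_top (hf e).lt_top)

/-- Global flows subject to the capacity `B`. -/
def feasible (N : ℕ) (B : ℝ≥0) : Set (TorusEdge N → ℝ≥0∞) :=
  {f | IsStandardizedGlobalFlow N f ∧ ∀ e, f e ≤ B}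

lemma feasible_nonempty (N : ℕ) {B : ℝ≥0} (hB : 1 / 4 < B) : (feasible N B).Nonempty := by
  obtain ⟨u, hu, h⟩ := exists_stdFlow_le_quarter N
  refine ⟨u, hu.isStandardizedGlobalFlow, fun e => (h e).trans ?_⟩
  have : ((1 / 4 : ℝ≥0) : ℝ≥0∞) ≤ B := by exact_mod_cast hB.le
  simpa using this

/-- A measurable, nearly optimal choice of a feasible flow. -/
lemma exists_measurable_selection (N : ℕ) {B : ℝ≥0} (hB : 1 / 4 < B) :
    ∃ f : (TorusEdge N → ℝ≥0) → (TorusEdge N → ℝ≥0∞), Measurable f ∧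
      (∀ c, f c ∈ feasible N B) ∧ ∀ c, ∀ g ∈ feasible N B, cost (f c) c ≤ cost g c + 1 := by
  classical
  have : Nonempty (feasible N B) := (feasible_nonempty N hB).to_subtype
  let d : ℕ → feasible N B := TopologicalSpace.denseSeq (feasible N B)
  have hfin : ∀ n e, (d n).1 e ≠ ∞ := fun n e => ((d n).2.2 e).trans_lt ENNReal.coe_lt_top |>.ne
  have hinf : ∀ c, (⨅ m, cost (d m).1 c) ≠ ∞ := fun c =>
    ((iInf_le _ 0).trans_lt (cost_lt_top (hfin 0) c)).ne
  have hex : ∀ c, ∃ n, cost (d n).1 c ≤ (⨅ m, cost (d m).1 c) + 1 := by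
    intro c
    obtain ⟨n, hn⟩ := iInf_lt_iff.1 (ENNReal.lt_add_right (hinf c) one_ne_zero)
    exact ⟨n, hn.le⟩
  have hmeas : ∀ n, Measurable fun c => cost (d n).1 c := fun n =>
    (continuous_cost_env (hfin n)).measurable
  -- The first member of a dense sequence that is within 1 of the infimum. The slack 1 disappears
  -- after division by `N²`.
  refine ⟨fun c => (d (Nat.find (hex c))).1, ?_, fun c => (d _).2, fun c g hg => ?_⟩
  · refine Measurable.comp (g := fun n => (d n).1) measurable_from_top (measurable_find hex fun n => ?_)
    exact measurableSet_le (hmeas n) ((Measurable.iInf hmeas).add_const _)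
  · refine (Nat.find_spec (hex c)).trans ?_
    gcongr
    -- The cost is continuous in the flow, so the infimum along the dense sequence bounds the cost
    -- of every feasible flow from below.
    refine (TopologicalSpace.denseRange_denseSeq (feasible N B)).induction_on
      (p := fun x => (⨅ m, cost (d m).1 c) ≤ cost x.1 c) ⟨g, hg⟩ ?_ fun n => iInf_le _ n
    exact isClosed_le continuous_const ((continuous_cost_flow c).comp continuous_subtype_val)

/-- The infimum is uncountable, but infima of continuous functions are upper semicontinuous. -/
lemma measurable_squareCost (M : ℕ) (B : ℝ≥0) (Q : Transport M) :
    Measurable (squareCost M B Q) := by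
  unfold squareCost
  refine UpperSemicontinuous.measurable ?_
  refine upperSemicontinuous_biInf fun μ hμ => Continuous.upperSemicontinuous ?_
  exact continuous_cost_env fun e => ((hμ.2.2 e).trans_lt ENNReal.coe_lt_top).ne

end Selection

end
end RoutingFlow

namespace RoutingFlow
noncomputable section

/-! ### Itineraries from balanced transportation measures. -/

section Itinerary

variable {M : ℕ}

lemma Bou.reflect_reflect (b : Bou M) : b.reflect.reflect = b := by
  obtain ⟨s, j⟩ := b
  cases s <;> rfl

/-- Number of consecutive legs `(x, b), (x', b')` such that `x'` is not the reflection of `b`,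
when the legs are run through starting from the entrance `y`. -/
def mismatches (y : Bou M) : List (Bou M × Bou M) → ℕ
  | [] => 0
  | (x, b) :: l => (if y = x then 0 else 1) + mismatches b.reflect l

lemma mismatches_append_le (y : Bou M) (l l' : List (Bou M × Bou M)) :
    ∃ z, mismatches y (l ++ l') = mismatches y l + mismatches z l' := by
  induction l generalizing y with
  | nil => exact ⟨y, by simp [mismatches]⟩
  | cons a l ih =>
    obtain ⟨x, b⟩ := a
    obtain ⟨z, hz⟩ := ih b.reflect
    exact ⟨z, by simp [mismatches, hz, add_assoc]⟩

lemma mismatches_le (y z : Bou M) (l : List (Bou M × Bou M)) :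
    mismatches y l ≤ mismatches z l + 1 := by
  cases l with
  | nil => simp [mismatches]
  | cons a l =>
    obtain ⟨x, b⟩ := a
    simp only [mismatches]
    split_ifs <;> omega

/-- The leg used in one step of a permutation of two copies of the set of entrances; moves between
the copies use no leg. -/
def permLeg (π : Equiv.Perm (Bou M × Bool)) (z : Bou M × Bool) : List (Bou M × Bou M) :=
  if (π z).2 = z.2 then [(z.1, (π z).1.reflect)] else []

/-- The legs used in `t` steps of a permutation. -/
def permRun (π : Equiv.Perm (Bou M × Bool)) : Bou M × Bool → ℕ → List (Bou M × Bou M)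
  | _, 0 => []
  | z, t + 1 => permLeg π z ++ permRun π (π z) t

/-- A step within a copy leads to the reflection of the exit just used, and a change of copy keeps
the entrance. -/
lemma mismatches_permRun {π : Equiv.Perm (Bou M × Bool)}
    (hπ : ∀ z, (π z).2 ≠ z.2 → (π z).1 = z.1) (z : Bou M × Bool) (t : ℕ) :
    mismatches z.1 (permRun π z t) = 0 := by
  induction t generalizing z with
  | zero => rfl
  | succ t ih =>
    simp only [permRun, permLeg]
    split_ifs with h
    · simp [mismatches, Bou.reflect_reflect, ih]
    · simpa [hπ z h] using ih (π z)

/-- As `π` permutes the starting points, each of the `t` steps contributes the same total. -/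
lemma sum_count_permRun (π : Equiv.Perm (Bou M × Bool)) (t : ℕ) (a : Bou M × Bou M) :
    ∑ z, (permRun π z t).count a = t * ∑ z, (permLeg π z).count a := by
  induction t with
  | zero => simp [permRun]
  | succ t ih =>
    simp only [permRun, List.count_append, Finset.sum_add_distrib]
    rw [Equiv.sum_comp π fun z => (permRun π z t).count a, ih]
    ring

lemma mismatches_flatMap_le {ι : Type} (f : ι → List (Bou M × Bou M)) (C : ℕ)
    (hC : ∀ i, ∃ z, mismatches z (f i) ≤ C) (y : Bou M) (L : List ι) :
    mismatches y (L.flatMap f) ≤ L.length * (C + 1) := by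
  induction L generalizing y with
  | nil => simp [mismatches]
  | cons i L ih =>
    obtain ⟨z, hz⟩ := mismatches_append_le y (f i) (L.flatMap f)
    obtain ⟨z', hz'⟩ := hC i
    have h1 := mismatches_le y z' (f i)
    have h2 := ih z
    rw [List.flatMap_cons, hz, List.length_cons]
    nlinarith

/-- A run through all permutations and all starting points, with prescribed numbers of steps. -/
lemma exists_list_of_perm (t : Equiv.Perm (Bou M × Bool) → ℕ)
    (ht : ∀ π, t π ≠ 0 → ∀ z, (π z).2 ≠ z.2 → (π z).1 = z.1) :
    ∃ l : List (Bou M × Bou M),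
      (∀ y, mismatches y l ≤ Fintype.card (Equiv.Perm (Bou M × Bool) × (Bou M × Bool))) ∧
      ∀ a, l.count a = ∑ π, t π * ∑ z, (permLeg π z).count a := by
  let f : Equiv.Perm (Bou M × Bool) × (Bou M × Bool) → List (Bou M × Bou M) :=
    fun x => permRun x.1 x.2 (t x.1)
  refine ⟨Finset.univ.toList.flatMap f, fun y => ?_, fun a => ?_⟩
  · have := mismatches_flatMap_le f 0 (fun x => ⟨x.2.1, ?_⟩) y Finset.univ.toList
    · simpa using this
    · by_cases h : t x.1 = 0
      · simp [f, h, permRun, mismatches]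
      · exact (mismatches_permRun (ht _ h) _ _).le
  · rw [List.count_flatMap]
    have : (List.map (List.count a ∘ f) Finset.univ.toList).sum = ∑ x, (f x).count a := by
      rw [Finset.sum_map_toList]; rfl
    rw [this, Fintype.sum_prod_type]
    exact Finset.sum_congr rfl fun π _ => sum_count_permRun π (t π) a

lemma entMarginal_reflect {Q : Transport M} (hQ : Q ∈ balanced M) (b : Bou M) :
    Q.exiMarginal b.reflect = Q.entMarginal b := by
  rw [← hQ b, Finset.sum_eq_single b.reflect]
  · intro b' hb' hne
    rw [Finset.mem_filter] at hb'
    exact absurd (by rw [← hb'.2, Bou.reflect_reflect]) hne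
  · simp [Bou.reflect_reflect]

/-- A balanced transportation measure is a combination of permutations. -/
lemma exists_perm_decomposition {Q : Transport M} (hQ : Q ∈ balanced M) :
    ∃ w : Equiv.Perm (Bou M × Bool) → ℝ, (∀ π, 0 ≤ w π) ∧
      (∀ π, w π ≠ 0 → ∀ z, (π z).2 ≠ z.2 → (π z).1 = z.1) ∧
      ∀ a : Bou M × Bou M, (Q a.1 a.2 : ℝ) = ∑ π, w π * ∑ z, ((permLeg π z).count a : ℝ) := by
  classical
  -- Above every marginal, and positive even if `Q = 0`.
  let S : ℝ := 1 + ∑ b, (Q.entMarginal b : ℝ)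
  have hS : 0 < S := by positivity
  -- Within a copy, `Q` moves mass from an entrance to the next entrance. The slack that completes
  -- the row sums goes to the same entrance in the other copy, so that it is not mistaken for a leg
  -- from `b` to `b.reflect`.
  let A : Matrix (Bou M × Bool) (Bou M × Bool) ℝ := fun z z' =>
    S⁻¹ * if z.2 = z'.2 then (Q z.1 z'.1.reflect : ℝ) else
      if z.1 = z'.1 then S - Q.entMarginal z.1 else 0
  have hle : ∀ b, (Q.entMarginal b : ℝ) ≤ S := by
    intro b
    have : (Q.entMarginal b : ℝ) ≤ ∑ b, (Q.entMarginal b : ℝ) :=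
      Finset.single_le_sum (f := fun b => (Q.entMarginal b : ℝ)) (fun b _ => by positivity)
        (Finset.mem_univ b)
    linarith
  have hrefl : ∀ g : Bou M → ℝ, ∑ b : Bou M, g b.reflect = ∑ b, g b := fun g =>
    Equiv.sum_comp (Function.Involutive.toPerm _ Bou.reflect_reflect) g
  have hA : A ∈ doublyStochastic ℝ (Bou M × Bool) := by
    rw [mem_doublyStochastic_iff_sum]
    refine ⟨fun z z' => ?_, fun z => ?_, fun z => ?_⟩
    · have := hle z.1
      simp only [A]
      split_ifs
      · positivity
      · exact mul_nonneg (by positivity) (by linarith)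
      · simp
    · have h1 : ∑ b : Bou M, (Q z.1 b.reflect : ℝ) = Q.entMarginal z.1 := by
        rw [hrefl fun b => (Q z.1 b : ℝ)]
        simp [Transport.entMarginal]
      simp only [A, ← Finset.mul_sum]
      rw [Fintype.sum_prod_type_right, Fintype.sum_bool]
      obtain ⟨b, ε⟩ := z
      cases ε <;> simp [h1] <;> field_simp
    · have h1 : ∑ b, (Q b z.1.reflect : ℝ) = Q.entMarginal z.1 := by
        rw [← entMarginal_reflect hQ]
        simp [Transport.exiMarginal]
      simp only [A, ← Finset.mul_sum]
      rw [Fintype.sum_prod_type_right, Fintype.sum_bool]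
      obtain ⟨b, ε⟩ := z
      cases ε <;> simp [h1] <;> field_simp
  obtain ⟨w, hw0, hw1, hw⟩ := exists_eq_sum_perm_of_mem_doublyStochastic hA
  have hentry : ∀ z z', ∑ π : Equiv.Perm (Bou M × Bool), w π * (if π z = z' then 1 else 0) = A z z' := by
    intro z z'
    rw [← hw]
    simp [Matrix.sum_apply, Equiv.Perm.permMatrix, PEquiv.toMatrix_apply, eq_comm]
  -- `S` undoes the normalization of `A`, and `1/2` accounts for both copies carrying `Q`.
  refine ⟨fun π => S / 2 * w π, fun π => mul_nonneg (by positivity) (hw0 π), ?_, ?_⟩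
  · intro π hπ z hz
    by_contra hne
    -- A permutation of positive weight uses only nonzero entries of `A`, and between the copies `A`
    -- is diagonal.
    have h0 : A z (π z) = 0 := by
      simp only [A]
      rw [if_neg (Ne.symm hz), if_neg (Ne.symm hne), mul_zero]
    rw [← hentry, Finset.sum_eq_zero_iff_of_nonneg] at h0
    · have := h0 π (Finset.mem_univ _)
      simp at this
      simp [this] at hπ
    · intro σ _
      exact mul_nonneg (hw0 σ) (by split_ifs <;> simp)
  · rintro ⟨a, b⟩
    have hcount : ∀ π : Equiv.Perm (Bou M × Bool), ∀ z, ((permLeg π z).count (a, b) : ℝ)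
        = if z.1 = a then (if π z = (b.reflect, z.2) then 1 else 0) else 0 := by
      intro π z
      unfold permLeg
      by_cases h1 : (π z).2 = z.2
      · rw [if_pos h1]
        by_cases h2 : z.1 = a
        · have : (π z).1.reflect = b ↔ π z = (b.reflect, z.2) := by
            constructor
            · intro h; exact Prod.ext (by rw [← h, Bou.reflect_reflect]) h1
            · intro h; rw [h, Bou.reflect_reflect]
          simp [List.count_cons, h2, this]
        · simp [h2]
      · rw [if_neg h1]
        have : π z ≠ (b.reflect, z.2) := fun h => h1 (by rw [h])
        simp [this]
    have : ∀ π : Equiv.Perm (Bou M × Bool), ∑ z, ((permLeg π z).count (a, b) : ℝ) =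
        ∑ ε : Bool, if π (a, ε) = (b.reflect, ε) then 1 else 0 := by
      intro π
      simp_rw [hcount]
      rw [Fintype.sum_prod_type_right]
      simp
    simp_rw [this, mul_assoc, Finset.mul_sum]
    rw [Finset.sum_comm]
    simp_rw [← Finset.mul_sum]
    have h2 : ∀ ε : Bool, ∑ π : Equiv.Perm (Bou M × Bool),
        w π * (if π (a, ε) = (b.reflect, ε) then 1 else 0) = S⁻¹ * Q a b := by
      intro ε
      rw [hentry]
      simp [A, Bou.reflect_reflect]
    simp_rw [h2]
    simp
    field_simp

/-- Approximation of multiples of a balanced transportation measure by itineraries. -/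
lemma exists_itinerary {Q : Transport M} (hQ : Q ∈ balanced M) :
    ∃ C : ℕ, ∀ s : ℝ, 0 ≤ s → ∃ l : List (Bou M × Bou M), (∀ y, mismatches y l ≤ C) ∧
      ∀ a, (l.count a : ℝ) ≤ s * Q a.1 a.2 ∧ s * Q a.1 a.2 ≤ l.count a + C := by
  classical
  obtain ⟨w, hw0, hw, hsum⟩ := exists_perm_decomposition hQ
  let R : Equiv.Perm (Bou M × Bool) → Bou M × Bou M → ℕ := fun π a => ∑ z, (permLeg π z).count a
  -- The number of concatenated runs bounds the mismatches, and the legs in a single step of every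
  -- permutation bound the loss from rounding down. Neither depends on `s`.
  refine ⟨Fintype.card (Equiv.Perm (Bou M × Bool) × (Bou M × Bool)) + ∑ a, ∑ π, R π a,
    fun s hs => ?_⟩
  obtain ⟨l, hl, hc⟩ := exists_list_of_perm (fun π => ⌊s * w π⌋₊) fun π h => by
    refine hw π fun h0 => h ?_
    simp [h0]
  refine ⟨l, fun y => (hl y).trans (Nat.le_add_right _ _), fun a => ?_⟩
  have hQa : s * (Q a.1 a.2 : ℝ) = ∑ π, s * w π * R π a := by
    rw [hsum, Finset.mul_sum]
    refine Finset.sum_congr rfl fun π _ => ?_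
    simp only [R]
    push_cast
    ring
  have hla : (l.count a : ℝ) = ∑ π, (⌊s * w π⌋₊ : ℝ) * R π a := by
    rw [hc, Nat.cast_sum]
    exact Finset.sum_congr rfl fun π _ => Nat.cast_mul _ _
  have hRa : ∑ π, (R π a : ℝ) ≤ ((∑ a, ∑ π, R π a : ℕ) : ℝ) := by
    push_cast
    exact Finset.single_le_sum (f := fun a => ∑ π, (R π a : ℝ)) (fun _ _ => by positivity)
      (Finset.mem_univ a)
  constructor
  · rw [hQa, hla]
    gcongr with π _
    exact Nat.floor_le (mul_nonneg hs (hw0 π))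
  · have : ∑ π, s * w π * R π a ≤ ∑ π, ((⌊s * w π⌋₊ : ℝ) * R π a + R π a) := by
      gcongr with π _
      have := (Nat.lt_floor_add_one (s * w π)).le
      have h2 : (0 : ℝ) ≤ R π a := by positivity
      nlinarith
    rw [Finset.sum_add_distrib, ← hQa, ← hla] at this
    rw [Nat.cast_add]
    have h3 : (0 : ℝ) ≤ (Fintype.card (Equiv.Perm (Bou M × Bool) × (Bou M × Bool)) : ℕ) := by
      positivity
    linarith

end Itinerary

end
end RoutingFlow

namespace RoutingFlow
noncomputable section

/-! ### Finite approximation of the mixing law by drift cells. -/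

section Discretization

variable {M : ℕ}

lemma drift_fst (Q : Transport M) : (drift Q).1 =
    ((M : ℝ) ^ 2)⁻¹ * ∑ b₁ : Bou M, ∑ b₂ : Bou M, (Q b₁ b₂ : ℝ) * (b₂.pos.1 - b₁.pos.1) := by
  simp [drift, Prod.fst_sum]

lemma drift_snd (Q : Transport M) : (drift Q).2 =
    ((M : ℝ) ^ 2)⁻¹ * ∑ b₁ : Bou M, ∑ b₂ : Bou M, (Q b₁ b₂ : ℝ) * (b₂.pos.2 - b₁.pos.2) := by
  simp [drift, Prod.snd_sum]

lemma measurable_transport_apply (b₁ b₂ : Bou M) :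
    Measurable fun Q : Transport M => (Q b₁ b₂ : ℝ≥0) :=
  (measurable_pi_apply b₂).comp (measurable_pi_apply b₁)

lemma measurable_drift : Measurable (drift : Transport M → ℝ × ℝ) := by
  refine Measurable.prodMk ?_ ?_
  · have := fun b₁ b₂ : Bou M => (measurable_transport_apply b₁ b₂).coe_nnreal_real
    change Measurable fun Q : Transport M => (drift Q).1
    simp_rw [drift_fst]
    fun_prop
  · have := fun b₁ b₂ : Bou M => (measurable_transport_apply b₁ b₂).coe_nnreal_real
    change Measurable fun Q : Transport M => (drift Q).2
    simp_rw [drift_snd]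
    fun_prop

lemma measurable_driftMod : Measurable (driftMod : Transport M → ℝ × ℝ) :=
  (measurable_fract.comp measurable_drift.fst).prodMk (measurable_fract.comp measurable_drift.snd)

/-- The transportation measures whose drift lies in the cell `k` of the grid of mesh `1 / n`. -/
def driftCell (M n : ℕ) (k : ℤ × ℤ) : Set (Transport M) :=
  {Q | ⌊n * (drift Q).1⌋ = k.1 ∧ ⌊n * (drift Q).2⌋ = k.2}

lemma measurableSet_driftCell (n : ℕ) (k : ℤ × ℤ) : MeasurableSet (driftCell M n k) := by
  have h1 : Measurable fun Q : Transport M => ⌊n * (drift Q).1⌋ :=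
    Int.measurable_floor.comp (measurable_drift.fst.const_mul _)
  have h2 : Measurable fun Q : Transport M => ⌊n * (drift Q).2⌋ :=
    Int.measurable_floor.comp (measurable_drift.snd.const_mul _)
  exact (h1 (measurableSet_singleton k.1)).inter (h2 (measurableSet_singleton k.2))

lemma disjoint_driftCell (n : ℕ) {k k' : ℤ × ℤ} (h : k ≠ k') :
    Disjoint (driftCell M n k) (driftCell M n k') := by
  refine Set.disjoint_left.2 ?_
  rintro Q ⟨h1, h2⟩ ⟨h3, h4⟩
  exact h (Prod.ext (h1.symm.trans h3) (h2.symm.trans h4))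

lemma iUnion_driftCell (n : ℕ) : ⋃ k, driftCell M n k = Set.univ :=
  Set.eq_univ_of_forall fun _ => Set.mem_iUnion.2 ⟨(_, _), rfl, rfl⟩

/-- Drift cells that agree modulo `n` have the same fractional parts; this is how uniformity of
`driftMod` bounds their total probability. -/
lemma fract_mem_of_floor {n : ℕ} (hn : 0 < n) {d : ℝ} {k : ℤ} (h : ⌊n * d⌋ = k) :
    Int.fract d ∈ Set.Icc (((k % n : ℤ) : ℝ) / n) (((k % n : ℤ) + 1 : ℝ) / n) := by
  have hn' : (0 : ℝ) < n := by exact_mod_cast hn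
  have hnz : (0 : ℤ) < n := by exact_mod_cast hn
  obtain ⟨h1, h2⟩ := Int.floor_eq_iff.1 h
  have hk : ((n : ℝ) * (k / n : ℤ) + (k % n : ℤ)) = k := by
    exact_mod_cast Int.mul_ediv_add_emod k n
  have hc0 : (0 : ℝ) ≤ (k % n : ℤ) := by exact_mod_cast Int.emod_nonneg k hnz.ne'
  have hc1 : ((k % n : ℤ) : ℝ) + 1 ≤ n := by exact_mod_cast Int.emod_lt_of_pos k hnz
  have hfl : ⌊d⌋ = k / n := by
    refine Int.floor_eq_iff.2 ⟨?_, ?_⟩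
    · by_contra hlt
      push Not at hlt
      nlinarith
    · by_contra hlt
      push Not at hlt
      nlinarith
  have hfr : Int.fract d = d - (k / n : ℤ) := by rw [← hfl]; rfl
  rw [hfr]
  refine ⟨?_, ?_⟩
  · rw [div_le_iff₀ hn']; nlinarith
  · rw [le_div_iff₀ hn']; nlinarith

/-- A law of transportation measures with isotropic drift is approximated by a finite mixture. -/
lemma exists_discretization {Q₀ : Transport M} (hQ₀ : Q₀ ∈ isotropic M) {n : ℕ} (hn : 0 < n)
    {ε : ℝ≥0∞} (hε : 0 < ε) :
    ∃ (I : Finset (ℤ × ℤ)) (p : ℤ × ℤ → ℝ≥0) (Q : ℤ × ℤ → Transport M),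
      (∀ k ∈ I, Q k ∈ balanced M) ∧
      (∀ b₁ b₂, ∑ k ∈ I, p k * Q k b₁ b₂ ≤ Q₀ b₁ b₂) ∧
      (∀ c : ℤ × ℤ, ∑ k ∈ I with (k.1 % (n : ℤ), k.2 % (n : ℤ)) = c, p k ≤ ((n : ℝ≥0) ^ 2)⁻¹) ∧
      (1 ≤ ∑ k ∈ I, (p k : ℝ≥0∞) + ε) ∧
      ∀ k ∈ I, ((k.1 : ℝ) / n ≤ (drift (Q k)).1 ∧ (drift (Q k)).1 ≤ (k.1 + 1 : ℝ) / n) ∧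
        ((k.2 : ℝ) / n ≤ (drift (Q k)).2 ∧ (drift (Q k)).2 ≤ (k.2 + 1 : ℝ) / n) := by
  classical
  obtain ⟨ψ, hψ, hbal, hmix, hunif⟩ := hQ₀
  have hn' : (0 : ℝ) < n := by exact_mod_cast hn
  let A := driftCell M n
  have hA : ∀ k, MeasurableSet (A k) := measurableSet_driftCell n
  have hsum : ∑' k, ψ (A k) = 1 := by
    rw [← measure_iUnion (fun k k' h => disjoint_driftCell n h) hA, iUnion_driftCell, measure_univ]
  obtain ⟨I₀, hI₀⟩ : ∃ I₀ : Finset (ℤ × ℤ), 1 ≤ ∑ k ∈ I₀, ψ (A k) + ε := by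
    have : 1 - ε < ∑' k, ψ (A k) := by
      rw [hsum]; exact ENNReal.sub_lt_self (by simp) (by simp) hε.ne'
    rw [ENNReal.tsum_eq_iSup_sum, lt_iSup_iff] at this
    obtain ⟨I₀, h⟩ := this
    exact ⟨I₀, tsub_le_iff_right.1 h.le⟩
  -- Conditioning on a null cell would be meaningless.
  let I := I₀.filter fun k => ψ (A k) ≠ 0
  let p : ℤ × ℤ → ℝ≥0 := fun k => (ψ (A k)).toNNReal
  have hp : ∀ k, (p k : ℝ≥0∞) = ψ (A k) := fun k => ENNReal.coe_toNNReal (measure_ne_top _ _)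
  -- The conditional mean over a cell. Balance and the bounds on the drift are linear conditions,
  -- hence survive averaging.
  let Q : ℤ × ℤ → Transport M := fun k b₁ b₂ =>
    ((ψ (A k))⁻¹ * ∫⁻ Q in A k, (Q b₁ b₂ : ℝ≥0∞) ∂ψ).toNNReal
  have hfin : ∀ b₁ b₂ k, ∫⁻ Q in A k, (Q b₁ b₂ : ℝ≥0∞) ∂ψ ≠ ∞ := fun b₁ b₂ k =>
    ((setLIntegral_le_lintegral _ _).trans_lt (by rw [← hmix]; exact ENNReal.coe_lt_top)).ne
  have hQ : ∀ k ∈ I, ∀ b₁ b₂, (Q k b₁ b₂ : ℝ≥0∞) =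
      (ψ (A k))⁻¹ * ∫⁻ Q in A k, (Q b₁ b₂ : ℝ≥0∞) ∂ψ := by
    intro k hk b₁ b₂
    exact ENNReal.coe_toNNReal (ENNReal.mul_ne_top
      (ENNReal.inv_ne_top.2 (Finset.mem_filter.1 hk).2) (hfin b₁ b₂ k))
  have hmeas : ∀ b₁ b₂ : Bou M, Measurable fun Q : Transport M => (Q b₁ b₂ : ℝ≥0∞) := fun b₁ b₂ =>
    (measurable_transport_apply b₁ b₂).coe_nnreal_ennreal
  have hInt : ∀ b₁ b₂ k, Integrable (fun Q : Transport M => (Q b₁ b₂ : ℝ)) (ψ.restrict (A k)) := by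
    intro b₁ b₂ k
    refine ⟨((measurable_transport_apply b₁ b₂).coe_nnreal_real).aestronglyMeasurable, ?_⟩
    rw [hasFiniteIntegral_iff_enorm]
    simpa using (hfin b₁ b₂ k).lt_top
  have hQreal : ∀ k b₁ b₂, (Q k b₁ b₂ : ℝ) =
      (ψ.real (A k))⁻¹ * ∫ Q in A k, (Q b₁ b₂ : ℝ) ∂ψ := by
    intro k b₁ b₂
    rw [integral_eq_lintegral_of_nonneg_ae (Eventually.of_forall fun _ => NNReal.coe_nonneg _)
      ((measurable_transport_apply b₁ b₂).coe_nnreal_real).aestronglyMeasurable]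
    simp [Q, Measure.real, ENNReal.toReal]
  have hdrift : ∀ k ∈ I, ∀ r : Bou M → Bou M → ℝ, ∀ lo hi : ℝ,
      (∀ Q ∈ A k, lo ≤ ∑ b₁, ∑ b₂, (Q b₁ b₂ : ℝ) * r b₁ b₂ ∧
        ∑ b₁, ∑ b₂, (Q b₁ b₂ : ℝ) * r b₁ b₂ ≤ hi) →
      lo ≤ ∑ b₁, ∑ b₂, (Q k b₁ b₂ : ℝ) * r b₁ b₂ ∧
        ∑ b₁, ∑ b₂, (Q k b₁ b₂ : ℝ) * r b₁ b₂ ≤ hi := by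
    intro k hk r lo hi h
    have hpos : 0 < ψ.real (A k) := by
      have := (Finset.mem_filter.1 hk).2
      exact ENNReal.toReal_pos this (measure_ne_top _ _)
    have hi2 : Integrable (fun Q : Transport M => ∑ b₁, ∑ b₂, (Q b₁ b₂ : ℝ) * r b₁ b₂)
        (ψ.restrict (A k)) :=
      integrable_finsetSum _ fun b₁ _ => integrable_finsetSum _ fun b₂ _ => (hInt b₁ b₂ k).mul_const _
    have heq : ∑ b₁, ∑ b₂, (Q k b₁ b₂ : ℝ) * r b₁ b₂ =
        (ψ.real (A k))⁻¹ * ∫ Q in A k, ∑ b₁, ∑ b₂, (Q b₁ b₂ : ℝ) * r b₁ b₂ ∂ψ := by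
      rw [integral_finsetSum _ fun b₁ _ => integrable_finsetSum _ fun b₂ _ =>
        (hInt b₁ b₂ k).mul_const _, Finset.mul_sum]
      refine Finset.sum_congr rfl fun b₁ _ => ?_
      rw [integral_finsetSum _ fun b₂ _ => (hInt b₁ b₂ k).mul_const _, Finset.mul_sum]
      refine Finset.sum_congr rfl fun b₂ _ => ?_
      rw [integral_mul_const, hQreal, mul_assoc]
    have hlo : ψ.real (A k) * lo ≤ ∫ Q in A k, ∑ b₁, ∑ b₂, (Q b₁ b₂ : ℝ) * r b₁ b₂ ∂ψ := by
      have := setIntegral_mono_on (integrable_const lo) hi2 (hA k) fun Q hQ => (h Q hQ).1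
      simpa using this
    have hhi : ∫ Q in A k, ∑ b₁, ∑ b₂, (Q b₁ b₂ : ℝ) * r b₁ b₂ ∂ψ ≤ ψ.real (A k) * hi := by
      have := setIntegral_mono_on hi2 (integrable_const hi) (hA k) fun Q hQ => (h Q hQ).2
      simpa using this
    rw [heq]
    exact ⟨(le_inv_mul_iff₀ hpos).2 hlo, (inv_mul_le_iff₀ hpos).2 hhi⟩
  refine ⟨I, p, Q, fun k hk b => ?_, fun b₁ b₂ => ?_, fun c => ?_, ?_, fun k hk => ?_⟩
  · have hmarg : ∀ s : Finset (Bou M × Bou M), ((∑ x ∈ s, Q k x.1 x.2 : ℝ≥0) : ℝ≥0∞) =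
        (ψ (A k))⁻¹ * ∫⁻ Q in A k, ((∑ x ∈ s, Q x.1 x.2 : ℝ≥0) : ℝ≥0∞) ∂ψ := by
      intro s
      push_cast
      rw [lintegral_finsetSum _ fun x _ => hmeas x.1 x.2, Finset.mul_sum]
      exact Finset.sum_congr rfl fun x _ => hQ k hk x.1 x.2
    have hL : ∀ Q : Transport M, ∑ b' with b'.reflect = b, Q.exiMarginal b' =
        ∑ x ∈ Finset.univ ×ˢ (Finset.univ.filter fun b' : Bou M => b'.reflect = b), Q x.1 x.2 := by
      intro Q
      rw [Finset.sum_product_right]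
      rfl
    have hR : ∀ Q : Transport M, Q.entMarginal b = ∑ x ∈ {b} ×ˢ Finset.univ, Q x.1 x.2 := by
      intro Q
      rw [Finset.sum_product]
      simp [Transport.entMarginal]
    rw [← ENNReal.coe_inj, hL, hR, hmarg, hmarg]
    congr 1
    refine lintegral_congr_ae ?_
    filter_upwards [ae_restrict_of_ae hbal] with Q hQ
    rw [← hL, ← hR, hQ b]
  · have h1 : ∀ k ∈ I, ((p k * Q k b₁ b₂ : ℝ≥0) : ℝ≥0∞) = ∫⁻ Q in A k, (Q b₁ b₂ : ℝ≥0∞) ∂ψ := by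
      intro k hk
      rw [ENNReal.coe_mul, hp, hQ k hk, ← mul_assoc,
        ENNReal.mul_inv_cancel (Finset.mem_filter.1 hk).2 (measure_ne_top _ _), one_mul]
    rw [← ENNReal.coe_le_coe, ENNReal.ofNNReal_finsetSum, Finset.sum_congr rfl h1, hmix,
      ← lintegral_biUnion_finset (fun k _ k' _ h => disjoint_driftCell n h) fun k _ => hA k]
    exact setLIntegral_le_lintegral _ _
  · rw [← ENNReal.coe_le_coe, ENNReal.ofNNReal_finsetSum]
    simp_rw [hp]
    rw [← measure_biUnion_finset (fun k _ k' _ h => disjoint_driftCell n h) fun k _ => hA k]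
    -- A class of cells modulo `n` confines `driftMod` to a square of side `1 / n`.
    let R : Set (ℝ × ℝ) := Set.Icc ((c.1 : ℝ) / n) ((c.1 + 1 : ℝ) / n) ×ˢ
      Set.Icc ((c.2 : ℝ) / n) ((c.2 + 1 : ℝ) / n)
    have hR : MeasurableSet R := measurableSet_Icc.prod measurableSet_Icc
    calc ψ (⋃ k ∈ I.filter fun k => (k.1 % (n : ℤ), k.2 % (n : ℤ)) = c, A k) ≤ ψ (driftMod ⁻¹' R) := by
          refine measure_mono (Set.iUnion₂_subset fun k hk Q hQ => ?_)
          obtain ⟨-, rfl⟩ := Finset.mem_filter.1 hk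
          exact ⟨fract_mem_of_floor hn hQ.1, fract_mem_of_floor hn hQ.2⟩
      _ = ψ.map driftMod R := (Measure.map_apply measurable_driftMod hR).symm
      _ ≤ volume R := by rw [hunif]; exact Measure.restrict_apply_le _ _
      _ = (((n : ℝ≥0) ^ 2)⁻¹ : ℝ≥0) := by
          simp only [R]
          rw [Measure.volume_eq_prod, Measure.prod_prod, Real.volume_Icc, Real.volume_Icc]
          have : ∀ x : ℝ, (x + 1) / n - x / n = (n : ℝ)⁻¹ := fun x => by field_simp; ring
          rw [this, this, ENNReal.ofReal_inv_of_pos hn', ENNReal.ofReal_natCast,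
            ENNReal.coe_inv (by positivity), ENNReal.coe_pow, ENNReal.coe_natCast, ← sq,
            ENNReal.inv_pow]
  · simp_rw [hp]
    rw [Finset.sum_filter_ne_zero]
    exact hI₀
  · constructor
    · have := hdrift k hk (fun b₁ b₂ => ((M : ℝ) ^ 2)⁻¹ * (b₂.pos.1 - b₁.pos.1)) (k.1 / n) ((k.1 + 1) / n)
      simp only [mul_left_comm _ ((M : ℝ) ^ 2)⁻¹, ← Finset.mul_sum, ← drift_fst] at this
      refine this fun Q hQ => ?_
      obtain ⟨h1, h2⟩ := Int.floor_eq_iff.1 hQ.1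
      constructor
      · rw [div_le_iff₀ hn']; linarith
      · rw [le_div_iff₀ hn']; linarith
    · have := hdrift k hk (fun b₁ b₂ => ((M : ℝ) ^ 2)⁻¹ * (b₂.pos.2 - b₁.pos.2)) (k.2 / n) ((k.2 + 1) / n)
      simp only [mul_left_comm _ ((M : ℝ) ^ 2)⁻¹, ← Finset.mul_sum, ← drift_snd] at this
      refine this fun Q hQ => ?_
      obtain ⟨h1, h2⟩ := Int.floor_eq_iff.1 hQ.2
      constructor
      · rw [div_le_iff₀ hn']; linarith
      · rw [le_div_iff₀ hn']; linarith

end Discretization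

end
end RoutingFlow

namespace RoutingFlow
noncomputable section

/-! ### Embedding of extended squares into the torus as blocks. -/

section Blocks

variable {M : ℕ}

/-- The direction in which one leaves a square through a boundary point. -/
def Bou.dir (b : Bou M) : ℤ × ℤ :=
  match b.1 with
  | .left => (-1, 0)
  | .right => (1, 0)
  | .bottom => (0, -1)
  | .top => (0, 1)

/-- The lattice point which represents a boundary point of the square with lower left corner `0`. -/
def Bou.offset : Bou M → ℤ × ℤ
  | (.left, j) => (-1, (j : ℕ))
  | (.right, j) => (M - 1, (j : ℕ))
  | (.bottom, i) => ((i : ℕ), -1)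
  | (.top, i) => ((i : ℕ), M - 1)

/-- In the block adjoining at `b`, the reflected entrance is therefore the same lattice point as the
exit. -/
lemma Bou.offset_reflect (b : Bou M) :
    b.reflect.offset = (b.offset.1 - M * b.dir.1, b.offset.2 - M * b.dir.2) := by
  obtain ⟨s, j⟩ := b
  cases s <;> simp [Bou.reflect, Side.opposite, Bou.offset, Bou.dir] <;> ring

lemma Bou.offset_mem (b : Bou M) : (-1 ≤ b.offset.1 ∧ b.offset.1 ≤ M - 1) ∧
    (-1 ≤ b.offset.2 ∧ b.offset.2 ≤ M - 1) := by
  obtain ⟨s, j⟩ := b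
  have := j.isLt
  cases s <;> simp only [Bou.offset] <;> omega

/-- Offset of an edge of the extended square. -/
def edgeOffset : SquareEdge M → ℤ × ℤ
  | .inl (.inl (i, j)) => ((i : ℕ), (j : ℕ))
  | .inl (.inr (i, j)) => ((i : ℕ), (j : ℕ))
  | .inr b => b.offset

/-- Whether an edge of the extended square is horizontal. -/
def isHorizontal : SquareEdge M → Bool
  | .inl (.inl _) => true
  | .inl (.inr _) => false
  | .inr (.left, _) => true
  | .inr (.right, _) => true
  | .inr (.bottom, _) => false
  | .inr (.top, _) => false

/-- The half-edges on the right and top sides. -/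
def contracted (M : ℕ) : Set (SquareEdge M) := {e | ∃ j, e = .inr (.right, j) ∨ e = .inr (.top, j)}

lemma edgeOffset_inj {e e' : SquareEdge M} (h : isHorizontal e = isHorizontal e')
    (h' : edgeOffset e = edgeOffset e') : e = e' := by
  rcases e with (⟨i, j⟩ | ⟨i, j⟩) | ⟨_ | _ | _ | _, j⟩ <;>
  rcases e' with (⟨i', j'⟩ | ⟨i', j'⟩) | ⟨_ | _ | _ | _, j'⟩ <;>
  simp only [isHorizontal, reduceCtorEq] at h <;>
  simp only [edgeOffset, Bou.offset, Prod.mk.injEq] at h' <;>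
  first
  | (exfalso; omega)
  | (have e1 : j = j' := Fin.ext (by omega)
     have e2 : i = i' := Fin.ext (by omega)
     rw [e1, e2])
  | (have e1 : j = j' := Fin.ext (by omega)
     rw [e1])

lemma edgeOffset_mem (e : SquareEdge M) : (-1 ≤ (edgeOffset e).1 ∧ (edgeOffset e).1 ≤ M - 1) ∧
    (-1 ≤ (edgeOffset e).2 ∧ (edgeOffset e).2 ≤ M - 1) := by
  rcases e with (⟨i, j⟩ | ⟨i, j⟩) | b
  · have := i.isLt; have := j.isLt; simp only [edgeOffset]; omega
  · have := i.isLt; have := j.isLt; simp only [edgeOffset]; omega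
  · exact b.offset_mem

/-- With `edgeOffset_mem`, the offsets of each orientation lie in a window of side `M`, so windows
of different blocks are disjoint. -/
lemma edgeOffset_mem_of_notMem {e : SquareEdge M} (he : e ∉ contracted M) :
    if isHorizontal e then
      ((edgeOffset e).1 ≤ M - 2 ∧ 0 ≤ (edgeOffset e).2)
    else (0 ≤ (edgeOffset e).1 ∧ (edgeOffset e).2 ≤ M - 2) := by
  rcases e with (⟨i, j⟩ | ⟨i, j⟩) | ⟨_ | _ | _ | _, j⟩
  · have := i.isLt; simp only [isHorizontal, edgeOffset, if_true]; omega
  · have := j.isLt; simp only [isHorizontal, edgeOffset]; simp; omega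
  · have := j.isLt; simp only [isHorizontal, edgeOffset, Bou.offset, if_true]; omega
  · exact absurd ⟨j, Or.inl rfl⟩ he
  · have := j.isLt; simp only [isHorizontal, edgeOffset, Bou.offset]; simp; omega
  · exact absurd ⟨j, Or.inr rfl⟩ he

variable (N : ℕ) [NeZero N]

/-- The lattice point with offset `o` in the block `A`. -/
def blockPt (M : ℕ) (A o : ℤ × ℤ) : TorusVertex N := pt N (M * A.1 + o.1, M * A.2 + o.2)

/-- The embedding into the torus of the vertices of the extended square, placed at block `A`. -/
def blockVertex (A : ℤ × ℤ) : SquareVertex M → TorusVertex N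
  | .inl (i, j) => blockPt N M A ((i : ℕ), (j : ℕ))
  | .inr b => blockPt N M A b.offset

/-- The embedding into the torus of the edges of the extended square, placed at block `A`. -/
def blockEdge (A : ℤ × ℤ) (e : SquareEdge M) : TorusEdge N :=
  if isHorizontal e then .inl (blockPt N M A (edgeOffset e)) else .inr (blockPt N M A (edgeOffset e))

variable {N}

/-- Right and top boundary points sit on the vertex next to them. The edge between two blocks is the
left or bottom half-edge of one of them, which is why the other half-edge has cost-factor 0. -/
lemma blockVertex_eq_of_mem_contracted (A : ℤ × ℤ) {e : SquareEdge M} (he : e ∈ contracted M) :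
    blockVertex N A (squareEnds M e).1 = blockVertex N A (squareEnds M e).2 := by
  obtain ⟨j, rfl | rfl⟩ := he <;>
  · have := j.isLt
    have h1 : ((M - 1 : ℕ) : ℤ) = M - 1 := by omega
    simp [squareEnds, blockVertex, Bou.inner, Bou.offset, h1]

lemma torusEnds_blockEdge (A : ℤ × ℤ) {e : SquareEdge M} (he : e ∉ contracted M) :
    torusEnds N (blockEdge N A e) =
      (blockVertex N A (squareEnds M e).1, blockVertex N A (squareEnds M e).2) := by
  rcases e with (⟨i, j⟩ | ⟨i, j⟩) | ⟨_ | _ | _ | _, j⟩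
  · simp [blockEdge, isHorizontal, edgeOffset, blockPt, pt, torusEnds, squareEnds, blockVertex,
      cyclicSucc_red, add_assoc]
  · simp [blockEdge, isHorizontal, edgeOffset, blockPt, pt, torusEnds, squareEnds, blockVertex,
      cyclicSucc_red, add_assoc]
  · simp [blockEdge, isHorizontal, edgeOffset, blockPt, pt, torusEnds, squareEnds, blockVertex,
      cyclicSucc_red, Bou.inner, Bou.offset]
  · exact absurd ⟨j, Or.inl rfl⟩ he
  · simp [blockEdge, isHorizontal, edgeOffset, blockPt, pt, torusEnds, squareEnds, blockVertex,
      cyclicSucc_red, Bou.inner, Bou.offset]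
  · exact absurd ⟨j, Or.inr rfl⟩ he

lemma UnitFlow.toBlock (A : ℤ × ℤ) {x y : SquareVertex M} {f : SquareEdge M → ℝ≥0∞}
    (hf : UnitFlow (square M) x y f) :
    UnitFlow (torus N) (blockVertex N A x) (blockVertex N A y)
      (pushFlow (contracted M) (blockEdge N A) f) := by
  refine hf.map (G' := torus N) (fun _ => trivial) (fun e he x y h => ?_) (fun e he x y h => ?_)
  · have := blockVertex_eq_of_mem_contracted (N := N) A he
    rcases h with h | h <;> rw [h] at this
    · exact this
    · exact this.symm
  · have := torusEnds_blockEdge (N := N) A he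
    rcases h with h | h <;> rw [h] at this
    · exact Or.inl this
    · exact Or.inr this

lemma red_inj {x y : ℤ} (h : red N x = red N y) (hxy : |x - y| < N) : x = y := by
  rw [red_eq_iff] at h
  have : (N : ℤ) ∣ x - y := Int.ModEq.dvd (Eq.symm h)
  have := Int.eq_zero_of_abs_lt_dvd this hxy
  omega

lemma blockPt_inj {A o A' o' : ℤ × ℤ} (h : blockPt N M A o = blockPt N M A' o')
    (h1 : |M * A.1 + o.1 - (M * A'.1 + o'.1)| < N) (h2 : |M * A.2 + o.2 - (M * A'.2 + o'.2)| < N) :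
    M * A.1 + o.1 = M * A'.1 + o'.1 ∧ M * A.2 + o.2 = M * A'.2 + o'.2 := by
  simp only [blockPt, pt, Prod.mk.injEq] at h
  exact ⟨red_inj h.1 h1, red_inj h.2 h2⟩

lemma blockEdge_eq_iff {A A' : ℤ × ℤ} {e e' : SquareEdge M} :
    blockEdge N A e = blockEdge N A' e' ↔ isHorizontal e = isHorizontal e' ∧
      blockPt N M A (edgeOffset e) = blockPt N M A' (edgeOffset e') := by
  unfold blockEdge
  cases isHorizontal e <;> cases isHorizontal e' <;> simp

/-- With the contracted half-edges included, an offset coordinate takes the `M + 1` values from `-1`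
to `M - 1`. -/
lemma blockEdge_injective (hMN : M + 1 ≤ N) (A : ℤ × ℤ) :
    Function.Injective (blockEdge (M := M) N A) := by
  intro e e' h
  obtain ⟨h1, h2⟩ := blockEdge_eq_iff.1 h
  have a1 := edgeOffset_mem e
  have a2 := edgeOffset_mem e'
  have h3 := blockPt_inj h2 (by rw [abs_lt]; omega) (by rw [abs_lt]; omega)
  exact edgeOffset_inj h1 (Prod.ext (by omega) (by omega))

lemma eq_of_mul_add_eq {m a a' o o' : ℤ} (h : m * a + o = m * a' + o') (h1 : |o - o'| < m) :
    a = a' ∧ o = o' := by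
  have hd : m ∣ o - o' := ⟨a' - a, by linarith⟩
  have h0 := Int.eq_zero_of_abs_lt_dvd hd h1
  have ho : o = o' := by omega
  have hm : 0 < m := (abs_nonneg _).trans_lt h1
  refine ⟨?_, ho⟩
  subst ho
  exact mul_left_cancel₀ hm.ne' (by linarith)

/-- The integer coordinates of a block. -/
def blockIdx {K : ℕ} (α : Fin K × Fin K) : ℤ × ℤ := ((α.1 : ℕ), (α.2 : ℕ))

/-- This lets the blocks choose their flows independently: neither loads nor costs interact. -/
lemma blockEdge_injOn {K : ℕ} (hK : M * K ≤ N) {α α' : Fin K × Fin K} {e e' : SquareEdge M}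
    (he : e ∉ contracted M) (he' : e' ∉ contracted M)
    (h : blockEdge N (blockIdx α) e = blockEdge N (blockIdx α') e') : α = α' ∧ e = e' := by
  obtain ⟨h1, h2⟩ := blockEdge_eq_iff.1 h
  have a1 := edgeOffset_mem e
  have a2 := edgeOffset_mem e'
  have b1 := edgeOffset_mem_of_notMem he
  have b2 := edgeOffset_mem_of_notMem he'
  have hK' : (M : ℤ) * K ≤ N := by exact_mod_cast hK
  have bd : ∀ a : Fin K, (0 : ℤ) ≤ M * (a : ℕ) ∧ (M : ℤ) * (a : ℕ) + M ≤ M * K := by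
    intro a
    have : (a : ℕ) + 1 ≤ K := a.isLt
    have : M * ((a : ℕ) + 1) ≤ M * K := Nat.mul_le_mul_left _ this
    refine ⟨by positivity, ?_⟩
    have h3 : ((M * ((a : ℕ) + 1) : ℕ) : ℤ) ≤ ((M * K : ℕ) : ℤ) := by exact_mod_cast this
    push_cast at h3
    linarith
  have c1 := bd α.1
  have c2 := bd α.2
  have c3 := bd α'.1
  have c4 := bd α'.2
  simp only [blockIdx] at h2
  rw [← h1] at b2
  cases hh : isHorizontal e <;> simp only [hh, if_true, Bool.false_eq_true, if_false] at b1 b2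
  all_goals
    have h3 := blockPt_inj h2 (by simp only; rw [abs_lt]; omega) (by simp only; rw [abs_lt]; omega)
    simp only at h3
    obtain ⟨d1, d2⟩ := eq_of_mul_add_eq h3.1 (by rw [abs_lt]; omega)
    obtain ⟨d3, d4⟩ := eq_of_mul_add_eq h3.2 (by rw [abs_lt]; omega)
    exact ⟨Prod.ext (Fin.ext (by exact Nat.cast_injective d1)) (Fin.ext (by exact Nat.cast_injective d3)),
      edgeOffset_inj h1 (Prod.ext d2 d4)⟩

/-- The superposition of flows in all blocks. -/
def blockSum (N : ℕ) [NeZero N] {K : ℕ} (f : Fin K × Fin K → SquareEdge M → ℝ≥0∞)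
    (e' : TorusEdge N) : ℝ≥0∞ :=
  ∑ α, pushFlow (contracted M) (blockEdge N (blockIdx α)) (f α) e'

open Classical in
lemma blockSum_eq_sum {K : ℕ} (f : Fin K × Fin K → SquareEdge M → ℝ≥0∞) (e' : TorusEdge N) :
    blockSum N f e' = ∑ x : (Fin K × Fin K) × SquareEdge M with
      x.2 ∉ contracted M ∧ blockEdge N (blockIdx x.1) x.2 = e', f x.1 x.2 := by
  simp only [blockSum, pushFlow, Finset.sum_filter]
  symm
  rw [Fintype.sum_prod_type]
  refine Finset.sum_congr rfl fun α _ => Finset.sum_congr rfl fun e _ => ?_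
  congr

lemma blockSum_cases {K : ℕ} (hK : M * K ≤ N) (f : Fin K × Fin K → SquareEdge M → ℝ≥0∞)
    (e' : TorusEdge N) : blockSum N f e' = 0 ∨ ∃ α e, e ∉ contracted M ∧
      blockEdge N (blockIdx α) e = e' ∧ blockSum N f e' = f α e := by
  classical
  by_cases h : ∃ x : (Fin K × Fin K) × SquareEdge M, x.2 ∉ contracted M ∧
      blockEdge N (blockIdx x.1) x.2 = e'
  · obtain ⟨⟨α, e⟩, h1, h2⟩ := h
    refine Or.inr ⟨α, e, h1, h2, ?_⟩
    rw [blockSum_eq_sum, Finset.sum_eq_single (α, e)]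
    · rintro ⟨α', e''⟩ hx hne
      simp only [Finset.mem_filter, Finset.mem_univ, true_and] at hx
      obtain ⟨rfl, rfl⟩ := blockEdge_injOn hK hx.1 h1 (hx.2.trans h2.symm)
      exact absurd rfl hne
    · intro hx
      simp only [Finset.mem_filter, Finset.mem_univ, true_and] at hx
      exact absurd ⟨h1, h2⟩ hx
  · left
    rw [blockSum_eq_sum, Finset.sum_eq_zero]
    intro x hx
    exact absurd ⟨x, by simpa using hx⟩ h

lemma blockSum_le {K : ℕ} (hK : M * K ≤ N) {f : Fin K × Fin K → SquareEdge M → ℝ≥0∞} {B : ℝ≥0∞}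
    (hf : ∀ α e, f α e ≤ B) (e' : TorusEdge N) : blockSum N f e' ≤ B := by
  rcases blockSum_cases hK f e' with h | ⟨α, e, -, -, h⟩
  · simp [h]
  · rw [h]; exact hf α e

open Classical in
/-- The environment seen in block `A`. -/
def blockEnv (A : ℤ × ℤ) (c : TorusEdge N → ℝ≥0) (e : SquareEdge M) : ℝ≥0 :=
  if e ∈ contracted M then 0 else c (blockEdge N A e)

/-- No torus edge receives flow from two blocks, so the squares do not mix. -/
lemma cost_blockSum_le {K : ℕ} (hK : M * K ≤ N) (f : Fin K × Fin K → SquareEdge M → ℝ≥0∞)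
    (c : TorusEdge N → ℝ≥0) :
    cost (blockSum N f) c ≤ ∑ α, cost (f α) (blockEnv (blockIdx α) c) := by
  classical
  unfold cost
  calc ∑ e', (c e' : ℝ≥0∞) * blockSum N f e' ^ 2
      ≤ ∑ e', ∑ x : (Fin K × Fin K) × SquareEdge M with blockEdge N (blockIdx x.1) x.2 = e',
          (blockEnv (blockIdx x.1) c x.2 : ℝ≥0∞) * f x.1 x.2 ^ 2 := by
        gcongr with e' _
        rcases blockSum_cases hK f e' with h | ⟨α, e, he, he', h⟩
        · simp [h]
        · rw [h]
          have := Finset.single_le_sum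
            (f := fun x : (Fin K × Fin K) × SquareEdge M =>
              (blockEnv (blockIdx x.1) c x.2 : ℝ≥0∞) * f x.1 x.2 ^ 2)
            (s := Finset.univ.filter fun x : (Fin K × Fin K) × SquareEdge M =>
              blockEdge N (blockIdx x.1) x.2 = e') (fun _ _ => zero_le) (a := (α, e)) (by simpa using he')
          refine le_trans (le_of_eq ?_) this
          simp [blockEnv, he, he']
    _ = ∑ x : (Fin K × Fin K) × SquareEdge M,
          (blockEnv (blockIdx x.1) c x.2 : ℝ≥0∞) * f x.1 x.2 ^ 2 :=
        Finset.sum_fiberwise _ (fun x : (Fin K × Fin K) × SquareEdge M =>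
          blockEdge N (blockIdx x.1) x.2) _
    _ = _ := by rw [Fintype.sum_prod_type]

open ProbabilityTheory in
/-- The environment seen in a block of the translated torus has the law of the environment on the
extended square. -/
lemma map_blockEnv (κ : Measure ℝ≥0) [IsProbabilityMeasure κ] (hMN : M + 1 ≤ N) (A : ℤ × ℤ)
    (τ : TorusVertex N) :
    (torusEnvLaw κ N).map (fun c => blockEnv (M := M) A fun e => c (edgeShift τ e))
      = squareEnvLaw κ M := by
  classical
  let F : SquareEdge M → ℝ≥0 → ℝ≥0 := fun e => if e ∈ contracted M then fun _ => 0 else id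
  have : IsProbabilityMeasure (torusEnvLaw κ N) := by unfold torusEnvLaw; infer_instance
  have hF : ∀ e, Measurable (F e) := by
    intro e
    simp only [F]
    split_ifs
    · exact measurable_const
    · exact measurable_id
  let g : SquareEdge M → TorusEdge N := fun e => edgeShift τ (blockEdge N A e)
  have hg : g.Injective := (edgeShift τ).injective.comp (blockEdge_injective hMN A)
  have h1 : iIndepFun (fun (e : TorusEdge N) (c : TorusEdge N → ℝ≥0) => c e)
      (torusEnvLaw κ N) :=
    iIndepFun_pi (μ := fun _ : TorusEdge N => κ) (X := fun _ x => x) fun _ => aemeasurable_id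
  have h2 := (h1.precomp hg).comp F hF
  have h3 := (iIndepFun_iff_map_fun_eq_pi_map (fun e =>
    ((hF e).comp (measurable_pi_apply (g e))).aemeasurable)).1 h2
  have h4 : (fun c : TorusEdge N → ℝ≥0 => blockEnv (M := M) A fun e => c (edgeShift τ e)) =
      fun c e => F e (c (g e)) := by
    ext c e
    simp only [blockEnv, F, g]
    split_ifs <;> rfl
  rw [h4]
  refine h3.trans ?_
  unfold squareEnvLaw
  congr 1
  ext1 e
  have h5 : ((torusEnvLaw κ N).map (F e ∘ fun c : TorusEdge N → ℝ≥0 => c (g e))) = κ.map (F e) := by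
    rw [← Measure.map_map (hF e) (measurable_pi_apply (g e))]
    congr 1
    exact (measurePreserving_eval (fun _ : TorusEdge N => κ) (g e)).map_eq
  refine h5.trans ?_
  rcases e with e | ⟨_ | _ | _ | _, j⟩ <;> simp [F, contracted]

end Blocks

end
end RoutingFlow

namespace RoutingFlow
noncomputable section

lemma vol_add {N : ℕ} (f g : TorusEdge N → ℝ≥0∞) : vol (f + g) = vol f + vol g := by
  simp [vol, Finset.sum_add_distrib]

/-! ### Gates between blocks, and the displacement of an itinerary. -/

section Gates

variable {M N K : ℕ} [NeZero N]

/-- The vertex of the torus which represents the boundary point `b` of the block `α`. -/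
def gate (N : ℕ) [NeZero N] (α : Fin K × Fin K) (b : Bou M) : TorusVertex N :=
  blockPt N M (blockIdx α) b.offset

lemma tdist_gate_le (α : Fin K × Fin K) (x y : Bou M) :
    tdist (gate N α x) (gate N α y) ≤ 2 * M := by
  have h := tdist_pt_le (N := N) (M * (blockIdx α).1 + x.offset.1, M * (blockIdx α).2 + x.offset.2)
    (M * (blockIdx α).1 + y.offset.1, M * (blockIdx α).2 + y.offset.2)
  have h1 := x.offset_mem
  have h2 := y.offset_mem
  have h3 : |(M * (blockIdx α).1 + x.offset.1) - (M * (blockIdx α).1 + y.offset.1)| ≤ M := by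
    rw [abs_le]; omega
  have h4 : |(M * (blockIdx α).2 + x.offset.2) - (M * (blockIdx α).2 + y.offset.2)| ≤ M := by
    rw [abs_le]; omega
  unfold gate blockPt
  simp only at h
  omega

end Gates

/-- The displacement, in blocks, along an itinerary. -/
def displacement {M : ℕ} (l : List (Bou M × Bou M)) : ℤ × ℤ := (l.map fun a => a.2.dir).sum

lemma displacement_eq {M : ℕ} (l : List (Bou M × Bou M)) :
    displacement l = ∑ a : Bou M × Bou M, (l.count a) • a.2.dir := by
  induction l with
  | nil => simp [displacement]
  | cons a l ih =>
    have h : displacement (a :: l) = a.2.dir + displacement l := by simp [displacement]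
    simp only [h, ih, List.count_cons, add_smul, Finset.sum_add_distrib]
    rw [add_comm]
    congr 1
    simp [ite_smul]

/-! ### Travelling through the blocks along an itinerary. -/

section Travel

variable {M N K : ℕ} [NeZero N] [NeZero K]

/-- The block reached by leaving the block `α` through `b`. -/
def nextBlock (α : Fin K × Fin K) (b : Bou M) : Fin K × Fin K := α + pt K b.dir

/-- The sum of `φ` over the legs of an itinerary which starts in the block `α`. -/
def traceSum (φ : Fin K × Fin K → Bou M → Bou M → ℝ≥0∞) :
    Fin K × Fin K → List (Bou M × Bou M) → ℝ≥0∞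
  | _, [] => 0
  | α, (x, b) :: l => φ α x b + traceSum φ (nextBlock α b) l

/-- Moves between blocks are translations of the `K × K` torus. As the starting block varies, each
leg is made in every block exactly once. -/
lemma sum_traceSum (φ : Fin K × Fin K → Bou M → Bou M → ℝ≥0∞) (l : List (Bou M × Bou M)) :
    ∑ α, traceSum φ α l = ∑ a, (l.count a : ℝ≥0∞) * ∑ α, φ α a.1 a.2 := by
  induction l with
  | nil => simp [traceSum]
  | cons a l ih =>
    obtain ⟨x, b⟩ := a
    simp only [traceSum, Finset.sum_add_distrib]
    have h : ∑ α, traceSum φ (nextBlock α b) l = ∑ α, traceSum φ α l :=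
      Equiv.sum_comp (Equiv.addRight (pt K b.dir)) fun α => traceSum φ α l
    rw [h, ih]
    simp only [List.count_cons, Nat.cast_add, add_mul, Finset.sum_add_distrib]
    rw [add_comm]
    congr 1
    simp

/-- The connection from the exit `b` of a block to the matching entrance of the next block. -/
def wrapFlow (N : ℕ) [NeZero N] (α : Fin K × Fin K) (b : Bou M) : TorusEdge N → ℝ≥0∞ :=
  shortest (gate N α b) (gate N (nextBlock α b) b.reflect)

/-- The connections at the mismatches of an itinerary. -/
def mismatchFlow (N : ℕ) [NeZero N] :
    Fin K × Fin K → Bou M → List (Bou M × Bou M) → TorusEdge N → ℝ≥0∞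
  | _, _, [] => 0
  | α, y, (x, b) :: l =>
    shortest (gate N α y) (gate N α x) + mismatchFlow N (nextBlock α b) b.reflect l

/-- The entrance reached at the end of an itinerary. -/
def lastEntrance : Bou M → List (Bou M × Bou M) → Bou M
  | y, [] => y
  | _, (_, b) :: l => lastEntrance b.reflect l

lemma pt_add (x y : ℤ × ℤ) : pt K (x + y) = pt K x + pt K y := by
  simp [pt, red_add]

lemma unitFlow_travel {g : Fin K × Fin K → Bou M → Bou M → TorusEdge N → ℝ≥0∞}
    (hg : ∀ α b₁ b₂, UnitFlow (torus N) (gate N α b₁) (gate N α b₂) (g α b₁ b₂))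
    (l : List (Bou M × Bou M)) (α : Fin K × Fin K) (y : Bou M) :
    UnitFlow (torus N) (gate N α y) (gate N (α + pt K (displacement l)) (lastEntrance y l))
      fun e => traceSum (fun α x b => g α x b e) α l + traceSum (fun α _ b => wrapFlow N α b e) α l
        + mismatchFlow N α y l e := by
  induction l generalizing α y with
  | nil =>
    have h0 : pt K (displacement ([] : List (Bou M × Bou M))) = 0 := by
      simp [displacement, pt, red_zero]
    rw [h0, add_zero]
    refine (congrArg (UnitFlow (torus N) _ _) ?_).mp
      (UnitFlow.refl (G := torus N) (v := gate N α y) trivial)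
    ext e
    simp [traceSum, mismatchFlow]
  | cons a l ih =>
    obtain ⟨x, b⟩ := a
    have h1 := unitFlow_shortest (gate N α y) (gate N α x)
    have h2 := h1.trans (hg α x b)
    have h3 := h2.trans (unitFlow_shortest (gate N α b) (gate N (nextBlock α b) b.reflect))
    have h4 := h3.trans (ih (nextBlock α b) b.reflect)
    have h5 : nextBlock α b + pt K (displacement l) = α + pt K (displacement ((x, b) :: l)) := by
      rw [nextBlock, add_assoc, ← pt_add]
      simp [displacement]
    rw [h5] at h4
    refine (congrArg (UnitFlow (torus N) _ _) ?_).mp h4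
    ext e
    simp only [traceSum, mismatchFlow, Pi.add_apply, wrapFlow]
    ring

lemma vol_mismatchFlow_le (l : List (Bou M × Bou M)) (α : Fin K × Fin K) (y : Bou M) :
    vol (mismatchFlow N α y l) ≤ (mismatches y l * (2 * M) : ℕ) := by
  induction l generalizing α y with
  | nil => simp [mismatchFlow, vol]
  | cons a l ih =>
    obtain ⟨x, b⟩ := a
    rw [mismatchFlow, mismatches, vol_add, add_mul, Nat.cast_add]
    refine add_le_add ((vol_shortest_le _ _).trans ?_) (ih _ _)
    split_ifs with h
    · simp [h, tdist_self]
    · rw [one_mul]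
      exact_mod_cast tdist_gate_le α y x

lemma blockIdx_add (α : Fin K × Fin K) (d : ℤ × ℤ) :
    blockIdx (α + pt K d) = (((α.1 : ℕ) + d.1) % K, ((α.2 : ℕ) + d.2) % K) := by
  have : ∀ (a : Fin K) (x : ℤ), (((a + red K x : Fin K) : ℕ) : ℤ) = ((a : ℕ) + x) % K := by
    intro a x
    rw [← red_val, red_add, red_coe]
  simp [blockIdx, pt, this]

/-- A bound for the length of `wrapFlow`. -/
def wrapBound (α : Fin K × Fin K) (b : Bou M) : ℕ :=
  match b.1 with
  | .left => if α.1 = 0 then M else 0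
  | .right => if α.1 = -1 then M else 0
  | .bottom => if α.2 = 0 then M else 0
  | .top => if α.2 = -1 then M else 0

/-- The two gates coincide unless the move goes around the `K × K` torus; then only the leftover
strip, of width `N - M * K ≤ M`, separates them. -/
lemma tdist_wrap_le (hK : M * K ≤ N) (hN : N ≤ M * K + M) (α : Fin K × Fin K) (b : Bou M) :
    tdist (gate N α b) (gate N (nextBlock α b) b.reflect) ≤
      wrapBound α b := by
  have hKpos : (0 : ℤ) < K := by exact_mod_cast Nat.pos_of_ne_zero (NeZero.ne K)
  have hshift : ∀ q : ℤ, ∀ x : ℤ, red N (x - M * K * q) = red N (x + (N - M * K) * q) := by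
    intro q x
    rw [red_eq_iff]
    have : x + ((N : ℤ) - M * K) * q = x - M * K * q + N * q := by ring
    rw [this, Int.add_mul_emod_self_left]
  have hneg : ∀ a : Fin K, (a = -1 ↔ ((a : ℕ) : ℤ) + 1 = K) := by
    intro a
    have hval : (((-1 : Fin K) : ℕ) : ℤ) = K - 1 := by
      have h1 : (1 : Fin K) = red K 1 := by
        apply Fin.ext
        have : ((red K 1 : ℕ) : ℤ) = ((1 % K : ℕ) : ℤ) := by rw [red_val]; push_cast; rfl
        have : (red K 1 : ℕ) = 1 % K := by exact_mod_cast this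
        rw [this]
        rfl
      rw [h1, ← red_neg, red_val]
      have : (-1 : ℤ) = (K - 1) + K * (-1) := by ring
      rw [this, Int.add_mul_emod_self_left]
      exact Int.emod_eq_of_lt (by omega) (by omega)
    constructor
    · rintro rfl; rw [hval]; ring
    · intro h
      apply Fin.ext
      have : ((a : ℕ) : ℤ) = ((-1 : Fin K) : ℕ) := by rw [hval]; omega
      exact_mod_cast this
  have hzero : ∀ a : Fin K, (a = 0 ↔ ((a : ℕ) : ℤ) = 0) := by
    intro a
    rw [Fin.ext_iff]
    simp
  have hlt : ∀ a : Fin K, ((a : ℕ) : ℤ) < K := fun a => by exact_mod_cast a.isLt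
  -- `q` counts the turns around the torus of blocks; each turn skips the strip once.
  have step : ∀ (a : Fin K) (d o : ℤ), ∀ q : ℤ, ((a : ℕ) + d : ℤ) / K = q →
      (cdist (red N (M * (a : ℕ) + o)) (red N (M * (((a : ℕ) + d) % K) + (o - M * d))) : ℤ)
        ≤ M * |q| := by
    intro a d o q hq
    have h1 : ((a : ℕ) + d : ℤ) % K = (a : ℕ) + d - K * q := by
      rw [← hq]; exact Int.emod_def _ _
    rw [h1]
    have h2 : (M : ℤ) * ((a : ℕ) + d - K * q) + (o - M * d) = M * (a : ℕ) + o - M * K * q := by ring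
    rw [h2, hshift]
    refine (cdist_red_le _ _).trans ?_
    have h3 : (M : ℤ) * (a : ℕ) + o - (M * (a : ℕ) + o + (N - M * K) * q) = -((N - M * K) * q) := by ring
    rw [h3, abs_neg, abs_mul]
    gcongr
    have h4 : (M : ℤ) * K ≤ N := by exact_mod_cast hK
    have h5 : (N : ℤ) ≤ M * K + M := by exact_mod_cast hN
    rw [abs_of_nonneg (by linarith)]
    linarith
  have hdiv : ∀ (a : Fin K), ((a : ℕ) + 0 : ℤ) / K = 0 := fun a => by
    rw [add_zero]; exact Int.ediv_eq_zero_of_lt (by omega) (hlt a)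
  have hdivp : ∀ (a : Fin K), ((a : ℕ) + 1 : ℤ) / K = if a = -1 then 1 else 0 := by
    intro a
    have := hlt a
    split_ifs with h
    · rw [(hneg a).1 h]; exact Int.ediv_self hKpos.ne'
    · rw [hneg] at h
      exact Int.ediv_eq_zero_of_lt (by omega) (by omega)
  have hdivm : ∀ (a : Fin K), ((a : ℕ) + -1 : ℤ) / K = if a = 0 then -1 else 0 := by
    intro a
    have := hlt a
    split_ifs with h
    · rw [(hzero a).1 h, zero_add]
      have h1 : (-1 : ℤ) = (K - 1) + K * (-1) := by ring
      rw [h1, Int.add_mul_ediv_left _ _ hKpos.ne', Int.ediv_eq_zero_of_lt (by omega) (by omega)]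
      ring
    · rw [hzero] at h
      exact Int.ediv_eq_zero_of_lt (by omega) (by omega)
  have key := fun (d : ℤ × ℤ) (o : ℤ × ℤ) => add_le_add (step α.1 d.1 o.1 _ rfl) (step α.2 d.2 o.2 _ rfl)
  have hval := key b.dir b.offset
  have heq : (tdist (gate N α b) (gate N (nextBlock α b) b.reflect) : ℤ) =
      (cdist (red N (M * (α.1 : ℕ) + b.offset.1))
        (red N (M * (((α.1 : ℕ) + b.dir.1) % K) + (b.offset.1 - M * b.dir.1))) : ℤ) +
      cdist (red N (M * (α.2 : ℕ) + b.offset.2))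
        (red N (M * (((α.2 : ℕ) + b.dir.2) % K) + (b.offset.2 - M * b.dir.2))) := by
    rw [tdist, gate, gate, nextBlock, blockIdx_add, Bou.offset_reflect]
    simp [blockPt, pt, blockIdx]
  rw [← heq] at hval
  obtain ⟨s, j⟩ := b
  zify
  refine hval.trans ?_
  cases s <;> simp only [Bou.dir, hdiv, hdivp, hdivm, wrapBound] <;> split_ifs <;> simp

/-- Only the `K` blocks along one side of the strip contribute, each at most `M`. -/
lemma sum_vol_wrapFlow_le (hK : M * K ≤ N) (hN : N ≤ M * K + M) (b : Bou M) :
    ∑ α : Fin K × Fin K, vol (wrapFlow N α b) ≤ N := by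
  have h1 : ∀ α : Fin K × Fin K, vol (wrapFlow N α b) ≤
      (wrapBound α b : ℝ≥0∞) := fun α =>
    (vol_shortest_le _ _).trans (by exact_mod_cast tdist_wrap_le hK hN α b)
  refine (Finset.sum_le_sum fun α _ => h1 α).trans ?_
  rw [← Nat.cast_sum]
  have h2 : ∑ α : Fin K × Fin K, wrapBound α b = M * K := by
    rw [Fintype.sum_prod_type]
    obtain ⟨s, j⟩ := b
    cases s <;> first
      | (simp [wrapBound, mul_comm]; done)
      | (rw [Finset.sum_comm]; simp [wrapBound, mul_comm])
  rw [h2]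
  exact_mod_cast hK

end Travel

end
end RoutingFlow

namespace RoutingFlow
noncomputable section

/-! ### Drift of a measure against displacement of its itinerary. -/

section Drift

variable {M : ℕ}

/-- Balance replaces the entrance by the reflected exit, so only `r b₂ - r b₂.reflect` remains: the
drift sees nothing but exit directions. -/
lemma sum_balanced {Q : Transport M} (hQ : Q ∈ balanced M) (r d : Bou M → ℝ)
    (h : ∀ b : Bou M, r b - r b.reflect = M * d b) :
    ∑ b₁, ∑ b₂, (Q b₁ b₂ : ℝ) * (r b₂ - r b₁) = M * ∑ a : Bou M × Bou M, (Q a.1 a.2 : ℝ) * d a.2 := by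
  have h1 : ∑ b₁, ∑ b₂, (Q b₁ b₂ : ℝ) * r b₁ = ∑ b₁, ∑ b₂, (Q b₁ b₂ : ℝ) * r b₂.reflect := by
    calc ∑ b₁, ∑ b₂, (Q b₁ b₂ : ℝ) * r b₁ = ∑ b, (Q.entMarginal b : ℝ) * r b := by
          simp [Transport.entMarginal, Finset.sum_mul]
      _ = ∑ b : Bou M, (Q.exiMarginal b.reflect : ℝ) * r b.reflect.reflect := by
          simp only [entMarginal_reflect hQ, Bou.reflect_reflect]
      _ = ∑ b : Bou M, (Q.exiMarginal b : ℝ) * r b.reflect :=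
          Equiv.sum_comp (Function.Involutive.toPerm _ Bou.reflect_reflect)
            fun b : Bou M => (Q.exiMarginal b : ℝ) * r b.reflect
      _ = _ := by
          rw [Finset.sum_comm]
          simp [Transport.exiMarginal, Finset.sum_mul]
  have h2 : ∑ a : Bou M × Bou M, (Q a.1 a.2 : ℝ) * d a.2 = ∑ b₁, ∑ b₂, (Q b₁ b₂ : ℝ) * d b₂ :=
    Fintype.sum_prod_type _
  rw [h2, Finset.mul_sum]
  simp only [mul_sub, Finset.sum_sub_distrib]
  rw [h1, ← Finset.sum_sub_distrib]
  refine Finset.sum_congr rfl fun b₁ _ => ?_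
  rw [← Finset.sum_sub_distrib, Finset.mul_sum]
  refine Finset.sum_congr rfl fun b₂ _ => ?_
  rw [← mul_sub, h]
  ring

lemma drift_fst_of_balanced {Q : Transport M} (hQ : Q ∈ balanced M) :
    (drift Q).1 = ((M : ℝ) ^ 2)⁻¹ * (M * ∑ a : Bou M × Bou M, (Q a.1 a.2 : ℝ) * (a.2.dir.1 : ℤ)) := by
  rw [drift_fst, sum_balanced hQ (fun b => b.pos.1) fun b => (b.dir.1 : ℤ)]
  rintro ⟨s, j⟩
  cases s <;> simp [Bou.pos, Bou.reflect, Side.opposite, Bou.dir] <;> ring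

lemma drift_snd_of_balanced {Q : Transport M} (hQ : Q ∈ balanced M) :
    (drift Q).2 = ((M : ℝ) ^ 2)⁻¹ * (M * ∑ a : Bou M × Bou M, (Q a.1 a.2 : ℝ) * (a.2.dir.2 : ℤ)) := by
  rw [drift_snd, sum_balanced hQ (fun b => b.pos.2) fun b => (b.dir.2 : ℤ)]
  rintro ⟨s, j⟩
  cases s <;> simp [Bou.pos, Bou.reflect, Side.opposite, Bou.dir] <;> ring

lemma abs_sum_count_sub_le {Q : Transport M} {l : List (Bou M × Bou M)} {s C : ℝ}
    (hl : ∀ a, (l.count a : ℝ) ≤ s * Q a.1 a.2 ∧ s * Q a.1 a.2 ≤ l.count a + C)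
    (d : Bou M × Bou M → ℤ) (hd : ∀ a, |d a| ≤ 1) :
    |∑ a, (l.count a : ℝ) * d a - s * ∑ a, (Q a.1 a.2 : ℝ) * d a| ≤
      Fintype.card (Bou M × Bou M) * C := by
  rw [Finset.mul_sum, ← Finset.sum_sub_distrib]
  refine (Finset.abs_sum_le_sum_abs _ _).trans ?_
  rw [← nsmul_eq_mul, ← Finset.card_univ]
  refine Finset.sum_le_card_nsmul _ _ _ fun a _ => ?_
  rw [← mul_assoc, ← sub_mul, abs_mul]
  obtain ⟨h1, h2⟩ := hl a
  have h3 : |(d a : ℝ)| ≤ 1 := by exact_mod_cast hd a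
  have h4 : |(l.count a : ℝ) - s * Q a.1 a.2| ≤ C := by rw [abs_le]; constructor <;> linarith
  calc _ ≤ |(l.count a : ℝ) - s * Q a.1 a.2| * 1 := by gcongr
    _ ≤ C := by linarith

lemma abs_dir_le (b : Bou M) : |b.dir.1| ≤ 1 ∧ |b.dir.2| ≤ 1 := by
  obtain ⟨s, j⟩ := b
  cases s <;> simp [Bou.dir]

/-- Both terms equal `N / M` times the total exit direction under `Q`, up to the rounding of leg
counts. -/
lemma displacement_near_drift (hM : 0 < M) {Q : Transport M} (hQ : Q ∈ balanced M)
    {l : List (Bou M × Bou M)} {N : ℕ} {C : ℝ}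
    (hl : ∀ a, (l.count a : ℝ) ≤ N / (M : ℝ) ^ 2 * Q a.1 a.2 ∧
      N / (M : ℝ) ^ 2 * Q a.1 a.2 ≤ l.count a + C) :
    |(M : ℝ) * (displacement l).1 - N * (drift Q).1| ≤ M * (Fintype.card (Bou M × Bou M) * C) ∧
    |(M : ℝ) * (displacement l).2 - N * (drift Q).2| ≤ M * (Fintype.card (Bou M × Bou M) * C) := by
  have hM' : (0 : ℝ) < M := by exact_mod_cast hM
  constructor
  · have h := abs_sum_count_sub_le hl (fun a => a.2.dir.1) fun a => (abs_dir_le a.2).1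
    have h1 : (((displacement l).1 : ℤ) : ℝ) = ∑ a, (l.count a : ℝ) * (a.2.dir.1 : ℤ) := by
      rw [displacement_eq, Prod.fst_sum]; simp
    rw [h1, drift_fst_of_balanced hQ]
    calc _ = |(M : ℝ) * (∑ a, (l.count a : ℝ) * (a.2.dir.1 : ℤ) -
            N / (M : ℝ) ^ 2 * ∑ a : Bou M × Bou M, (Q a.1 a.2 : ℝ) * (a.2.dir.1 : ℤ))| := by
          congr 1; ring
      _ ≤ _ := by rw [abs_mul, abs_of_pos hM']; gcongr
  · have h := abs_sum_count_sub_le hl (fun a => a.2.dir.2) fun a => (abs_dir_le a.2).2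
    have h1 : (((displacement l).2 : ℤ) : ℝ) = ∑ a, (l.count a : ℝ) * (a.2.dir.2 : ℤ) := by
      rw [displacement_eq, Prod.snd_sum]; simp
    rw [h1, drift_snd_of_balanced hQ]
    calc _ = |(M : ℝ) * (∑ a, (l.count a : ℝ) * (a.2.dir.2 : ℤ) -
            N / (M : ℝ) ^ 2 * ∑ a : Bou M × Bou M, (Q a.1 a.2 : ℝ) * (a.2.dir.2 : ℤ))| := by
          congr 1; ring
      _ ≤ _ := by rw [abs_mul, abs_of_pos hM']; gcongr

end Drift

/-! ### Where an itinerary ends. -/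

section Endpoint

/-- `u` lies in the `c`-th interval of length `⌊N / n⌋`, and removing the floor moves the interval
by at most `c ≤ n`. -/
lemma abs_sub_mul_le {N n : ℕ} (hn : 0 < n) (hm : 0 < N / n) {u c : ℤ} (hc : 0 ≤ c ∧ c ≤ n)
    (hu : u / ((N / n : ℕ) : ℤ) = c) : |(u : ℝ) - N / n * c| ≤ N / n + n := by
  obtain ⟨m, hm'⟩ : ∃ m, m = N / n := ⟨_, rfl⟩
  rw [← hm'] at hm hu
  have hn' : (0 : ℝ) < n := by exact_mod_cast hn
  have hmz : (0 : ℤ) < (m : ℤ) := Int.natCast_pos.2 hm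
  have hc0 : (0 : ℝ) ≤ c := by exact_mod_cast hc.1
  have hc1 : (c : ℝ) ≤ n := by exact_mod_cast hc.2
  have h3 : (m : ℤ) * c ≤ u := by rw [← hu]; exact Int.mul_ediv_self_le hmz.ne'
  have h4 : u < (m : ℤ) * c + (m : ℤ) := by
    rw [← hu]; exact Int.lt_mul_ediv_self_add hmz
  have h3' : (m : ℝ) * c ≤ u := by exact_mod_cast h3
  have h4' : (u : ℝ) < (m : ℝ) * c + (m : ℝ) := by exact_mod_cast h4
  have h5 : (m : ℝ) ≤ N / n := hm' ▸ Nat.cast_div_le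
  have h6 : (N : ℝ) / n ≤ (m : ℝ) + 1 := by
    rw [div_le_iff₀ hn']
    have h7 := Nat.div_add_mod N n
    rw [← hm'] at h7
    have h8 := Nat.mod_lt N hn
    have h9 : N ≤ (m + 1) * n := by nlinarith
    exact_mod_cast h9
  have h7 : (m : ℝ) * c ≤ N / n * c := mul_le_mul_of_nonneg_right h5 hc0
  have h8 : (N : ℝ) / n * c ≤ ((m : ℝ) + 1) * c := mul_le_mul_of_nonneg_right h6 hc0
  have h10 : (0 : ℝ) ≤ N / n := by positivity
  rw [abs_le]
  constructor <;> linarith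

/-- The number `q` of turns stays bounded as `N` grows, because `d` is close to `N * dr / M` and `N
≤ 2 * M * K`. -/
lemma abs_quotient_le {M K N C dr d q a : ℝ} (hM : 1 ≤ M) (hK : 1 ≤ K) (hN0 : 0 ≤ N)
    (hN : N ≤ M * K + M) (hd : |M * d - N * dr| ≤ C) (ha0 : 0 ≤ a) (ha : a < K)
    (r0 : 0 ≤ a + d - K * q) (r1 : a + d - K * q < K) : |q| ≤ 2 + 2 * |dr| + C := by
  have hC : 0 ≤ C := (abs_nonneg _).trans hd
  have hMK : M ≤ M * K := le_mul_of_one_le_right (by linarith) hK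
  have h3 : M * |d| ≤ C + N * |dr| := by
    have := abs_sub_abs_le_abs_sub (M * d) (N * dr)
    rw [abs_mul, abs_mul, abs_of_nonneg hN0, abs_of_nonneg (by linarith : 0 ≤ M)] at this
    linarith
  have h4 : K * |q| ≤ 2 * K + |d| := by
    have h5 : K * |q| = |K * q| := by rw [abs_mul, abs_of_nonneg (by linarith : 0 ≤ K)]
    rw [h5, abs_le]
    have := neg_abs_le d
    have := le_abs_self d
    constructor <;> linarith
  have s1 : M * (K * |q|) ≤ M * (2 * K + |d|) := mul_le_mul_of_nonneg_left h4 (by linarith)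
  have s2 : N * |dr| ≤ 2 * (M * K) * |dr| :=
    mul_le_mul_of_nonneg_right (by linarith) (abs_nonneg _)
  have s3 : C ≤ M * K * C := le_mul_of_one_le_left hC (by linarith)
  have h6 : M * K * |q| ≤ M * K * (2 + 2 * |dr| + C) := by linarith
  exact le_of_mul_le_mul_left h6 (by linarith)

variable {M N K n : ℕ} [NeZero N] [NeZero K]

/-- In one coordinate: an itinerary whose drift lies in the cell of `w - v` ends close to `w`. -/
lemma cdist_endpoint_le (hK : M * K ≤ N) (hN : N ≤ M * K + M) (hM : 0 < M)
    (hn : 0 < n) (v w : Fin N) (a : Fin K) (ha : (a : ℕ) = v / M) {d k o : ℤ}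
    {dr C : ℝ} (hd : |(M : ℝ) * d - N * dr| ≤ C)
    (hk : (k : ℝ) / n ≤ dr ∧ dr ≤ (k + 1 : ℝ) / n)
    (hu : (((w - v : Fin N) : ℕ) : ℤ) / ((N / n : ℕ) : ℤ) = k % n) (hm : 0 < N / n)
    (ho : -1 ≤ o ∧ o ≤ M - 1) :
    (cdist (red N (M * (((a : ℕ) + d) % K) + o)) w : ℝ) ≤
      2 * N / n + (n + C + 2 * M + M * (2 + 2 * |dr| + C)) := by
  set u : ℤ := (((w - v : Fin N) : ℕ) : ℤ) with hudef
  set q : ℤ := ((a : ℕ) + d) / K with hq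
  set m : ℤ := ((N / n : ℕ) : ℤ) with hmdef
  set c : ℤ := k % n with hc
  have hKpos : (0 : ℤ) < K := by exact_mod_cast Nat.pos_of_ne_zero (NeZero.ne K)
  -- A lift of `w` close to the end point: `k / n` supplies the integer part of the drift and `q`
  -- the turns already removed by reduction modulo `K`.
  have hw : red N ((v : ℕ) + u + N * (k / n) - N * q) = w := by
    have h1 : red N (N * (k / n)) = 0 := by rw [← red_zero, red_eq_iff]; simp
    have h2 : red N (N * q) = 0 := by rw [← red_zero, red_eq_iff]; simp
    rw [red_sub, red_add, red_add, h1, h2, red_coe, hudef, red_coe]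
    simp
  have hmod : ((a : ℕ) + d : ℤ) % K = (a : ℕ) + d - K * q := Int.emod_def _ _
  have hle := cdist_red_le (N := N) (M * (((a : ℕ) + d) % K) + o)
    ((v : ℕ) + u + N * (k / n) - N * q)
  rw [hw] at hle
  have hle' : (cdist (red N (M * (((a : ℕ) + d) % K) + o)) w : ℝ) ≤
      |((M * (((a : ℕ) + d - K * q)) + o - ((v : ℕ) + u + N * (k / n) - N * q) : ℤ) : ℝ)| := by
    rw [hmod] at hle ⊢
    exact_mod_cast hle
  refine hle'.trans ?_
  have hn' : (0 : ℝ) < n := by exact_mod_cast hn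
  have hMr : (1 : ℝ) ≤ M := by exact_mod_cast hM
  have hKr : (1 : ℝ) ≤ K := by exact_mod_cast hKpos
  have hNr : (0 : ℝ) ≤ N := by positivity
  have e1 : |(M : ℝ) * (a : ℕ) - (v : ℕ)| ≤ M := by
    have h1 := Nat.div_add_mod (v : ℕ) M
    have h2 := Nat.mod_lt (v : ℕ) hM
    rw [← ha] at h1
    have h3 : (M : ℝ) * (a : ℕ) + ((v : ℕ) % M : ℕ) = (v : ℕ) := by exact_mod_cast h1
    have h4 : (((v : ℕ) % M : ℕ) : ℝ) < M := by exact_mod_cast h2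
    have h5 : (0 : ℝ) ≤ (((v : ℕ) % M : ℕ) : ℝ) := by positivity
    rw [abs_le]; constructor <;> linarith
  have e2 : |(N : ℝ) * dr - N * (k / n : ℝ)| ≤ N / n := by
    rw [← mul_sub, abs_mul, abs_of_nonneg hNr, show (N : ℝ) / n = N * (n : ℝ)⁻¹ from div_eq_mul_inv _ _]
    refine mul_le_mul_of_nonneg_left ?_ hNr
    have h3 : ((k : ℝ) + 1) / n = k / n + (n : ℝ)⁻¹ := by rw [add_div, one_div]
    have h4 : (0 : ℝ) < (n : ℝ)⁻¹ := by positivity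
    rw [abs_le]; constructor <;> linarith [hk.1, hk.2]
  have hnz : (0 : ℤ) < n := by exact_mod_cast hn
  have hcb := And.intro (Int.emod_nonneg k hnz.ne') (Int.emod_lt_of_pos k hnz)
  have e3 : |(u : ℝ) + N * ((k / n : ℤ) : ℝ) - N * (k / n : ℝ)| ≤ N / n + n := by
    have h1 : (n : ℝ) * ((k / n : ℤ) : ℝ) + c = k := by exact_mod_cast Int.mul_ediv_add_emod k n
    have h2 : (N : ℝ) * (k / n : ℝ) = N * ((k / n : ℤ) : ℝ) + N / n * c := by
      rw [← h1]; field_simp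
    have h3 := abs_sub_mul_le hn hm (by omega : 0 ≤ c ∧ c ≤ n) hu
    rw [h2]
    have h4 : (u : ℝ) + N * ((k / n : ℤ) : ℝ) - (N * ((k / n : ℤ) : ℝ) + N / n * c) =
      u - N / n * c := by ring
    rw [h4]
    exact h3
  have e4 : |((N : ℝ) - M * K) * q| ≤ M * (2 + 2 * |dr| + C) := by
    have h1 : (M : ℝ) * K ≤ N := by exact_mod_cast hK
    have h2 : (N : ℝ) ≤ M * K + M := by exact_mod_cast hN
    have r0 := Int.emod_nonneg ((a : ℕ) + d : ℤ) hKpos.ne'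
    have r1 := Int.emod_lt_of_pos ((a : ℕ) + d : ℤ) hKpos
    rw [hmod] at r0 r1
    have h5 := abs_quotient_le (M := M) (K := K) (N := N) (d := d) (q := q) (a := (a : ℕ)) hMr hKr
      hNr h2 hd (by positivity) (by exact_mod_cast a.isLt) (by exact_mod_cast r0)
      (by exact_mod_cast r1)
    rw [abs_mul, abs_of_nonneg (by linarith)]
    exact mul_le_mul (by linarith) h5 (abs_nonneg _) (by linarith)
  have e5 : |(o : ℝ)| ≤ M := by
    have h1 : (-1 : ℝ) ≤ o := by exact_mod_cast ho.1
    have h2 : (o : ℝ) ≤ M - 1 := by exact_mod_cast ho.2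
    rw [abs_le]; constructor <;> linarith
  -- The errors in order: `v` within its block, rounding of the itinerary, drift within its cell, `w
  -- - v` within its cell, strips crossed, offset of the gate.
  have hsplit : ((M * (((a : ℕ) + d - K * q)) + o - ((v : ℕ) + u + N * (k / n) - N * q) : ℤ) : ℝ) =
      (M * (a : ℕ) - (v : ℕ)) + (M * d - N * dr) + (N * dr - N * (k / n : ℝ))
      - (u + N * ((k / n : ℤ) : ℝ) - N * (k / n : ℝ)) + (N - M * K) * q + o := by
    push_cast
    ring
  rw [hsplit]
  have hdist : (2 : ℝ) * N / n = N / n + N / n := by ring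
  rw [hdist]
  rw [abs_le] at e1 e2 e3 e4 e5 hd ⊢
  constructor <;> linarith

end Endpoint

end
end RoutingFlow

namespace RoutingFlow
noncomputable section

/-! ### Distribution of the demand over the components. -/

section Weights

variable {N n : ℕ}

lemma card_filter_div_eq {m : ℕ} (hm : 0 < m) (hmn : n * m ≤ N) {c : ℤ} (hc : 0 ≤ c ∧ c < n) :
    (Finset.univ.filter fun u : Fin N => (((u : ℕ) : ℤ) / (m : ℤ)) = c).card = m := by
  obtain ⟨c, rfl⟩ := Int.eq_ofNat_of_zero_le hc.1
  have hc' : c < n := by exact_mod_cast hc.2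
  rw [← Finset.card_image_of_injective _ Fin.val_injective]
  have : (Finset.univ.filter fun u : Fin N => (((u : ℕ) : ℤ) / (m : ℤ)) = c).image Fin.val =
      Finset.Ico (c * m) (c * m + m) := by
    ext x
    have key : (((x : ℤ) / (m : ℤ)) = c) ↔ (c * m ≤ x ∧ x < c * m + m) := by
      rw [← Int.natCast_ediv, Nat.cast_inj, Nat.div_eq_iff hm]
      constructor <;> rintro ⟨h1, h2⟩ <;> constructor <;> omega
    simp only [Finset.mem_image, Finset.mem_filter, Finset.mem_univ, true_and, Finset.mem_Ico]
    constructor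
    · rintro ⟨u, hu, rfl⟩
      exact key.1 hu
    · intro hx
      have h1 : (c + 1) * m ≤ n * m := Nat.mul_le_mul_right _ hc'
      have h2 : x < N := by nlinarith [hx.2]
      exact ⟨⟨x, h2⟩, key.2 hx, rfl⟩
  rw [this]
  simp

/-- The cell of the displacement `u`. -/
def cellOf (n : ℕ) (u : TorusVertex N) : ℤ × ℤ :=
  (((u.1 : ℕ) : ℤ) / ((N / n : ℕ) : ℤ), ((u.2 : ℕ) : ℤ) / ((N / n : ℕ) : ℤ))

/-- The share of the flow with displacement `u` which is carried by the component `k`. -/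
def share (n : ℕ) (p : ℤ × ℤ → ℝ≥0) (k : ℤ × ℤ) (u : TorusVertex N) : ℝ≥0∞ :=
  if (k.1 % (n : ℤ), k.2 % (n : ℤ)) = cellOf n u then (n : ℝ≥0∞) ^ 2 * p k else 0

/-- The components that match a cell have total weight at most `n⁻²`, compensated by the factor `n²`
in `share`. -/
lemma sum_share_le_one (hn : 0 < n) {p : ℤ × ℤ → ℝ≥0} {I : Finset (ℤ × ℤ)}
    (hp : ∀ c : ℤ × ℤ, ∑ k ∈ I with (k.1 % (n : ℤ), k.2 % (n : ℤ)) = c, p k ≤ ((n : ℝ≥0) ^ 2)⁻¹)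
    (u : TorusVertex N) : ∑ k ∈ I, share n p k u ≤ 1 := by
  unfold share
  rw [← Finset.sum_filter, ← Finset.mul_sum]
  have h := hp (cellOf n u)
  rw [← ENNReal.coe_le_coe, ENNReal.ofNNReal_finsetSum] at h
  calc _ ≤ (n : ℝ≥0∞) ^ 2 * (((n : ℝ≥0) ^ 2)⁻¹ : ℝ≥0) := by gcongr
    _ = 1 := by
      rw [ENNReal.coe_inv (by positivity)]
      push_cast
      exact ENNReal.mul_inv_cancel (by positivity) (by finiteness)

lemma sum_share (hn : 0 < n) (hnN : n ≤ N) (p : ℤ × ℤ → ℝ≥0) (k : ℤ × ℤ) :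
    ∑ u : TorusVertex N, share n p k u = (((N / n : ℕ) : ℝ≥0∞) * n) ^ 2 * p k := by
  have hnz : (0 : ℤ) < n := by exact_mod_cast hn
  have hm : 0 < N / n := Nat.div_pos hnN hn
  have hmn : n * (N / n) ≤ N := Nat.mul_div_le N n
  have hcard : (Finset.univ.filter fun u : TorusVertex N =>
      (k.1 % (n : ℤ), k.2 % (n : ℤ)) = cellOf n u).card = (N / n) * (N / n) := by
    have h1 : (Finset.univ.filter fun u : TorusVertex N =>
        (k.1 % (n : ℤ), k.2 % (n : ℤ)) = cellOf n u) =
        (Finset.univ.filter fun u : Fin N => (((u : ℕ) : ℤ) / ((N / n : ℕ) : ℤ)) = k.1 % n) ×ˢ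
        (Finset.univ.filter fun u : Fin N => (((u : ℕ) : ℤ) / ((N / n : ℕ) : ℤ)) = k.2 % n) := by
      ext u
      simp [cellOf, Prod.ext_iff, eq_comm]
    rw [h1, Finset.card_product,
      card_filter_div_eq hm hmn ⟨Int.emod_nonneg _ hnz.ne', Int.emod_lt_of_pos _ hnz⟩,
      card_filter_div_eq hm hmn ⟨Int.emod_nonneg _ hnz.ne', Int.emod_lt_of_pos _ hnz⟩]
  unfold share
  rw [← Finset.sum_filter, Finset.sum_const, hcard, nsmul_eq_mul]
  push_cast
  ring

lemma sum_share_le (hn : 0 < n) (hnN : n ≤ N) (p : ℤ × ℤ → ℝ≥0) (k : ℤ × ℤ) :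
    ∑ u : TorusVertex N, share n p k u ≤ (N : ℝ≥0∞) ^ 2 * p k := by
  rw [sum_share hn hnN]
  gcongr
  exact_mod_cast Nat.div_mul_le_self N n

/-- `2 n N` accounts for displacements with a coordinate beyond `n * (N / n)`, and `ε` for the mass
lost in the discretization. -/
lemma sum_one_sub_share_le (hn : 0 < n) (hnN : n ≤ N) {p : ℤ × ℤ → ℝ≥0} {I : Finset (ℤ × ℤ)}
    (hp : ∀ u : TorusVertex N, ∑ k ∈ I, share n p k u ≤ 1) {ε : ℝ≥0∞}
    (hε : 1 ≤ ∑ k ∈ I, (p k : ℝ≥0∞) + ε) :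
    ∑ u : TorusVertex N, (1 - ∑ k ∈ I, share n p k u) ≤ 2 * n * N + ε * (N : ℝ≥0∞) ^ 2 := by
  have hsum : ∑ u : TorusVertex N, ∑ k ∈ I, share n p k u =
      (((N / n : ℕ) : ℝ≥0∞) * n) ^ 2 * ∑ k ∈ I, (p k : ℝ≥0∞) := by
    rw [Finset.sum_comm, Finset.mul_sum]
    exact Finset.sum_congr rfl fun k _ => sum_share hn hnN p k
  have hfin : ∑ u : TorusVertex N, ∑ k ∈ I, share n p k u ≠ ∞ :=
    (ENNReal.sum_lt_top.2 fun u _ => (hp u).trans_lt ENNReal.one_lt_top).ne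
  have hadd : ∑ u : TorusVertex N, (1 - ∑ k ∈ I, share n p k u) +
      ∑ u : TorusVertex N, ∑ k ∈ I, share n p k u = (N : ℝ≥0∞) ^ 2 := by
    rw [← Finset.sum_add_distrib, ← card_torusVertex, ← Finset.card_univ, Finset.card_eq_sum_ones,
      Nat.cast_sum]
    exact Finset.sum_congr rfl fun u _ => by rw [tsub_add_cancel_of_le (hp u)]; simp
  rw [← ENNReal.add_le_add_iff_right hfin, hadd]
  have h1 : (N : ℝ≥0∞) ^ 2 ≤ 2 * n * N + (((N / n : ℕ) : ℝ≥0∞) * n) ^ 2 := by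
    have h2 := Nat.div_add_mod N n
    have h3 := Nat.mod_lt N hn
    have h4 : N ^ 2 ≤ 2 * n * N + (N / n * n) ^ 2 := by
      set m := N / n * n with hm
      have h5 : m ≤ N := Nat.div_mul_le_self N n
      have h6 : N ≤ m + n := by rw [hm, mul_comm]; omega
      nlinarith
    exact_mod_cast h4
  have h7 : (((N / n : ℕ) : ℝ≥0∞) * n) ^ 2 ≤ (N : ℝ≥0∞) ^ 2 := by
    gcongr
    exact_mod_cast Nat.div_mul_le_self N n
  calc (N : ℝ≥0∞) ^ 2 ≤ 2 * n * N + (((N / n : ℕ) : ℝ≥0∞) * n) ^ 2 * 1 := by rwa [mul_one]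
    _ ≤ 2 * n * N + (((N / n : ℕ) : ℝ≥0∞) * n) ^ 2 * (∑ k ∈ I, (p k : ℝ≥0∞) + ε) := by gcongr
    _ = 2 * n * N + ε * (((N / n : ℕ) : ℝ≥0∞) * n) ^ 2 + ∑ u : TorusVertex N, ∑ k ∈ I, share n p k u := by
        rw [hsum]; ring
    _ ≤ _ := by gcongr

end Weights

/-! ### Vertices outside the blocks. -/

section Uncovered

variable {M N K : ℕ}

/-- The vertices which lie in one of the blocks. -/
def covered (M K : ℕ) {N : ℕ} (v : TorusVertex N) : Prop :=
  (v.1 : ℕ) < M * K ∧ (v.2 : ℕ) < M * K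

lemma card_not_lt_le {L : ℕ} :
    (Finset.univ.filter fun i : Fin N => ¬ (i : ℕ) < L).card ≤ N - L := by
  rw [← Finset.card_image_of_injective _ Fin.val_injective, ← Nat.card_Ico]
  refine Finset.card_le_card fun x hx => ?_
  simp only [Finset.mem_image, Finset.mem_filter, Finset.mem_univ, true_and] at hx
  obtain ⟨u, hu, rfl⟩ := hx
  exact Finset.mem_Ico.2 ⟨by omega, u.isLt⟩

open Classical in
lemma sum_not_covered_le (hN : N ≤ M * K + M) :
    ∑ v : TorusVertex N, (if covered M K v then 0 else 1 : ℝ≥0∞) ≤ 2 * M * N := by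
  have h1 : ∀ v : TorusVertex N, (if covered M K v then 0 else 1 : ℝ≥0∞) ≤
      (if ¬ (v.1 : ℕ) < M * K then 1 else 0) + (if ¬ (v.2 : ℕ) < M * K then 1 else 0) := by
    intro v
    unfold covered
    by_cases h1 : (v.1 : ℕ) < M * K <;> by_cases h2 : (v.2 : ℕ) < M * K <;> simp [h1, h2]
  have h2 : (Finset.univ.filter fun i : Fin N => ¬ (i : ℕ) < M * K).card ≤ M :=
    card_not_lt_le.trans (by omega)
  have h3 : ∑ i : Fin N, (if ¬ (i : ℕ) < M * K then 1 else 0 : ℝ≥0∞) ≤ M := by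
    rw [Finset.sum_ite, Finset.sum_const_zero, add_zero, Finset.sum_const, nsmul_eq_mul, mul_one]
    exact_mod_cast h2
  refine (Finset.sum_le_sum fun v _ => h1 v).trans ?_
  rw [Finset.sum_add_distrib, Fintype.sum_prod_type, Fintype.sum_prod_type_right]
  have h4 : ∑ i : Fin N, ∑ _j : Fin N, (if ¬ (i : ℕ) < M * K then 1 else 0 : ℝ≥0∞) ≤ N * M := by
    rw [Finset.sum_comm, Finset.sum_const, Finset.card_univ, Fintype.card_fin, nsmul_eq_mul]
    gcongr
  calc _ ≤ (N : ℝ≥0∞) * M + N * M := add_le_add h4 h4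
    _ = _ := by ring

end Uncovered

/-! ### Vertices inside the blocks. -/

section Covered

variable {M N K : ℕ} [NeZero K]

/-- The block of a covered vertex. -/
def homeBlock (M K : ℕ) [NeZero K] {N : ℕ} (v : TorusVertex N) : Fin K × Fin K :=
  pt K (((v.1 : ℕ) / M : ℕ), ((v.2 : ℕ) / M : ℕ))

lemma homeBlock_val {v : TorusVertex N} (hv : covered M K v) :
    ((homeBlock M K v).1 : ℕ) = (v.1 : ℕ) / M ∧ ((homeBlock M K v).2 : ℕ) = (v.2 : ℕ) / M := by
  have key : ∀ x : ℕ, x < M * K → (red K ((x / M : ℕ) : ℤ) : ℕ) = x / M := by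
    intro x hx
    have h1 : x / M < K := Nat.div_lt_of_lt_mul hx
    have h2 : ((red K ((x / M : ℕ) : ℤ) : ℕ) : ℤ) = ((x / M : ℕ) : ℤ) := by
      rw [red_val]
      exact Int.emod_eq_of_lt (by positivity) (by exact_mod_cast h1)
    exact_mod_cast h2
  exact ⟨key _ hv.1, key _ hv.2⟩

-- Covered vertices with the same home block are told apart by their residues modulo `M`, so there
-- are at most `M²` of them.
open Classical in
lemma sum_homeBlock_le (hM : 0 < M) (G : Fin K × Fin K → ℝ≥0∞) :
    ∑ v : TorusVertex N, (if covered M K v then G (homeBlock M K v) else 0) ≤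
      (M : ℝ≥0∞) ^ 2 * ∑ β, G β := by
  rw [← Finset.sum_filter, ← Finset.sum_fiberwise _ (fun v : TorusVertex N => homeBlock M K v),
    Finset.mul_sum]
  gcongr with β _
  calc _ ≤ ∑ v ∈ (Finset.univ.filter fun v : TorusVertex N => covered M K v) with
        homeBlock M K v = β, G β := by
        refine Finset.sum_le_sum fun v hv => ?_
        rw [(Finset.mem_filter.1 hv).2]
    _ ≤ _ := by
      rw [Finset.sum_const, nsmul_eq_mul]
      gcongr
      have : ((Finset.univ.filter fun v : TorusVertex N => covered M K v).filter fun v =>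
          homeBlock M K v = β).card ≤ (Finset.range M ×ˢ Finset.range M).card := by
        refine Finset.card_le_card_of_injOn (fun v => ((v.1 : ℕ) % M, (v.2 : ℕ) % M)) ?_ ?_
        · intro v _
          simp [Nat.mod_lt _ hM]
        · intro v hv w hw h
          simp only [Finset.coe_filter, Finset.mem_filter, Finset.mem_univ, true_and,
            Set.mem_ofPred_eq] at hv hw
          obtain ⟨a1, a2⟩ := homeBlock_val hv.1
          obtain ⟨b1, b2⟩ := homeBlock_val hw.1
          rw [hv.2] at a1 a2
          rw [hw.2] at b1 b2
          simp only [Prod.mk.injEq] at h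
          have c1 := Nat.div_add_mod (v.1 : ℕ) M
          have c2 := Nat.div_add_mod (v.2 : ℕ) M
          have d1 := Nat.div_add_mod (w.1 : ℕ) M
          have d2 := Nat.div_add_mod (w.2 : ℕ) M
          rw [← a1, b1, h.1, d1] at c1
          rw [← a2, b2, h.2, d2] at c2
          exact Prod.ext (Fin.ext c1.symm) (Fin.ext c2.symm)
      rw [Finset.card_product, Finset.card_range, ← sq] at this
      exact_mod_cast this

end Covered

/-! ### Splitting the global flow into block part and direct connections. -/

section Parts

variable {M N K : ℕ} [NeZero N] [NeZero K]

/-- The direct connections used on a trip from `v` to `w` by the itinerary `l`, other than those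
between blocks. -/
def tripExtra (y : Bou M) (l : List (Bou M × Bou M)) (K : ℕ) [NeZero K] (v w : TorusVertex N) :
    TorusEdge N → ℝ≥0∞ :=
  shortest v (gate N (homeBlock M K v) y) + mismatchFlow N (homeBlock M K v) y l +
    shortest (gate N (homeBlock M K v + pt K (displacement l)) (lastEntrance y l)) w

lemma unitFlow_trip {g : Fin K × Fin K → Bou M → Bou M → TorusEdge N → ℝ≥0∞}
    (hg : ∀ α b₁ b₂, UnitFlow (torus N) (gate N α b₁) (gate N α b₂) (g α b₁ b₂))
    (y : Bou M) (l : List (Bou M × Bou M)) (v w : TorusVertex N) :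
    UnitFlow (torus N) v w fun e => traceSum (fun α x b => g α x b e) (homeBlock M K v) l
      + traceSum (fun α _ b => wrapFlow N α b e) (homeBlock M K v) l + tripExtra y l K v w e := by
  have h1 := unitFlow_shortest v (gate N (homeBlock M K v) y)
  have h2 := (h1.trans (unitFlow_travel hg l (homeBlock M K v) y)).trans (unitFlow_shortest _ w)
  refine (congrArg (UnitFlow (torus N) _ _) ?_).mp h2
  ext e
  simp only [tripExtra, Pi.add_apply]
  ring

variable {I : Finset (ℤ × ℤ)} {W : ℤ × ℤ → TorusVertex N → ℝ≥0∞}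
  {l : ℤ × ℤ → List (Bou M × Bou M)}

open Classical in
/-- The part of the global flow which runs inside the blocks. -/
def mainPart (I : Finset (ℤ × ℤ)) (W : ℤ × ℤ → TorusVertex N → ℝ≥0∞)
    (l : ℤ × ℤ → List (Bou M × Bou M)) (g : Fin K × Fin K → Bou M → Bou M → TorusEdge N → ℝ≥0∞)
    (e : TorusEdge N) : ℝ≥0∞ :=
  ∑ v, ∑ w, ((N : ℝ≥0∞) ^ 3)⁻¹ * if covered M K v then
    ∑ k ∈ I, W k (w - v) * traceSum (fun α x b => g α x b e) (homeBlock M K v) (l k) else 0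

open Classical in
/-- The part of the global flow which consists of direct connections. -/
def restPart (K : ℕ) [NeZero K] (I : Finset (ℤ × ℤ)) (W : ℤ × ℤ → TorusVertex N → ℝ≥0∞)
    (l : ℤ × ℤ → List (Bou M × Bou M)) (y : Bou M) (e : TorusEdge N) : ℝ≥0∞ :=
  ∑ v, ∑ w, ((N : ℝ≥0∞) ^ 3)⁻¹ * if covered M K v then
    ∑ k ∈ I, W k (w - v) * tripExtra y (l k) K v w e +
      (1 - ∑ k ∈ I, W k (w - v)) * shortest v w e else shortest v w e

lemma stdFlow_parts (hW : ∀ u, ∑ k ∈ I, W k u ≤ 1) (y : Bou M)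
    {g : Fin K × Fin K → Bou M → Bou M → TorusEdge N → ℝ≥0∞}
    (hg : ∀ α b₁ b₂, UnitFlow (torus N) (gate N α b₁) (gate N α b₂) (g α b₁ b₂)) :
    StdFlow N fun e => mainPart I W l g e +
      (mainPart (K := K) I W l (fun α _ b => wrapFlow N α b) e + restPart K I W l y e) := by
  classical
  refine ⟨fun v w e => if covered M K v then
    ∑ k ∈ I, W k (w - v) * (traceSum (fun α x b => g α x b e) (homeBlock M K v) (l k)
      + traceSum (fun α _ b => wrapFlow N α b e) (homeBlock M K v) (l k)
      + tripExtra y (l k) K v w e) + (1 - ∑ k ∈ I, W k (w - v)) * shortest v w e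
    else shortest v w e, fun v w => ?_, ?_⟩
  · by_cases hv : covered M K v
    · simp only [hv, if_true]
      -- `none` is the direct route, which takes the share not claimed by any component.
      have := UnitFlow.sum (G := torus N) (v := v) (w := w) (J := Option I)
        (m := fun j => j.elim (1 - ∑ k ∈ I, W k (w - v)) fun k => W k (w - v))
        (f := fun j => j.elim (shortest v w) fun k e =>
          traceSum (fun α x b => g α x b e) (homeBlock M K v) (l k)
          + traceSum (fun α _ b => wrapFlow N α b e) (homeBlock M K v) (l k)
          + tripExtra y (l k) K v w e) ?_ ?_
      · refine (congrArg (UnitFlow (torus N) _ _) ?_).mp this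
        ext e
        rw [Fintype.sum_option, add_comm]
        simp only [Option.elim]
        congr 1
        exact Finset.sum_coe_sort I fun k => W k (w - v) *
          (traceSum (fun α x b => g α x b e) (homeBlock M K v) (l k)
          + traceSum (fun α _ b => wrapFlow N α b e) (homeBlock M K v) (l k)
          + tripExtra y (l k) K v w e)
      · rw [Fintype.sum_option]
        simp only [Option.elim]
        rw [Finset.sum_coe_sort I fun k => W k (w - v)]
        exact tsub_add_cancel_of_le (hW _)
      · rintro (_ | k)
        · exact unitFlow_shortest v w
        · exact unitFlow_trip hg y (l k) v w
    · simp only [hv, if_false]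
      exact unitFlow_shortest v w
  · ext e
    unfold mainPart restPart
    rw [← Finset.sum_add_distrib, ← Finset.sum_add_distrib]
    refine Finset.sum_congr rfl fun v _ => ?_
    rw [← Finset.sum_add_distrib, ← Finset.sum_add_distrib]
    refine Finset.sum_congr rfl fun w _ => ?_
    by_cases hv : covered M K v
    · simp only [hv, if_true, mul_add, Finset.sum_add_distrib]
      ring
    · simp only [hv, if_false]
      ring

/-- Demand `N⁻³` per pair, displacements of total share `N² p k`, at most `M²` sources per block and
at most `N Q k / M²` legs of each kind: the powers cancel, and each block is charged at most `∑ p k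
* Q k ≤ Q₀`. With `wrapFlow` for `g` it also bounds the connections across the strip. -/
lemma mainPart_le (hM : 0 < M) {p : ℤ × ℤ → ℝ≥0} (hW : ∀ k ∈ I, ∑ u, W k u ≤ (N : ℝ≥0∞) ^ 2 * p k)
    {Q : ℤ × ℤ → Transport M} {Q₀ : Transport M}
    (hl : ∀ k ∈ I, ∀ a : Bou M × Bou M,
      (M : ℝ≥0∞) ^ 2 * ((l k).count a : ℝ≥0∞) ≤ N * Q k a.1 a.2)
    (hQ : ∀ b₁ b₂, ∑ k ∈ I, p k * Q k b₁ b₂ ≤ Q₀ b₁ b₂)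
    (g : Fin K × Fin K → Bou M → Bou M → TorusEdge N → ℝ≥0∞) (e : TorusEdge N) :
    mainPart I W l g e ≤ ∑ a : Bou M × Bou M, (Q₀ a.1 a.2 : ℝ≥0∞) * ∑ α, g α a.1 a.2 e := by
  classical
  let φ : Fin K × Fin K → Bou M → Bou M → ℝ≥0∞ := fun α x b => g α x b e
  have hN0 : (N : ℝ≥0∞) ≠ 0 := by simp [NeZero.ne N]
  have h1 : mainPart I W l g e = ((N : ℝ≥0∞) ^ 3)⁻¹ * ∑ k ∈ I, (∑ u, W k u) *
      ∑ v : TorusVertex N, if covered M K v then traceSum φ (homeBlock M K v) (l k) else 0 := by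
    unfold mainPart
    simp only [← Finset.mul_sum]
    congr 1
    have : ∀ v : TorusVertex N, (∑ w, if covered M K v then
        ∑ k ∈ I, W k (w - v) * traceSum φ (homeBlock M K v) (l k) else 0) =
        ∑ k ∈ I, (∑ u, W k u) * if covered M K v then traceSum φ (homeBlock M K v) (l k) else 0 := by
      intro v
      by_cases hv : covered M K v
      · simp only [hv, if_true]
        rw [Finset.sum_comm]
        refine Finset.sum_congr rfl fun k _ => ?_
        rw [← Finset.sum_mul]
        congr 1
        exact Equiv.sum_comp (Equiv.subRight v) fun u => W k u
      · simp [hv]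
    rw [Finset.sum_congr rfl fun v _ => this v, Finset.sum_comm]
    exact Finset.sum_congr rfl fun k _ => (Finset.mul_sum _ _ _).symm
  rw [h1]
  calc ((N : ℝ≥0∞) ^ 3)⁻¹ * ∑ k ∈ I, (∑ u, W k u) *
        ∑ v : TorusVertex N, (if covered M K v then traceSum φ (homeBlock M K v) (l k) else 0)
      ≤ ((N : ℝ≥0∞) ^ 3)⁻¹ * ∑ k ∈ I, ((N : ℝ≥0∞) ^ 2 * p k) *
        ((M : ℝ≥0∞) ^ 2 * ∑ β, traceSum φ β (l k)) := by
        gcongr with k hk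
        · exact hW k hk
        · exact sum_homeBlock_le hM fun β => traceSum φ β (l k)
    _ = ((N : ℝ≥0∞) ^ 3)⁻¹ * ∑ k ∈ I, ∑ a : Bou M × Bou M, ((N : ℝ≥0∞) ^ 2 * p k) *
        (((M : ℝ≥0∞) ^ 2 * ((l k).count a : ℝ≥0∞)) * ∑ α, φ α a.1 a.2) := by
        congr 1
        refine Finset.sum_congr rfl fun k _ => ?_
        rw [sum_traceSum, Finset.mul_sum, Finset.mul_sum]
        exact Finset.sum_congr rfl fun a _ => by ring
    _ ≤ ((N : ℝ≥0∞) ^ 3)⁻¹ * ∑ k ∈ I, ∑ a : Bou M × Bou M, ((N : ℝ≥0∞) ^ 2 * p k) *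
        ((N * Q k a.1 a.2) * ∑ α, φ α a.1 a.2) := by
        refine mul_le_mul' le_rfl (Finset.sum_le_sum fun k hk => Finset.sum_le_sum fun a _ => ?_)
        exact mul_le_mul' le_rfl (mul_le_mul' (hl k hk a) le_rfl)
    _ = ((N : ℝ≥0∞) ^ 3)⁻¹ * ((N : ℝ≥0∞) ^ 3 * ∑ a : Bou M × Bou M,
        ((∑ k ∈ I, p k * Q k a.1 a.2 : ℝ≥0) : ℝ≥0∞) * ∑ α, φ α a.1 a.2) := by
        congr 1
        rw [Finset.sum_comm, Finset.mul_sum]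
        refine Finset.sum_congr rfl fun a _ => ?_
        rw [ENNReal.ofNNReal_finsetSum, Finset.sum_mul, Finset.mul_sum]
        refine Finset.sum_congr rfl fun k _ => ?_
        rw [ENNReal.coe_mul]
        ring
    _ = ∑ a : Bou M × Bou M,
        ((∑ k ∈ I, p k * Q k a.1 a.2 : ℝ≥0) : ℝ≥0∞) * ∑ α, φ α a.1 a.2 := by
        rw [← mul_assoc, ENNReal.inv_mul_cancel (by simp [hN0]) (by finiteness), one_mul]
    _ ≤ _ := by
        gcongr with a _
        exact_mod_cast hQ a.1 a.2

/-- The total demand is `N⁴ * N⁻³ = N`, paying at most `A` per unit. Unclaimed displacements and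
uncovered sources go directly, over at most `N` edges. -/
lemma vol_restPart_le (hN : N ≤ M * K + M) (hW : ∀ u, ∑ k ∈ I, W k u ≤ 1) (y : Bou M) {A δ : ℝ≥0∞}
    (hA : ∀ k ∈ I, ∀ v w, covered M K v → W k (w - v) ≠ 0 → vol (tripExtra y (l k) K v w) ≤ A)
    (hδ : ∑ u, (1 - ∑ k ∈ I, W k u) ≤ δ) :
    vol (restPart K I W l y) ≤ N * A + δ + 2 * M * N := by
  classical
  have hN0 : (N : ℝ≥0∞) ≠ 0 := by simp [NeZero.ne N]
  have hcard : ∑ _v : TorusVertex N, (1 : ℝ≥0∞) = (N : ℝ≥0∞) ^ 2 := by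
    rw [Finset.sum_const, nsmul_eq_mul, Finset.card_univ, card_torusVertex, mul_one]
  have hshort : ∀ v w : TorusVertex N, vol (shortest v w) ≤ N := fun v w =>
    (vol_shortest_le v w).trans (by exact_mod_cast tdist_le v w)
  have h1 : vol (restPart K I W l y) = ((N : ℝ≥0∞) ^ 3)⁻¹ * ∑ v, ∑ w, if covered M K v then
      ∑ k ∈ I, W k (w - v) * vol (tripExtra y (l k) K v w) +
        (1 - ∑ k ∈ I, W k (w - v)) * vol (shortest v w) else vol (shortest v w) := by
    unfold restPart
    rw [vol, Finset.sum_comm, Finset.mul_sum]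
    refine Finset.sum_congr rfl fun v _ => ?_
    rw [Finset.sum_comm, Finset.mul_sum]
    refine Finset.sum_congr rfl fun w _ => ?_
    rw [← Finset.mul_sum]
    congr 1
    by_cases hv : covered M K v
    · simp only [hv, if_true, Finset.sum_add_distrib, vol, Finset.mul_sum]
      rw [Finset.sum_comm]
    · simp only [hv, if_false, vol]
  have h2 : ∀ v w : TorusVertex N, (if covered M K v then
      ∑ k ∈ I, W k (w - v) * vol (tripExtra y (l k) K v w) +
        (1 - ∑ k ∈ I, W k (w - v)) * vol (shortest v w) else vol (shortest v w)) ≤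
      A + (1 - ∑ k ∈ I, W k (w - v)) * N + (if covered M K v then 0 else 1) * N := by
    intro v w
    by_cases hv : covered M K v
    · simp only [hv, if_true, zero_mul, add_zero]
      gcongr
      · calc ∑ k ∈ I, W k (w - v) * vol (tripExtra y (l k) K v w) ≤ ∑ k ∈ I, W k (w - v) * A := by
              refine Finset.sum_le_sum fun k hk => ?_
              by_cases h0 : W k (w - v) = 0
              · simp [h0]
              · gcongr
                exact hA k hk v w hv h0
          _ ≤ A := by
              rw [← Finset.sum_mul]
              exact mul_le_of_le_one_left' (hW _)
      · exact hshort v w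
    · simp only [hv, if_false, one_mul]
      exact (hshort v w).trans le_add_self
  rw [h1]
  calc _ ≤ ((N : ℝ≥0∞) ^ 3)⁻¹ * ∑ v : TorusVertex N, ∑ w : TorusVertex N,
        (A + (1 - ∑ k ∈ I, W k (w - v)) * N + (if covered M K v then 0 else 1) * N) := by
        gcongr with v _ w _
        exact h2 v w
    _ = ((N : ℝ≥0∞) ^ 3)⁻¹ * ((N : ℝ≥0∞) ^ 3 * (N * A + ∑ u, (1 - ∑ k ∈ I, W k u) +
        ∑ v : TorusVertex N, (if covered M K v then 0 else 1))) := by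
        congr 1
        have h3 : ∀ v : TorusVertex N, ∑ w : TorusVertex N, (1 - ∑ k ∈ I, W k (w - v)) =
            ∑ u, (1 - ∑ k ∈ I, W k u) := fun v =>
          Equiv.sum_comp (Equiv.subRight v) fun u => 1 - ∑ k ∈ I, W k u
        have h4 : ∀ x : ℝ≥0∞, ∑ _v : TorusVertex N, x = (N : ℝ≥0∞) ^ 2 * x := by
          intro x
          rw [← hcard, Finset.sum_mul]
          simp
        simp only [Finset.sum_add_distrib, ← Finset.sum_mul, h3, h4, ← Finset.mul_sum]
        ring
    _ = N * A + ∑ u, (1 - ∑ k ∈ I, W k u) +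
        ∑ v : TorusVertex N, (if covered M K v then 0 else 1) := by
        rw [← mul_assoc, ENNReal.inv_mul_cancel (by simp [hN0]) (by finiteness), one_mul]
    _ ≤ _ := by
        gcongr
        exact sum_not_covered_le hN

end Parts

end
end RoutingFlow

namespace RoutingFlow
noncomputable section

/-! ### Global flow for prescribed flows in the blocks. -/

section GlobalFlow

variable {M N K : ℕ} [NeZero N] [NeZero K]

lemma tdist_home_le (hM : 0 < M) {v : TorusVertex N} (hv : covered M K v) (y : Bou M) :
    tdist v (gate N (homeBlock M K v) y) ≤ 2 * M := by
  obtain ⟨h1, h2⟩ := homeBlock_val hv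
  have hpt : v = pt N ((v.1 : ℕ), (v.2 : ℕ)) := by simp [pt, red_coe]
  have h := tdist_pt_le (N := N) ((v.1 : ℕ), (v.2 : ℕ))
    (M * (blockIdx (homeBlock M K v)).1 + y.offset.1, M * (blockIdx (homeBlock M K v)).2 + y.offset.2)
  rw [← hpt] at h
  have ho := y.offset_mem
  have key : ∀ x a : ℕ, ∀ o : ℤ, a = x / M → -1 ≤ o → o ≤ M - 1 →
      |(x : ℤ) - (M * (a : ℤ) + o)| ≤ M := by
    intro x a o ha ho1 ho2
    have e1 := Nat.div_add_mod x M
    have e2 := Nat.mod_lt x hM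
    rw [← ha] at e1
    have e3 : (M : ℤ) * a + ((x % M : ℕ) : ℤ) = x := by exact_mod_cast e1
    rw [abs_le]
    constructor <;> omega
  have k1 := key _ _ _ h1 ho.1.1 ho.1.2
  have k2 := key _ _ _ h2 ho.2.1 ho.2.2
  unfold gate blockPt
  simp only [blockIdx] at h ⊢
  omega

/-- The remainder `h` is chosen before `g`: it is the same for all environments and all translates,
as averaging it over translations requires. -/
lemma exists_global_flow {M : ℕ} (hM : 0 < M) {Q₀ : Transport M} (hQ₀ : Q₀ ∈ isotropic M)
    {η : ℝ≥0} (hη : 0 < η) :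
    ∃ N₀ : ℕ, ∀ (N K : ℕ) [NeZero N] [NeZero K], N₀ ≤ N → M * K ≤ N → N ≤ M * K + M →
      ∃ h : TorusEdge N → ℝ≥0∞, vol h ≤ η * (N : ℝ≥0∞) ^ 2 ∧
        ∀ g : Fin K × Fin K → Bou M → Bou M → TorusEdge N → ℝ≥0∞,
          (∀ α b₁ b₂, UnitFlow (torus N) (gate N α b₁) (gate N α b₂) (g α b₁ b₂)) →
          ∃ m : TorusEdge N → ℝ≥0∞, StdFlow N (fun e => m e + h e) ∧
            ∀ e, m e ≤ ∑ a : Bou M × Bou M, (Q₀ a.1 a.2 : ℝ≥0∞) * ∑ α, g α a.1 a.2 e := by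
  classical
  -- One third each for inexact end points, for mass lost in the discretization, and for everything
  -- of order `N`.
  obtain ⟨t, ht0, ht⟩ : ∃ t : ℝ≥0, 0 < t ∧ 3 * t = η :=
    ⟨η / 3, by positivity, by rw [mul_div_cancel₀ η (by norm_num)]⟩
  -- The end point misses by `2 * N / n` in each of two coordinates, up to a bounded error.
  obtain ⟨n, hn⟩ := exists_nat_gt (4 / (t : ℝ))
  have hn0 : 0 < n := by
    have : (0 : ℝ) < n := lt_trans (by positivity) hn
    exact_mod_cast this
  have hnt : 4 / (n : ℝ) ≤ t := by
    have hn0' : (0 : ℝ) < n := by exact_mod_cast hn0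
    have ht0' : (0 : ℝ) < t := by exact_mod_cast ht0
    rw [div_lt_iff₀ ht0'] at hn
    rw [div_le_iff₀ hn0']
    linarith
  obtain ⟨I, p, Q, hbal, hmix, hcell, htot, hdrift⟩ :=
    exists_discretization hQ₀ hn0 (ε := t) (by exact_mod_cast ht0)
  choose! C hC using fun k (hk : k ∈ I) => exists_itinerary (hbal k hk)
  let C' : ℤ × ℤ → ℝ := fun k => M * (Fintype.card (Bou M × Bou M) * C k)
  -- The parts of the extra trip length that do not grow with `N`.
  let G : ℤ × ℤ → ℝ := fun k =>
    (n + C' k + 2 * M + M * (2 + 2 * |(drift (Q k)).1| + C' k)) +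
    (n + C' k + 2 * M + M * (2 + 2 * |(drift (Q k)).2| + C' k)) + 2 * M + C k * (2 * M)
  have hC'0 : ∀ k, 0 ≤ C' k := fun k => by positivity
  have hG0 : ∀ k, 0 ≤ G k := fun k => by
    have := hC'0 k
    positivity
  obtain ⟨D, hD⟩ := exists_nat_ge (∑ k ∈ I, G k)
  have hGD : ∀ k ∈ I, G k ≤ D := fun k hk =>
    (Finset.single_le_sum (fun k _ => hG0 k) hk).trans hD
  obtain ⟨S, hS⟩ := exists_nat_ge (∑ a : Bou M × Bou M, Q₀ a.1 a.2)
  obtain ⟨N₁, hN₁⟩ := exists_nat_ge (((S + D + 2 * n + 2 * M : ℕ) : ℝ≥0) / t)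
  refine ⟨max n N₁, fun N K _ _ hN hK hKN => ?_⟩
  have hnN : n ≤ N := (le_max_left _ _).trans hN
  have hNt : ((S + D + 2 * n + 2 * M : ℕ) : ℝ≥0) ≤ t * N := by
    rw [div_le_iff₀ ht0] at hN₁
    refine hN₁.trans ?_
    rw [mul_comm]
    gcongr
    exact (le_max_right _ _).trans hN
  choose! l hmis hcount using fun k (hk : k ∈ I) => hC k hk ((N : ℝ) / (M : ℝ) ^ 2) (by positivity)
  let y : Bou M := (.left, ⟨0, hM⟩)
  let W : ℤ × ℤ → TorusVertex N → ℝ≥0∞ := share n p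
  have hW1 : ∀ u, ∑ k ∈ I, W k u ≤ 1 := sum_share_le_one hn0 hcell
  have hW2 : ∀ k ∈ I, ∑ u, W k u ≤ (N : ℝ≥0∞) ^ 2 * p k := fun k _ => sum_share_le hn0 hnN p k
  have hW3 := sum_one_sub_share_le hn0 hnN hW1 htot
  have hM' : (0 : ℝ) < M := by exact_mod_cast hM
  have hl : ∀ k ∈ I, ∀ a : Bou M × Bou M,
      (M : ℝ≥0∞) ^ 2 * ((l k).count a : ℝ≥0∞) ≤ N * Q k a.1 a.2 := by
    intro k hk a
    have h1 := (hcount k hk a).1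
    have h2 : (M : ℝ) ^ 2 * (l k).count a ≤ N * Q k a.1 a.2 := by
      calc (M : ℝ) ^ 2 * (l k).count a ≤ (M : ℝ) ^ 2 * (N / (M : ℝ) ^ 2 * Q k a.1 a.2) := by gcongr
        _ = _ := by field_simp
    have h3 : (M : ℝ≥0) ^ 2 * ((l k).count a : ℝ≥0) ≤ N * Q k a.1 a.2 := by exact_mod_cast h2
    exact_mod_cast h3
  have hA : ∀ k ∈ I, ∀ v w, covered M K v → W k (w - v) ≠ 0 →
      vol (tripExtra y (l k) K v w) ≤ t * N + D := by
    intro k hk v w hv hne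
    have hcellk : (k.1 % (n : ℤ), k.2 % (n : ℤ)) = cellOf n (w - v) := by
      by_contra hcon
      exact hne (if_neg hcon)
    simp only [cellOf, Prod.mk.injEq] at hcellk
    obtain ⟨hd1, hd2⟩ := displacement_near_drift hM (hbal k hk) (hcount k hk)
    have hm : 0 < N / n := Nat.div_pos hnN hn0
    have hh := homeBlock_val hv
    have e1 := cdist_endpoint_le hK hKN hM hn0 v.1 w.1 _ hh.1 hd1 (hdrift k hk).1
      hcellk.1.symm hm (Bou.offset_mem (lastEntrance y (l k))).1
    have e2 := cdist_endpoint_le hK hKN hM hn0 v.2 w.2 _ hh.2 hd2 (hdrift k hk).2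
      hcellk.2.symm hm (Bou.offset_mem (lastEntrance y (l k))).2
    have e3 : (tdist (gate N (homeBlock M K v + pt K (displacement (l k)))
        (lastEntrance y (l k))) w : ℝ) ≤ 2 * N / n + (n + C' k + 2 * M + M * (2 + 2 * |(drift (Q k)).1| + C' k))
          + (2 * N / n + (n + C' k + 2 * M + M * (2 + 2 * |(drift (Q k)).2| + C' k))) := by
      have : (tdist (gate N (homeBlock M K v + pt K (displacement (l k)))
          (lastEntrance y (l k))) w : ℝ) =
          (cdist (red N (M * ((((homeBlock M K v).1 : ℕ) + (displacement (l k)).1) % K) +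
            (lastEntrance y (l k)).offset.1)) w.1 : ℝ) +
          (cdist (red N (M * ((((homeBlock M K v).2 : ℕ) + (displacement (l k)).2) % K) +
            (lastEntrance y (l k)).offset.2)) w.2 : ℝ) := by
        rw [tdist, gate, blockPt, blockIdx_add]
        push_cast
        rfl
      rw [this]
      exact add_le_add e1 e2
    have e4 := tdist_home_le hM hv y
    have e5 := hmis k hk y
    have hfinal : ((2 * M + C k * (2 * M) + tdist (gate N (homeBlock M K v + pt K (displacement (l k)))
        (lastEntrance y (l k))) w : ℕ) : ℝ) ≤ t * N + D := by
      have h1 := hGD k hk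
      simp only [G] at h1
      have h2 : 2 * (N : ℝ) / n + 2 * N / n ≤ t * N := by
        calc 2 * (N : ℝ) / n + 2 * N / n = 4 / n * N := by ring
          _ ≤ t * N := by gcongr
      push_cast
      linarith
    have hfinal' : ((2 * M + C k * (2 * M) + tdist (gate N (homeBlock M K v + pt K (displacement (l k)))
        (lastEntrance y (l k))) w : ℕ) : ℝ≥0) ≤ t * N + D := by
      rw [← NNReal.coe_le_coe]
      exact_mod_cast hfinal
    calc vol (tripExtra y (l k) K v w) ≤ ((2 * M : ℕ) : ℝ≥0∞) + ((C k * (2 * M) : ℕ) : ℝ≥0∞) +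
          (tdist (gate N (homeBlock M K v + pt K (displacement (l k))) (lastEntrance y (l k))) w : ℝ≥0∞) := by
          rw [tripExtra, vol_add, vol_add]
          gcongr
          · exact (vol_shortest_le _ _).trans (by exact_mod_cast e4)
          · refine (vol_mismatchFlow_le _ _ _).trans ?_
            exact_mod_cast Nat.mul_le_mul_right _ e5
          · exact vol_shortest_le _ _
      _ = (((2 * M + C k * (2 * M) + tdist (gate N (homeBlock M K v + pt K (displacement (l k)))
        (lastEntrance y (l k))) w : ℕ) : ℝ≥0) : ℝ≥0∞) := by push_cast; ring
      _ ≤ _ := by exact_mod_cast hfinal'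
  let h : TorusEdge N → ℝ≥0∞ := fun e =>
    mainPart (K := K) I W l (fun α _ b => wrapFlow N α b) e + restPart K I W l y e
  refine ⟨h, ?_, fun g hg => ⟨mainPart I W l g, stdFlow_parts hW1 y hg,
    mainPart_le hM hW2 hl hmix g⟩⟩
  have hwrap : vol (mainPart (K := K) I W l fun α _ b => wrapFlow N α b) ≤ S * N := by
    calc vol (mainPart (K := K) I W l fun α _ b => wrapFlow N α b)
        ≤ ∑ e, ∑ a : Bou M × Bou M, (Q₀ a.1 a.2 : ℝ≥0∞) * ∑ α : Fin K × Fin K, wrapFlow N α a.2 e :=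
          Finset.sum_le_sum fun e _ => mainPart_le hM hW2 hl hmix _ e
      _ = ∑ a : Bou M × Bou M, (Q₀ a.1 a.2 : ℝ≥0∞) * ∑ α : Fin K × Fin K, vol (wrapFlow N α a.2) := by
          rw [Finset.sum_comm]
          refine Finset.sum_congr rfl fun a _ => ?_
          rw [← Finset.mul_sum, Finset.sum_comm]
          rfl
      _ ≤ ∑ a : Bou M × Bou M, (Q₀ a.1 a.2 : ℝ≥0∞) * N := by
          gcongr with a _
          exact sum_vol_wrapFlow_le hK hKN a.2
      _ ≤ S * N := by
          rw [← Finset.sum_mul]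
          gcongr
          exact_mod_cast hS
  have hrest := vol_restPart_le hKN hW1 y hA hW3
  have hvol : vol h = vol (mainPart (K := K) I W l fun α _ b => wrapFlow N α b) +
      vol (restPart K I W l y) := vol_add _ _
  rw [hvol]
  calc _ ≤ (S : ℝ≥0∞) * N + (N * (t * N + D) + (2 * n * N + t * (N : ℝ≥0∞) ^ 2) + 2 * M * N) :=
        add_le_add hwrap hrest
    _ = 2 * t * (N : ℝ≥0∞) ^ 2 + (((S + D + 2 * n + 2 * M : ℕ) : ℝ≥0) : ℝ≥0∞) * N := by
        push_cast; ring
    _ ≤ 2 * t * (N : ℝ≥0∞) ^ 2 + ((t * N : ℝ≥0) : ℝ≥0∞) * N := by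
        gcongr
    _ = ((3 * t : ℝ≥0) : ℝ≥0∞) * (N : ℝ≥0∞) ^ 2 := by
        push_cast; ring
    _ = _ := by rw [ht]

end GlobalFlow

end
end RoutingFlow

namespace RoutingFlow
noncomputable section

/-! ### Capacity, convexity and the expected cost. -/

section Assembly

/-- Admixture of the uniform flow restores the capacity constraint. -/
lemma exists_feasible_of_stdFlow {N : ℕ} {B η : ℝ≥0} (hB : 1 / 4 < B) (hηB : η ≤ B - 1 / 4)
    {f m : TorusEdge N → ℝ≥0∞} (hf : StdFlow N f) (hfm : ∀ e, f e ≤ m e + η) (hm : ∀ e, m e ≤ B) :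
    ∃ g ∈ feasible N B, ∀ e, g e ≤ m e + (η / (B - 1 / 4) + η : ℝ≥0) := by
  obtain ⟨u, hu, hu4⟩ := exists_stdFlow_le_quarter N
  have hβ : 0 < B - 1 / 4 := tsub_pos_of_lt hB
  -- Replacing load `B` by `1/4` on a fraction `θ` gains `θ * (B - 1/4) = η`, just the excess of `f`
  -- over `B`.
  set θ : ℝ≥0 := η / (B - 1 / 4) with hθ
  have hθ1 : θ ≤ 1 := div_le_one_of_le₀ hηB zero_le
  have hu4' : ∀ e, u e ≤ ((1 / 4 : ℝ≥0) : ℝ≥0∞) := fun e => (hu4 e).trans (by simp)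
  refine ⟨fun e => ∑ j : Bool, (if j then (θ : ℝ≥0∞) else ((1 - θ : ℝ≥0) : ℝ≥0∞)) *
    (if j then u else f) e, ⟨StdFlow.isStandardizedGlobalFlow (StdFlow.sum ?_ ?_), fun e => ?_⟩,
    fun e => ?_⟩
  · simp only [Fintype.sum_bool, if_true, Bool.false_eq_true, if_false]
    rw [← ENNReal.coe_add, add_tsub_cancel_of_le hθ1, ENNReal.coe_one]
  · rintro (_ | _)
    · simpa using hf
    · simpa using hu
  · simp only [Fintype.sum_bool, if_true, Bool.false_eq_true, if_false]
    calc (θ : ℝ≥0∞) * u e + ((1 - θ : ℝ≥0) : ℝ≥0∞) * f e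
        ≤ θ * ((1 / 4 : ℝ≥0) : ℝ≥0∞) + ((1 - θ : ℝ≥0) : ℝ≥0∞) * (B + η) := by
          gcongr
          · exact hu4' e
          · exact (hfm e).trans (by gcongr; exact hm e)
      _ = ((θ * (1 / 4) + (1 - θ) * (B + η) : ℝ≥0) : ℝ≥0∞) := by push_cast; ring
      _ ≤ B := by
          rw [ENNReal.coe_le_coe, ← NNReal.coe_le_coe]
          have h1 : (θ : ℝ) * (B - 1 / 4) = η := by
            have : θ * (B - 1 / 4) = η := div_mul_cancel₀ η hβ.ne'
            rw [← NNReal.coe_inj, NNReal.coe_mul, NNReal.coe_sub hB.le] at this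
            simpa using this
          have h2 : (0 : ℝ) ≤ θ * η := by positivity
          push_cast [NNReal.coe_sub hθ1]
          nlinarith
  · simp only [Fintype.sum_bool, if_true, Bool.false_eq_true, if_false]
    calc (θ : ℝ≥0∞) * u e + ((1 - θ : ℝ≥0) : ℝ≥0∞) * f e ≤ θ * 1 + 1 * (m e + η) := by
          gcongr
          · exact (hu4 e).trans (by rw [one_div]; exact ENNReal.inv_le_one.2 (by norm_num))
          · exact_mod_cast tsub_le_self
          · exact hfm e
      _ = _ := by push_cast; ring

variable {M N K : ℕ} [NeZero N]

/-- The legs are `μ` conditioned on its end points. Pairs with `Q = 0` also need a unit flow, but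
any will do since it has weight 0 in the bound. -/
lemma exists_legs {Q : Transport M} (α : Fin K × Fin K) (μ : Measure (FinPath (square M)))
    (hμ : IsFiniteMeasure μ) (hQ : ∀ v w, tra μ v w = Q.extend v w) :
    ∃ g : Bou M → Bou M → TorusEdge N → ℝ≥0∞,
      (∀ b₁ b₂, UnitFlow (torus N) (gate N α b₁) (gate N α b₂) (g b₁ b₂)) ∧
      ∀ e, ∑ a : Bou M × Bou M, (Q a.1 a.2 : ℝ≥0∞) * g a.1 a.2 e ≤
        pushFlow (contracted M) (blockEdge N (blockIdx α)) (flo μ) e := by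
  classical
  obtain ⟨g, hg, hsum⟩ := exists_unitFlow_of_measure (ι := (Sum.inr : Bou M → SquareVertex M))
    Sum.inr_injective μ hμ
  simp only [hQ, Transport.extend] at hg hsum
  refine ⟨fun b₁ b₂ => if Q b₁ b₂ = 0 then shortest (gate N α b₁) (gate N α b₂) else
    pushFlow (contracted M) (blockEdge N (blockIdx α)) (g b₁ b₂), fun b₁ b₂ => ?_, fun e' => ?_⟩
  · by_cases h : Q b₁ b₂ = 0
    · simp only [h, if_true]
      exact unitFlow_shortest _ _
    · simp only [h, if_false]
      exact (hg b₁ b₂ (by simpa using h)).toBlock (blockIdx α)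
  · calc _ ≤ ∑ a : Bou M × Bou M, (Q a.1 a.2 : ℝ≥0∞) *
          pushFlow (contracted M) (blockEdge N (blockIdx α)) (g a.1 a.2) e' := by
          refine Finset.sum_le_sum fun a _ => ?_
          by_cases h : Q a.1 a.2 = 0 <;> simp [h]
      _ ≤ _ := by
          unfold pushFlow
          simp only [Finset.mul_sum]
          rw [Finset.sum_comm]
          refine Finset.sum_le_sum fun e _ => ?_
          refine le_trans (le_of_eq ?_) (hsum e)
          exact Fintype.sum_prod_type fun a : Bou M × Bou M => (Q a.1 a.2 : ℝ≥0∞) * g a.1 a.2 e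

/-- Admissibility of a path-flow does not involve the environment, and bounded loads have finite
cost; so finiteness for `c₀` passes to every `c`. -/
lemma exists_near_optimal {B : ℝ≥0} {Q : Transport M} {c₀ : SquareEdge M → ℝ≥0}
    (h : squareCost M B Q c₀ ≠ ∞) (c : SquareEdge M → ℝ≥0) {η : ℝ≥0} (hη : 0 < η) :
    ∃ μ : Measure (FinPath (square M)), IsFiniteMeasure μ ∧ (∀ v w, tra μ v w = Q.extend v w) ∧
      (∀ e, flo μ e ≤ B) ∧ cost (flo μ) c ≤ squareCost M B Q c + η := by
  have hne : squareCost M B Q c ≠ ∞ := by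
    have h' := lt_top_iff_ne_top.2 h
    simp only [squareCost, iInf_lt_iff] at h'
    obtain ⟨μ, hμ, -⟩ := h'
    refine ((iInf₂_le μ hμ).trans_lt (cost_lt_top (fun e => ?_) c)).ne
    exact ((hμ.2.2 e).trans_lt ENNReal.coe_lt_top).ne
  have hlt : squareCost M B Q c < squareCost M B Q c + η :=
    ENNReal.lt_add_right hne (by exact_mod_cast hη.ne')
  conv_lhs at hlt => unfold squareCost
  simp only [iInf_lt_iff] at hlt
  obtain ⟨μ, hμ, hlt⟩ := hlt
  exact ⟨μ, hμ.1, hμ.2.1, hμ.2.2, hlt.le⟩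

lemma cost_mono {E : Type} [Fintype E] {f f' : E → ℝ≥0∞} (h : ∀ e, f e ≤ f' e) (c : E → ℝ≥0) :
    cost f c ≤ cost f' c := by
  unfold cost
  gcongr with e _
  exact h e

lemma cost_add_const_le {E : Type} [Fintype E] {f : E → ℝ≥0∞} {B δ : ℝ≥0∞} (hf : ∀ e, f e ≤ B)
    (c : E → ℝ≥0) :
    cost (fun e => f e + δ) c ≤ cost f c + (2 * B * δ + δ ^ 2) * ∑ e, (c e : ℝ≥0∞) := by
  unfold cost
  rw [Finset.mul_sum, ← Finset.sum_add_distrib]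
  refine Finset.sum_le_sum fun e _ => ?_
  calc (c e : ℝ≥0∞) * (f e + δ) ^ 2 = c e * f e ^ 2 + (2 * f e * δ + δ ^ 2) * c e := by ring
    _ ≤ _ := by gcongr; exact hf e

lemma cost_average_le {E : Type} [Fintype E] {J : Type} [Fintype J] {m : J → ℝ≥0∞}
    (hm : ∑ j, m j = 1) (f : J → E → ℝ≥0∞) (c : E → ℝ≥0) :
    cost (fun e => ∑ j, m j * f j e) c ≤ ∑ j, m j * cost (f j) c := by
  unfold cost
  simp only [Finset.mul_sum]
  rw [Finset.sum_comm]
  refine Finset.sum_le_sum fun e _ => ?_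
  have h := ENNReal.rpow_arith_mean_le_arith_mean_rpow Finset.univ m (fun j => f j e) hm
    (one_le_two (α := ℝ))
  simp only [ENNReal.rpow_two] at h
  calc _ ≤ (c e : ℝ≥0∞) * ∑ j, m j * f j e ^ 2 := by gcongr
    _ = _ := by
      rw [Finset.mul_sum]
      exact Finset.sum_congr rfl fun j _ => by ring

lemma cost_shift (τ : TorusVertex N) (f : TorusEdge N → ℝ≥0∞) (c : TorusEdge N → ℝ≥0) :
    cost (fun e => f ((edgeShift τ).symm e)) c = cost f fun e => c (edgeShift τ e) := by
  unfold cost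
  rw [← Equiv.sum_comp (edgeShift τ)]
  simp

lemma sum_inv_card : ∑ _τ : TorusVertex N, ((N : ℝ≥0∞) ^ 2)⁻¹ = 1 := by
  rw [Finset.sum_const, nsmul_eq_mul, Finset.card_univ, card_torusVertex]
  exact ENNReal.mul_inv_cancel (by simp [NeZero.ne N]) (by finiteness)

/-- The deterministic upper bound for the cost of a good global flow. -/
lemma exists_feasible_cost_le [NeZero K] (hK : M * K ≤ N) {B η : ℝ≥0} (hη : 0 < η) (hB : 1 / 4 < B)
    (hηB : η ≤ B - 1 / 4) {Q₀ : Transport M} {c₀ : SquareEdge M → ℝ≥0}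
    (h₀ : squareCost M B Q₀ c₀ ≠ ∞) {h : TorusEdge N → ℝ≥0∞} (hvol : vol h ≤ η * (N : ℝ≥0∞) ^ 2)
    (hflow : ∀ g : Fin K × Fin K → Bou M → Bou M → TorusEdge N → ℝ≥0∞,
      (∀ α b₁ b₂, UnitFlow (torus N) (gate N α b₁) (gate N α b₂) (g α b₁ b₂)) →
      ∃ m : TorusEdge N → ℝ≥0∞, StdFlow N (fun e => m e + h e) ∧
        ∀ e, m e ≤ ∑ a : Bou M × Bou M, (Q₀ a.1 a.2 : ℝ≥0∞) * ∑ α, g α a.1 a.2 e)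
    (c : TorusEdge N → ℝ≥0) {δ : ℝ≥0} (hδ : δ = η / (B - 1 / 4) + η) :
    ∃ f ∈ feasible N B, cost f c ≤
      ((N : ℝ≥0∞) ^ 2)⁻¹ * ∑ τ : TorusVertex N, ∑ α : Fin K × Fin K,
        (squareCost M B Q₀ (blockEnv (blockIdx α) fun e => c (edgeShift τ e)) + η) +
      (2 * B * δ + δ ^ 2) * ∑ e, (c e : ℝ≥0∞) := by
  -- Each block of each translate is adapted to the environment it sees.
  choose μ hμfin hμtra hμB hμcost using fun (τ : TorusVertex N) (α : Fin K × Fin K) =>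
    exists_near_optimal h₀ (blockEnv (blockIdx α) fun e => c (edgeShift τ e)) hη
  choose g hg hgsum using fun (τ : TorusVertex N) (α : Fin K × Fin K) =>
    exists_legs (N := N) α (μ τ α) (hμfin τ α) (hμtra τ α)
  choose m hm hmle using fun τ => hflow (g τ) (hg τ)
  let b : TorusVertex N → TorusEdge N → ℝ≥0∞ := fun τ => blockSum N fun α => flo (μ τ α)
  have hmb : ∀ τ e, m τ e ≤ b τ e := by
    intro τ e
    refine (hmle τ e).trans ?_
    simp only [Finset.mul_sum]
    rw [Finset.sum_comm]
    exact Finset.sum_le_sum fun α _ => hgsum τ α e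
  have hbB : ∀ τ e, b τ e ≤ B := fun τ => blockSum_le hK fun α e => hμB τ α e
  let gbar : TorusEdge N → ℝ≥0∞ := fun e =>
    ∑ τ, ((N : ℝ≥0∞) ^ 2)⁻¹ * b τ ((edgeShift τ).symm e)
  have hbar : ∀ e, gbar e ≤ B := by
    intro e
    calc gbar e ≤ ∑ _τ : TorusVertex N, ((N : ℝ≥0∞) ^ 2)⁻¹ * B := by
          simp only [gbar]; gcongr; exact hbB _ _
      _ = B := by rw [← Finset.sum_mul, sum_inv_card, one_mul]
  have hgm : ∀ e, ∑ τ, ((N : ℝ≥0∞) ^ 2)⁻¹ *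
      (m τ ((edgeShift τ).symm e) + h ((edgeShift τ).symm e)) ≤ gbar e + η := by
    intro e
    simp only [mul_add, Finset.sum_add_distrib]
    refine add_le_add ?_ ?_
    · simp only [gbar]
      gcongr
      exact hmb _ _
    · rw [← Finset.mul_sum]
      calc _ ≤ ((N : ℝ≥0∞) ^ 2)⁻¹ * (η * (N : ℝ≥0∞) ^ 2) := by
            gcongr; exact (sum_edgeShift_le_vol h e).trans hvol
        _ = η := by
            rw [mul_comm, mul_assoc, ENNReal.mul_inv_cancel (by simp [NeZero.ne N]) (by finiteness),
              mul_one]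
  obtain ⟨f, hf, hle⟩ := exists_feasible_of_stdFlow hB hηB (StdFlow.average hm) hgm hbar
  refine ⟨f, hf, (cost_mono hle c).trans ((cost_add_const_le hbar c).trans ?_)⟩
  rw [hδ]
  refine add_le_add ?_ le_rfl
  -- Convexity: averaging the translates does not exceed the average of their costs.
  refine (cost_average_le sum_inv_card (fun τ e => b τ ((edgeShift τ).symm e)) c).trans ?_
  rw [Finset.mul_sum]
  gcongr with τ _
  rw [cost_shift]
  refine (cost_blockSum_le hK _ _).trans ?_
  gcongr with α _
  exact hμcost τ α

lemma lintegral_squareCost_blockEnv (κ : Measure ℝ≥0) [IsProbabilityMeasure κ] (hMN : M + 1 ≤ N)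
    (B : ℝ≥0) (Q : Transport M) (A : ℤ × ℤ) (τ : TorusVertex N) :
    ∫⁻ c, squareCost M B Q (blockEnv A fun e => c (edgeShift τ e)) ∂(torusEnvLaw κ N) =
      ∫⁻ c, squareCost M B Q c ∂(squareEnvLaw κ M) := by
  rw [← map_blockEnv κ hMN A τ, lintegral_map (measurable_squareCost M B Q)]
  refine measurable_pi_lambda _ fun e => ?_
  unfold blockEnv
  split_ifs
  · exact measurable_const
  · exact measurable_pi_apply _

lemma measurable_squareCost_blockEnv (B : ℝ≥0) (Q : Transport M) (A : ℤ × ℤ) (τ : TorusVertex N) :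
    Measurable fun c : TorusEdge N → ℝ≥0 =>
      squareCost M B Q (blockEnv A fun e => c (edgeShift τ e)) := by
  refine (measurable_squareCost M B Q).comp (measurable_pi_lambda _ fun e => ?_)
  unfold blockEnv
  split_ifs
  · exact measurable_const
  · exact measurable_pi_apply _

lemma lintegral_env_le {N : ℕ} (κ : Measure ℝ≥0) [IsProbabilityMeasure κ] {cstar : ℝ≥0}
    (hκ : κ (Set.Icc 0 cstar) = 1) (e : TorusEdge N) :
    ∫⁻ c, (c e : ℝ≥0∞) ∂(torusEnvLaw κ N) ≤ cstar := by
  have h1 : ∫⁻ c, (c e : ℝ≥0∞) ∂(torusEnvLaw κ N) = ∫⁻ x, (x : ℝ≥0∞) ∂κ := by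
    have := (measurePreserving_eval (fun _ : TorusEdge N => κ) e).lintegral_comp
      measurable_coe_nnreal_ennreal
    exact this
  rw [h1]
  have h2 : ∀ᵐ x ∂κ, x ∈ Set.Icc 0 cstar := (prob_compl_eq_zero_iff measurableSet_Icc).2 hκ
  calc ∫⁻ x, (x : ℝ≥0∞) ∂κ ≤ ∫⁻ _, (cstar : ℝ≥0∞) ∂κ := by
        refine lintegral_mono_ae ?_
        filter_upwards [h2] with x hx
        exact_mod_cast hx.2
    _ = cstar := by simp

/-- The bound for the expected cost on the torus of size `N`. -/
lemma lintegral_cost_le (κ : Measure ℝ≥0) [IsProbabilityMeasure κ] {cstar : ℝ≥0}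
    (hκ : κ (Set.Icc 0 cstar) = 1) (hMN : M + 1 ≤ N) {B η δ : ℝ≥0} {Q₀ : Transport M}
    {f : (TorusEdge N → ℝ≥0) → TorusEdge N → ℝ≥0∞}
    (hf : ∀ c, cost (f c) c ≤ ((N : ℝ≥0∞) ^ 2)⁻¹ * ∑ τ : TorusVertex N, ∑ α : Fin K × Fin K,
        (squareCost M B Q₀ (blockEnv (blockIdx α) fun e => c (edgeShift τ e)) + η) +
      (2 * B * δ + δ ^ 2) * ∑ e, (c e : ℝ≥0∞) + 1) :
    ∫⁻ c, cost (f c) c ∂(torusEnvLaw κ N) ≤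
      (K : ℝ≥0∞) ^ 2 * (∫⁻ c, squareCost M B Q₀ c ∂(squareEnvLaw κ M) + η) +
      (2 * B * δ + δ ^ 2) * (2 * (N : ℝ≥0∞) ^ 2 * cstar) + 1 := by
  have : IsProbabilityMeasure (torusEnvLaw κ N) := by unfold torusEnvLaw; infer_instance
  have hms := fun (α : Fin K × Fin K) (τ : TorusVertex N) =>
    measurable_squareCost_blockEnv B Q₀ (blockIdx α) τ
  have hme : ∀ e : TorusEdge N, Measurable fun c : TorusEdge N → ℝ≥0 => (c e : ℝ≥0∞) := fun e =>
    (measurable_pi_apply e).coe_nnreal_ennreal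
  refine (lintegral_mono hf).trans ?_
  rw [lintegral_add_right _ measurable_const, lintegral_add_left (by fun_prop),
    lintegral_const_mul _ (by fun_prop), lintegral_const_mul _ (by fun_prop)]
  -- Linearity of expectation suffices: only the law of each single block enters, not independence
  -- between blocks.
  have e1 : ∫⁻ c, ∑ τ : TorusVertex N, ∑ α : Fin K × Fin K,
      (squareCost M B Q₀ (blockEnv (blockIdx α) fun e => c (edgeShift τ e)) + η) ∂(torusEnvLaw κ N) =
      (N : ℝ≥0∞) ^ 2 * ((K : ℝ≥0∞) ^ 2 * (∫⁻ c, squareCost M B Q₀ c ∂(squareEnvLaw κ M) + η)) := by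
    rw [lintegral_finsetSum _ fun τ _ => by fun_prop]
    have : ∀ τ : TorusVertex N, ∫⁻ c, ∑ α : Fin K × Fin K,
        (squareCost M B Q₀ (blockEnv (blockIdx α) fun e => c (edgeShift τ e)) + η) ∂(torusEnvLaw κ N) =
        (K : ℝ≥0∞) ^ 2 * (∫⁻ c, squareCost M B Q₀ c ∂(squareEnvLaw κ M) + η) := by
      intro τ
      rw [lintegral_finsetSum _ fun α _ => by fun_prop]
      have h1 : ∀ α : Fin K × Fin K, ∫⁻ c,
          (squareCost M B Q₀ (blockEnv (blockIdx α) fun e => c (edgeShift τ e)) + η) ∂(torusEnvLaw κ N) =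
          ∫⁻ c, squareCost M B Q₀ c ∂(squareEnvLaw κ M) + η := by
        intro α
        rw [lintegral_add_right _ measurable_const, lintegral_squareCost_blockEnv κ hMN]
        simp
      simp only [h1]
      rw [Finset.sum_const, nsmul_eq_mul, Finset.card_univ, card_torusVertex]
    simp only [this]
    rw [Finset.sum_const, nsmul_eq_mul, Finset.card_univ, card_torusVertex]
  have e2 : ∫⁻ c, ∑ e, (c e : ℝ≥0∞) ∂(torusEnvLaw κ N) ≤ 2 * (N : ℝ≥0∞) ^ 2 * cstar := by
    rw [lintegral_finsetSum _ fun e _ => hme e]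
    calc _ ≤ ∑ _e : TorusEdge N, (cstar : ℝ≥0∞) :=
          Finset.sum_le_sum fun e _ => lintegral_env_le κ hκ e
      _ = _ := by
          rw [Finset.sum_const, nsmul_eq_mul, Finset.card_univ, Fintype.card_sum, Nat.cast_add,
            card_torusVertex]
          ring
  rw [e1, ← mul_assoc, ENNReal.inv_mul_cancel (by simp [NeZero.ne N]) (by finiteness), one_mul]
  gcongr
  simp

end Assembly

end
end RoutingFlow

namespace RoutingFlow
noncomputable section

/-! ### Passage to the limit. -/

section Limit

variable {M : ℕ}

lemma isProbabilityMeasure_squareEnvLaw (κ : Measure ℝ≥0) [IsProbabilityMeasure κ] (M : ℕ) :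
    IsProbabilityMeasure (squareEnvLaw κ M) := by
  unfold squareEnvLaw
  have : ∀ e : SquareEdge M, IsProbabilityMeasure (match e with
      | .inl _ => κ
      | .inr (.left, _) => κ
      | .inr (.bottom, _) => κ
      | .inr (.right, _) => Measure.dirac (0 : ℝ≥0)
      | .inr (.top, _) => Measure.dirac 0) := by
    rintro (_ | ⟨_ | _ | _ | _, _⟩) <;> dsimp only <;> infer_instance
  infer_instance

lemma exists_squareCost_ne_top {κ : Measure ℝ≥0} [IsProbabilityMeasure κ] {B : ℝ≥0}
    {Q : Transport M} (h : ∫⁻ c, squareCost M B Q c ∂(squareEnvLaw κ M) ≠ ∞) :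
    ∃ c, squareCost M B Q c ≠ ∞ := by
  have := isProbabilityMeasure_squareEnvLaw κ M
  by_contra! h'
  exact h (by simp [h'])

/-- The excess over the local cost per vertex, as a function of the volume of the remainder. -/
def excess (B cstar η : ℝ≥0) : ℝ≥0 :=
  η + (2 * B * (η / (B - 1 / 4) + η) + (η / (B - 1 / 4) + η) ^ 2) * (2 * cstar) + η

lemma tendsto_excess (B cstar : ℝ≥0) :
    Tendsto (fun η => (excess B cstar η : ℝ≥0∞)) (nhdsWithin 0 (Set.Ioi 0)) (nhds 0) := by
  have h : Continuous (excess B cstar) := by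
    unfold excess
    simp only [div_eq_mul_inv]
    fun_prop
  have h0 : (excess B cstar 0 : ℝ≥0∞) = 0 := by simp [excess]
  rw [← h0]
  exact ((ENNReal.continuous_coe.comp h).tendsto 0).mono_left nhdsWithin_le_nhds

/-- `K² / N² ≤ M⁻²`, and the last `η` absorbs the slack 1 of the selection. -/
lemma div_sq_le {N K : ℕ} (hM : 0 < M) (hN : 0 < N) (hK : M * K ≤ N) {J η D cstar : ℝ≥0∞}
    (hNη : ((N : ℝ≥0∞) ^ 2)⁻¹ ≤ η) :
    ((K : ℝ≥0∞) ^ 2 * (J + η) + D * (2 * (N : ℝ≥0∞) ^ 2 * cstar) + 1) / (N : ℝ≥0∞) ^ 2 ≤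
      J / (M : ℝ≥0∞) ^ 2 + (η + D * (2 * cstar) + η) := by
  have hN0 : ((N : ℝ≥0∞) ^ 2) ≠ 0 := by simp [hN.ne']
  have hNt : ((N : ℝ≥0∞) ^ 2) ≠ ∞ := by finiteness
  have hM0 : ((M : ℝ≥0∞) ^ 2) ≠ 0 := by simp [hM.ne']
  have hMt : ((M : ℝ≥0∞) ^ 2) ≠ ∞ := by finiteness
  have hKN : (K : ℝ≥0∞) ^ 2 / (N : ℝ≥0∞) ^ 2 ≤ ((M : ℝ≥0∞) ^ 2)⁻¹ := by
    refine ENNReal.div_le_of_le_mul ?_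
    rw [mul_comm, ← div_eq_mul_inv, ENNReal.le_div_iff_mul_le (Or.inl hM0) (Or.inl hMt)]
    exact_mod_cast (by rw [← mul_pow, mul_comm]; exact Nat.pow_le_pow_left hK 2 :
      K ^ 2 * M ^ 2 ≤ N ^ 2)
  have hM1 : ((M : ℝ≥0∞) ^ 2)⁻¹ ≤ 1 := by
    rw [ENNReal.inv_le_one]
    exact_mod_cast Nat.one_le_pow _ _ hM
  calc _ = (K : ℝ≥0∞) ^ 2 / (N : ℝ≥0∞) ^ 2 * (J + η) +
        D * (2 * cstar) * ((N : ℝ≥0∞) ^ 2 * ((N : ℝ≥0∞) ^ 2)⁻¹) + ((N : ℝ≥0∞) ^ 2)⁻¹ := by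
        simp only [div_eq_mul_inv]; ring
    _ ≤ ((M : ℝ≥0∞) ^ 2)⁻¹ * J + 1 * η + D * (2 * cstar) + η := by
        rw [ENNReal.mul_inv_cancel hN0 hNt, mul_one, mul_add]
        gcongr
        exact hKN.trans hM1
    _ = _ := by rw [div_eq_mul_inv]; ring

lemma tendsto_inv_sq : Tendsto (fun N : ℕ => ((N : ℝ≥0∞) ^ 2)⁻¹) atTop (nhds 0) := by
  have := ENNReal.Tendsto.pow (n := 2) ENNReal.tendsto_inv_nat_nhds_zero
  simpa [ENNReal.inv_pow] using this

lemma eventually_lintegral_cost_le {κ : Measure ℝ≥0} [IsProbabilityMeasure κ] {cstar : ℝ≥0}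
    (hκ : κ (Set.Icc 0 cstar) = 1) {B : ℝ≥0} (hB : 1 / 4 < B) (hM : 0 < M) {Q₀ : Transport M}
    (hQ₀ : Q₀ ∈ isotropic M) (hfin : ∫⁻ c, squareCost M B Q₀ c ∂(squareEnvLaw κ M) ≠ ∞)
    {f : (N : ℕ) → (TorusEdge N → ℝ≥0) → (TorusEdge N → ℝ≥0∞)}
    (hf : ∀ N c, ∀ g ∈ feasible N B, cost (f N c) c ≤ cost g c + 1)
    {η : ℝ≥0} (hη : 0 < η) (hηB : η ≤ B - 1 / 4) :
    ∀ᶠ N : ℕ in atTop, (∫⁻ c, cost (f N c) c ∂(torusEnvLaw κ N)) / (N : ℝ≥0∞) ^ 2 ≤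
      (∫⁻ c, squareCost M B Q₀ c ∂(squareEnvLaw κ M)) / (M : ℝ≥0∞) ^ 2 + excess B cstar η := by
  obtain ⟨c₀, h₀⟩ := exists_squareCost_ne_top hfin
  obtain ⟨N₀, hN₀⟩ := exists_global_flow hM hQ₀ hη
  filter_upwards [eventually_ge_atTop N₀, eventually_ge_atTop (M + 1),
    tendsto_inv_sq.eventually_le_const (u := (η : ℝ≥0∞)) (by exact_mod_cast hη)] with N hN hMN hNη
  have : NeZero N := ⟨by omega⟩
  have : NeZero (N / M) := ⟨(Nat.div_pos (by omega) hM).ne'⟩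
  have hK : M * (N / M) ≤ N := Nat.mul_div_le N M
  have hK' : N ≤ M * (N / M) + M := by
    have := Nat.div_add_mod N M
    have := Nat.mod_lt N hM
    omega
  obtain ⟨h, hvol, hflow⟩ := hN₀ N (N / M) hN hK hK'
  have hInt := lintegral_cost_le κ hκ hMN (K := N / M) (f := f N) (Q₀ := Q₀) (B := B) (η := η)
    (δ := η / (B - 1 / 4) + η) fun c => by
      obtain ⟨g, hg, hgc⟩ := exists_feasible_cost_le hK hη hB hηB h₀ hvol hflow c rfl
      exact (hf N c g hg).trans (by gcongr)
  refine (ENNReal.div_le_div_right hInt _).trans ((div_sq_le hM (by omega) hK hNη).trans ?_)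
  simp only [excess]
  push_cast
  exact le_rfl

lemma limsup_cost_le {κ : Measure ℝ≥0} [IsProbabilityMeasure κ] {cstar : ℝ≥0}
    (hκ : κ (Set.Icc 0 cstar) = 1) {B : ℝ≥0} (hB : 1 / 4 < B) (hM : 0 < M)
    {f : (N : ℕ) → (TorusEdge N → ℝ≥0) → (TorusEdge N → ℝ≥0∞)}
    (hf : ∀ N c, ∀ g ∈ feasible N B, cost (f N c) c ≤ cost g c + 1) :
    limsup (fun N : ℕ => (∫⁻ c, cost (f N c) c ∂(torusEnvLaw κ N)) / (N : ℝ≥0∞) ^ 2) atTop ≤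
      localCost κ B M / (M : ℝ≥0∞) ^ 2 := by
  have hM0 : ((M : ℝ≥0∞) ^ 2) ≠ 0 := by simp [hM.ne']
  have hMt : ((M : ℝ≥0∞) ^ 2) ≠ ∞ := by finiteness
  -- With `M²` on the left, the infimum in `localCost` can be tested on each `Q₀` separately.
  rw [ENNReal.le_div_iff_mul_le (Or.inl hM0) (Or.inl hMt)]
  refine le_iInf₂ fun Q₀ hQ₀ => ?_
  rw [← ENNReal.le_div_iff_mul_le (Or.inl hM0) (Or.inl hMt)]
  by_cases hfin : ∫⁻ c, squareCost M B Q₀ c ∂(squareEnvLaw κ M) = ∞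
  · rw [hfin, ENNReal.top_div_of_ne_top hMt]
    exact le_top
  have hlim := (tendsto_excess B cstar).const_add
    ((∫⁻ c, squareCost M B Q₀ c ∂(squareEnvLaw κ M)) / (M : ℝ≥0∞) ^ 2)
  rw [add_zero] at hlim
  -- `f` does not depend on `η`, so `η` may tend to 0 after `N` has tended to infinity.
  refine ge_of_tendsto hlim ?_
  filter_upwards [Ioc_mem_nhdsGT (tsub_pos_of_lt hB)] with η hη
  exact limsup_le_of_le (by isBoundedDefault)
    (eventually_lintegral_cost_le hκ hB hM hQ₀ hfin hf hη.1 hη.2)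

end Limit

end
end RoutingFlow

theorem proposition17 (κ : Measure ℝ≥0) [IsProbabilityMeasure κ]
    (cstar : ℝ≥0) (hcstar : 0 < cstar) (hκ : κ (Set.Icc 0 cstar) = 1)
    (B : ℝ≥0) (hB : 1 / 4 < B) :
    ∃ f : (N : ℕ) → (RoutingFlow.TorusEdge N → ℝ≥0) → (RoutingFlow.TorusEdge N → ℝ≥0∞),
      (∀ N, Measurable (f N)) ∧
      (∀ N c, RoutingFlow.IsStandardizedGlobalFlow N (f N c)) ∧
      (∀ N c e, f N c e ≤ B) ∧
      ∀ M : ℕ, 1 ≤ M →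
        limsup (fun N : ℕ =>
            (∫⁻ c, RoutingFlow.cost (f N c) c ∂(RoutingFlow.torusEnvLaw κ N)) / (N : ℝ≥0∞) ^ 2)
          atTop ≤ RoutingFlow.localCost κ B M / (M : ℝ≥0∞) ^ 2 := by
  -- Near-optimality among all feasible flows makes the choice independent of `M`.
  choose f hmeas hfeas hopt using fun N => RoutingFlow.exists_measurable_selection N hB
  exact ⟨f, hmeas, fun N c => (hfeas N c).1, fun N c => (hfeas N c).2,
    fun M hM => RoutingFlow.limsup_cost_le hκ hB hM hopt⟩
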